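/- **Theorem (maximizing the second Robin eigenvalue on rectangles, with length scaling).** A rectangle $\mathcal R=(x_0,x_1)\times(y_0,y_1)$ is a product of two bounded nonempty open intervals; $A$ denotes its area and $L$ the length of its boundary; it is a square if its sides have equal length. For $a\in\mathbb R$ let $\lambda_k(\mathcal R;a)$, $k=1,2,\dots$, be the $k$-th eigenvalue of the Robin Laplacian ($-\Delta u=\lambda u$ in $\mathcal R$, $\partial u/\partial\nu+a u=0$ on $\partial\mathcal R$), that is $$\lambda_k(\mathcal R;a)=\min_{U_k}\ \max_{u\in U_k\setminus 0}\ \frac{\int_{\mathcal R}|\nabla u|^2\,dx+a\int_{\partial\mathcal R}u^2\,dS}{\int_{\mathcal R}u^2\,dx},$$ where $U_k$ ranges over the $k$-dimensional subspaces of $H^1(\mathcal R)$ and $u$ is taken on $\partial\mathcal R$ in the sense of traces. Let $g_1^{-1},g_2^{-1},h_1^{-1},h_2^{-1}$ be the inverses of the strictly increasing bijections $g_1(x)=x\tan x:(0,\pi/2)\to(0,\infty)$, $g_2(x)=-x\cot x:(0,\pi)\to(-1,\infty)$, $h_1(x)=x\tanh x:(0,\infty)\to(0,\infty)$, $h_2(x)=x\coth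 x:(0,\infty)\to(1,\infty)$. The equation $$g_1^{-1}(\alpha/8)^2+g_2^{-1}(\alpha/8)^2=\alpha/4$$ has exactly one root $\alpha_+$ in $(0,\infty)$, and the equation $$h_1^{-1}(|\alpha|/8)^2+h_2^{-1}(|\alpha|/8)^2=|\alpha|/4$$ has exactly one root $\alpha_-$ in $(-\infty,-8)$; numerically $|\alpha_+-33.2054|<10^{-4}$ and $|\alpha_-+9.3885|<10^{-4}$. Moreover: 1. If $\alpha\in[\alpha_-,\alpha_+]$, then $\lambda_2(\mathcal R;\alpha/L)A$ is maximal for the square and only the square, among rectangles: for every square $\mathcal S$ and every rectangle $\mathcal R$, $\lambda_2(\mathcal R;\alpha/L(\mathcal R))A(\mathcal R)\le\lambda_2(\mathcal S;\alpha/L(\mathcal S))A(\mathcal S)$, with equality if and only if $\mathcal R$ is a square. 2. If $\alpha\notin[\alpha_-,\alpha_+]$, then $\lambda_2(\mathcal R;\alpha/L)A<\alpha$ for every rectangle $\mathcal R$, and $\lambda_2(\mathcal R;\alpha/L)A\to\alpha$ as $\mathcal R$ degenerates to a line segment, that is, as the ratio of its longer to its shorter side tends to infinity. -/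

import Mathlib

open Set Filter MeasureTheory
open scoped ContDiff

noncomputable section

/-- A (nonempty, bounded, open) rectangle `(x₀, x₁) × (y₀, y₁)` in the plane. -/
structure Rect where
  x₀ : ℝ
  x₁ : ℝ
  y₀ : ℝ
  y₁ : ℝ
  hx : x₀ < x₁
  hy : y₀ < y₁

namespace Rect

/-- The open rectangle as a subset of the plane. -/
def carrier (R : Rect) : Set (ℝ × ℝ) := Ioo R.x₀ R.x₁ ×ˢ Ioo R.y₀ R.y₁

def width (R : Rect) : ℝ := R.x₁ - R.x₀

def height (R : Rect) : ℝ := R.y₁ - R.y₀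

/-- The area `A`. -/
def area (R : Rect) : ℝ := R.width * R.height

/-- The length `L` of the boundary. -/
def perimeter (R : Rect) : ℝ := 2 * (R.width + R.height)

def IsSquare (R : Rect) : Prop := R.width = R.height

/-- The ratio of the longer side to the shorter side. -/
def aspectRatio (R : Rect) : ℝ := max R.width R.height / min R.width R.height

/-- The filter of rectangles degenerating to a line segment: the aspect ratio tends to infinity. -/
def degenerating : Filter Rect := comap aspectRatio atTop

/-- Lebesgue measure on the rectangle. -/
def areaMeasure (R : Rect) : Measure (ℝ × ℝ) := volume.restrict R.carrier

/-- Arc length measure `dS` on the boundary: the sum of the one-dimensional Lebesgue measures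
of the two horizontal and the two vertical sides. -/
def boundaryMeasure (R : Rect) : Measure (ℝ × ℝ) :=
  (volume.restrict (Ioo R.x₀ R.x₁)).map (fun x : ℝ => (x, R.y₀)) +
  (volume.restrict (Ioo R.x₀ R.x₁)).map (fun x : ℝ => (x, R.y₁)) +
  (volume.restrict (Ioo R.y₀ R.y₁)).map (fun y : ℝ => (R.x₀, y)) +
  (volume.restrict (Ioo R.y₀ R.y₁)).map (fun y : ℝ => (R.x₁, y))

/-- The real Hilbert space `L²(R)`. -/
abbrev L2 (R : Rect) := Lp ℝ 2 R.areaMeasure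

/-- `p ∈ L²(R)` is the weak derivative of `u ∈ L²(R)` in the direction `v`. -/
def IsWeakDeriv (R : Rect) (v : ℝ × ℝ) (u p : R.L2) : Prop :=
  ∀ φ : ℝ × ℝ → ℝ, ContDiff ℝ ∞ φ → HasCompactSupport φ → tsupport φ ⊆ R.carrier →
    ∫ z, u z * fderiv ℝ φ z v ∂(R.areaMeasure) = - ∫ z, p z * φ z ∂(R.areaMeasure)

theorem integrable_L2_mul (R : Rect) (u : R.L2) {ψ : ℝ × ℝ → ℝ} (hψ : Continuous ψ)
    (hc : HasCompactSupport ψ) : Integrable (fun z => u z * ψ z) R.areaMeasure := by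
  have : IsFiniteMeasureOnCompacts R.areaMeasure := by
    unfold areaMeasure; infer_instance
  exact (Lp.memLp u).integrable_mul (hψ.memLp_of_hasCompactSupport hc (p := 2))

theorem IsWeakDeriv.zero (R : Rect) (v : ℝ × ℝ) : R.IsWeakDeriv v 0 0 := by
  intro φ _ _ _
  have h (ψ : ℝ × ℝ → ℝ) : ∫ z, (0 : R.L2) z * ψ z ∂(R.areaMeasure) = 0 :=
    integral_eq_zero_of_ae ((Lp.coeFn_zero ℝ 2 R.areaMeasure).mono fun z hz => by
      simp only [hz, Pi.zero_apply, zero_mul])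
  rw [h φ, h (fun z => fderiv ℝ φ z v), neg_zero]

theorem IsWeakDeriv.smul {R : Rect} {v : ℝ × ℝ} {u p : R.L2} (c : ℝ)
    (h : R.IsWeakDeriv v u p) : R.IsWeakDeriv v (c • u) (c • p) := by
  intro φ h1 h2 h3
  have key (w : R.L2) (ψ : ℝ × ℝ → ℝ) :
      ∫ z, (c • w) z * ψ z ∂(R.areaMeasure) = c * ∫ z, w z * ψ z ∂(R.areaMeasure) := by
    rw [← integral_const_mul]
    refine integral_congr_ae ((Lp.coeFn_smul c w).mono fun z hz => ?_)
    simp only [hz, Pi.smul_apply, smul_eq_mul, mul_assoc]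
  rw [key p φ, key u (fun z => fderiv ℝ φ z v), h φ h1 h2 h3, mul_neg]

theorem IsWeakDeriv.add {R : Rect} {v : ℝ × ℝ} {u p u' p' : R.L2}
    (h : R.IsWeakDeriv v u p) (h' : R.IsWeakDeriv v u' p') :
    R.IsWeakDeriv v (u + u') (p + p') := by
  intro φ h1 h2 h3
  have key (w w' : R.L2) {ψ : ℝ × ℝ → ℝ} (hψ : Continuous ψ) (hc : HasCompactSupport ψ) :
      ∫ z, (w + w') z * ψ z ∂(R.areaMeasure) =
        ∫ z, w z * ψ z ∂(R.areaMeasure) + ∫ z, w' z * ψ z ∂(R.areaMeasure) := by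
    rw [← integral_add (R.integrable_L2_mul w hψ hc) (R.integrable_L2_mul w' hψ hc)]
    refine integral_congr_ae ((Lp.coeFn_add w w').mono fun z hz => ?_)
    simp only [hz, Pi.add_apply, add_mul]
  have hd : Continuous (fun z => fderiv ℝ φ z v) :=
    (h1.continuous_fderiv (by simp)).clm_apply continuous_const
  rw [key p p' h1.continuous h2, key u u' hd (h2.fderiv_apply (𝕜 := ℝ) v), h φ h1 h2 h3,
    h' φ h1 h2 h3, neg_add]

/-- The Sobolev space `H¹(R)`: functions in `L²(R)` whose weak partial derivatives exist
and belong to `L²(R)`. -/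
def H1 (R : Rect) : Submodule ℝ R.L2 where
  carrier := {u | (∃ p, R.IsWeakDeriv (1, 0) u p) ∧ (∃ q, R.IsWeakDeriv (0, 1) u q)}
  zero_mem' := ⟨⟨0, IsWeakDeriv.zero R _⟩, ⟨0, IsWeakDeriv.zero R _⟩⟩
  add_mem' := by
    rintro u u' ⟨⟨p, hp⟩, ⟨q, hq⟩⟩ ⟨⟨p', hp'⟩, ⟨q', hq'⟩⟩
    exact ⟨⟨p + p', hp.add hp'⟩, ⟨q + q', hq.add hq'⟩⟩
  smul_mem' := by
    rintro c u ⟨⟨p, hp⟩, ⟨q, hq⟩⟩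
    exact ⟨⟨c • p, hp.smul c⟩, ⟨c • q, hq.smul c⟩⟩

open Classical in
/-- The weak derivative of `u` in the direction `v` (it is unique in `L²(R)` when it exists;
`0` when it does not, which does not happen for `u ∈ H¹(R)` and a coordinate direction `v`). -/
def weakDeriv (R : Rect) (v : ℝ × ℝ) (u : R.L2) : R.L2 :=
  if h : ∃ p, R.IsWeakDeriv v u p then h.choose else 0

/-- The boundary function `g ∈ L²(∂R)` is the trace of `u ∈ H¹(R)`: some sequence of functions
that are smooth up to the boundary converges to `u` in `H¹(R)`, and the boundary values of these
functions converge to `g` in `L²(∂R)`. -/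
def IsTrace (R : Rect) (u : R.L2) (g : Lp ℝ 2 R.boundaryMeasure) : Prop :=
  ∃ φ : ℕ → ℝ × ℝ → ℝ, (∀ n, ContDiff ℝ ∞ (φ n)) ∧
    Tendsto (fun n => eLpNorm (fun z => φ n z - u z) 2 R.areaMeasure) atTop (nhds 0) ∧
    Tendsto (fun n => eLpNorm (fun z => fderiv ℝ (φ n) z (1, 0) - R.weakDeriv (1, 0) u z) 2
      R.areaMeasure) atTop (nhds 0) ∧
    Tendsto (fun n => eLpNorm (fun z => fderiv ℝ (φ n) z (0, 1) - R.weakDeriv (0, 1) u z) 2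
      R.areaMeasure) atTop (nhds 0) ∧
    Tendsto (fun n => eLpNorm (fun z => φ n z - g z) 2 R.boundaryMeasure) atTop (nhds 0)

open Classical in
/-- The trace of `u ∈ H¹(R)` on the boundary (it exists and is unique in `L²(∂R)`). -/
def trace (R : Rect) (u : R.L2) : Lp ℝ 2 R.boundaryMeasure :=
  if h : ∃ g, R.IsTrace u g then h.choose else 0

/-- The Rayleigh quotient of the Robin Laplacian with parameter `a`:
`(∫_R |∇u|² dx + a ∫_{∂R} u² dS) / ∫_R u² dx`. -/
def rayleigh (R : Rect) (a : ℝ) (u : R.L2) : ℝ :=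
  ((∫ z, ((R.weakDeriv (1, 0) u z) ^ 2 + (R.weakDeriv (0, 1) u z) ^ 2) ∂(R.areaMeasure)) +
    a * ∫ z, (R.trace u z) ^ 2 ∂(R.boundaryMeasure)) / ∫ z, (u z) ^ 2 ∂(R.areaMeasure)

/-- The `k`-th eigenvalue `λ_k(R; a)`, `k = 1, 2, …`, of the Robin Laplacian on `R`, by the minimax
principle: the smallest value, over the `k`-dimensional subspaces `U` of `H¹(R)`, of the maximum of
the Rayleigh quotient over the nonzero elements of `U`. -/
def robinEigenvalue (R : Rect) (a : ℝ) (k : ℕ) : ℝ :=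
  sInf {Λ : ℝ | ∃ U : Submodule ℝ R.L2, U ≤ R.H1 ∧ Module.finrank ℝ U = k ∧
    IsGreatest {r : ℝ | ∃ u ∈ U, u ≠ 0 ∧ R.rayleigh a u = r} Λ}

/-- The scale invariant quantity `λ₂(R; α / L) A`. -/
def scaledSecondEigenvalue (α : ℝ) (R : Rect) : ℝ :=
  R.robinEigenvalue (α / R.perimeter) 2 * R.area

end Rect

/-- The inverse of `g₁(x) = x tan x`, `g₁ : (0, π/2) → (0, ∞)`. -/
def g₁Inv : ℝ → ℝ := Function.invFunOn (fun x => x * Real.tan x) (Ioo 0 (Real.pi / 2))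

/-- The inverse of `g₂(x) = -x cot x`, `g₂ : (0, π) → (-1, ∞)`. -/
def g₂Inv : ℝ → ℝ := Function.invFunOn (fun x => -x * Real.cot x) (Ioo 0 Real.pi)

/-- The inverse of `h₁(x) = x tanh x`, `h₁ : (0, ∞) → (0, ∞)`. -/
def h₁Inv : ℝ → ℝ := Function.invFunOn (fun x => x * Real.tanh x) (Ioi 0)

/-- The inverse of `h₂(x) = x coth x`, `h₂ : (0, ∞) → (1, ∞)`. -/
def h₂Inv : ℝ → ℝ := Function.invFunOn (fun x => x * (Real.cosh x / Real.sinh x)) (Ioi 0)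

/-- The equation that determines `α₊`, for `a > 0` (so that `a / 8` is in the range of
`g₁` and of `g₂`). -/
def IsAlphaPlus (a : ℝ) : Prop :=
  0 < a ∧ g₁Inv (a / 8) ^ 2 + g₂Inv (a / 8) ^ 2 = a / 4

/-- The equation that determines `α₋`, for `a < -8` (so that `|a| / 8` is in the range of
`h₁` and of `h₂`). -/
def IsAlphaMinus (a : ℝ) : Prop :=
  a < -8 ∧ h₁Inv (|a| / 8) ^ 2 + h₂Inv (|a| / 8) ^ 2 = |a| / 4

end

open scoped Topology Interval

/-! ### Picone's inequality and the one-dimensional Robin problem on `[-1, 1]` -/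

/-! Separation of variables reduces everything to the first two Robin eigenvalues `μ₁(c)` and
`μ₂(c)` of `[-1, 1]`, namely `evenEigenvalue` and `oddEigenvalue`. Put `c = α / 8` and let the sides
of a rectangle be in the ratio `τ : (2 - τ)` with `τ ≤ 1`. The ground state of the short side,
multiplied by the first two modes of the long side, spans a trial space that gives `λ₂ A ≤ 4 T(c,
τ)`, where `T` is `trialValue` and `T(c, 1) = μ₁(c) + μ₂(c)`. For rectangles that are not squares
this upper bound suffices; only for the square must it be shown to be exact.

The competition is between `4 T(c, 1)` and the degenerate value `α = 4 · 2c`, so the sign of `D(c) =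
μ₁(c) + μ₂(c) - 2c` (`squareExcess`) decides. An eigenfunction for `c` is a trial function for every
`c'`, with energy affine in `c'`; hence `μ₁`, `μ₂` and `D` are concave. Since `D(0) = π² / 4 > 0`,
there is at most one zero on each side of `0`; four rigorous sign evaluations show that both exist
and enclose them. They are `α₋ / 8` and `α₊ / 8`.

If `D(c) ≥ 0`, then `T(c, τ) < T(c, 1)` for `τ < 1` in the relevant range (`trialValue_lt`). This
combines the concavity of `μ₂` with a quantitative comparison of `μ₁(cτ)` and `μ₁(c)`, which comes
from Wilker's inequality for `c > 0` and a hyperbolic analogue for `c < 0`. Beyond the roots, `T(c,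
τ) - 2c` is concave in `c`, positive at `0` and nonpositive at the root, hence negative, which gives
`λ₂ A < α`. The limit follows from `λ₂ ≥ λ₁` and `μ₁(c) ≥ c - c²`.

Exactness on the square (`Rect.scaledSecondEigenvalue_of_isSquare`) needs a lower bound on all of
`H¹`. In one dimension, a Darboux transform shows that even functions orthogonal to the ground state
have Rayleigh quotient at least `π² + 2μ₁`, which is at least `μ₂` in the relevant range. In two
dimensions one integrates over slices and pays with a single rank-one correction, which vanishes
somewhere on every two-dimensional subspace. The slices are taken of smooth functions, so their
density in `H¹` and a trace inequality are proved as well. -/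

/-- Picone's identity for a positive solution `v` of `v'' = -μ v`. -/
theorem picone_identity {a b μ : ℝ} (hab : a ≤ b) {f f' v v' : ℝ → ℝ}
    (hf : ∀ x ∈ Icc a b, HasDerivAt f (f' x) x) (hf' : ContinuousOn f' (Icc a b))
    (hv : ∀ x ∈ Icc a b, HasDerivAt v (v' x) x)
    (hv' : ∀ x ∈ Icc a b, HasDerivAt v' (-μ * v x) x)
    (hpos : ∀ x ∈ Icc a b, 0 < v x) :
    μ * (∫ x in a..b, f x ^ 2) + f b ^ 2 * (v' b / v b) - f a ^ 2 * (v' a / v a) +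
      ∫ x in a..b, (f' x - v' x / v x * f x) ^ 2 = ∫ x in a..b, f' x ^ 2 := by
  have hu : uIcc a b = Icc a b := uIcc_of_le hab
  have cf : ContinuousOn f (Icc a b) := fun x hx => (hf x hx).continuousAt.continuousWithinAt
  have cv : ContinuousOn v (Icc a b) := fun x hx => (hv x hx).continuousAt.continuousWithinAt
  have cv' : ContinuousOn v' (Icc a b) := fun x hx => (hv' x hx).continuousAt.continuousWithinAt
  have cq : ContinuousOn (fun x => v' x / v x) (Icc a b) :=
    cv'.div cv fun x hx => (hpos x hx).ne'
  have i1 : IntervalIntegrable (fun x => f' x ^ 2) volume a b :=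
    (hf'.pow 2).intervalIntegrable_of_Icc hab
  have i2 : IntervalIntegrable (fun x => μ * f x ^ 2) volume a b :=
    ((cf.pow 2).const_mul μ |>.congr fun x _ => rfl).intervalIntegrable_of_Icc hab
  have i3 : IntervalIntegrable (fun x => (f' x - v' x / v x * f x) ^ 2) volume a b :=
    ((hf'.sub (cq.mul cf)).pow 2).intervalIntegrable_of_Icc hab
  -- The integrand is the derivative of `f² v' / v`; the equation `v'' = -μ v` supplies the term
  -- with `μ`.
  have key : ∫ x in a..b, (f' x ^ 2 - μ * f x ^ 2 - (f' x - v' x / v x * f x) ^ 2) =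
      f b ^ 2 * (v' b / v b) - f a ^ 2 * (v' a / v a) := by
    apply intervalIntegral.integral_eq_sub_of_hasDerivAt (f := fun x => f x ^ 2 * (v' x / v x))
    · intro x hx
      rw [hu] at hx
      have h0 := (hpos x hx).ne'
      refine HasDerivAt.congr_deriv (((hf x hx).pow 2).mul ((hv' x hx).div (hv x hx) h0)) ?_
      simp only [Pi.pow_apply]
      field_simp
      ring
    · exact (i1.sub i2).sub i3
  rw [intervalIntegral.integral_sub (i1.sub i2) i3, intervalIntegral.integral_sub i1 i2,
    intervalIntegral.integral_const_mul] at key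
  linarith

/-- Picone's inequality for a positive solution `v` of `v'' = -μ v`. -/
theorem picone {a b μ : ℝ} (hab : a ≤ b) {f f' v v' : ℝ → ℝ}
    (hf : ∀ x ∈ Icc a b, HasDerivAt f (f' x) x) (hf' : ContinuousOn f' (Icc a b))
    (hv : ∀ x ∈ Icc a b, HasDerivAt v (v' x) x)
    (hv' : ∀ x ∈ Icc a b, HasDerivAt v' (-μ * v x) x)
    (hpos : ∀ x ∈ Icc a b, 0 < v x) :
    μ * (∫ x in a..b, f x ^ 2) + f b ^ 2 * (v' b / v b) - f a ^ 2 * (v' a / v a) ≤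
      ∫ x in a..b, f' x ^ 2 := by
  have := picone_identity hab hf hf' hv hv' hpos
  have h3 : 0 ≤ ∫ x in a..b, (f' x - v' x / v x * f x) ^ 2 :=
    intervalIntegral.integral_nonneg hab fun x _ => sq_nonneg _
  linarith

/-- `v` is a positive even solution of the Robin problem on `[-1, 1]` with parameter `c`
and eigenvalue `μ`. -/
structure EvenMode (c μ : ℝ) (v : ℝ → ℝ) : Prop where
  smooth : ContDiff ℝ ∞ v
  ode : ∀ x, deriv (deriv v) x = -μ * v x
  even : ∀ x, v (-x) = v x
  pos : ∀ x ∈ Icc (0 : ℝ) 1, 0 < v x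
  bc : deriv v 1 + c * v 1 = 0

/-- `v` is an odd solution, positive on `(0, 1]`, of the Robin problem on `[-1, 1]` with
parameter `c` and eigenvalue `μ`. -/
structure OddMode (c μ : ℝ) (v : ℝ → ℝ) : Prop where
  smooth : ContDiff ℝ ∞ v
  ode : ∀ x, deriv (deriv v) x = -μ * v x
  odd : ∀ x, v (-x) = -v x
  pos : ∀ x ∈ Ioc (0 : ℝ) 1, 0 < v x
  bc : deriv v 1 + c * v 1 = 0

theorem ContDiff.hasDerivAt_deriv {v : ℝ → ℝ} (h : ContDiff ℝ ∞ v) (x : ℝ) :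
    HasDerivAt v (deriv v x) x :=
  (h.differentiable (by simp)).differentiableAt.hasDerivAt

theorem ContDiff.contDiff_deriv {v : ℝ → ℝ} (h : ContDiff ℝ ∞ v) : ContDiff ℝ ∞ (deriv v) :=
  (contDiff_infty_iff_deriv.1 h).2

theorem ContDiff.hasDerivAt_deriv_of_one {f : ℝ → ℝ} (h : ContDiff ℝ 1 f) (x : ℝ) :
    HasDerivAt f (deriv f x) x :=
  (h.differentiable one_ne_zero).differentiableAt.hasDerivAt

theorem deriv_odd_of_even {v : ℝ → ℝ} (h : ∀ x, v (-x) = v x) (x : ℝ) :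
    deriv v (-x) = -deriv v x := by
  have := deriv_comp_neg v x
  rw [show (fun x => v (-x)) = v from funext h] at this
  rw [this, neg_neg]

theorem deriv_even_of_odd {v : ℝ → ℝ} (h : ∀ x, v (-x) = -v x) (x : ℝ) :
    deriv v (-x) = deriv v x := by
  have := deriv_comp_neg v x
  rw [show (fun x => v (-x)) = fun x => -v x from funext h, deriv.fun_neg] at this
  linarith

namespace EvenMode

variable {c μ : ℝ} {v : ℝ → ℝ}

theorem hasDerivAt (h : EvenMode c μ v) (x : ℝ) : HasDerivAt v (deriv v x) x :=
  h.smooth.hasDerivAt_deriv x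

theorem hasDerivAt_deriv (h : EvenMode c μ v) (x : ℝ) : HasDerivAt (deriv v) (-μ * v x) x := by
  rw [← h.ode x]; exact h.smooth.contDiff_deriv.hasDerivAt_deriv x

theorem pos' (h : EvenMode c μ v) (x : ℝ) (hx : x ∈ Icc (-1 : ℝ) 1) : 0 < v x := by
  rcases le_total 0 x with h0 | h0
  · exact h.pos x ⟨h0, hx.2⟩
  · rw [← h.even]; exact h.pos _ ⟨by linarith, by linarith [hx.1]⟩

theorem deriv_zero (h : EvenMode c μ v) : deriv v 0 = 0 := by
  have := deriv_odd_of_even h.even 0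
  rw [neg_zero] at this; linarith

theorem quot_one (h : EvenMode c μ v) : deriv v 1 / v 1 = -c := by
  have h1 := h.pos 1 (by simp)
  rw [div_eq_iff h1.ne']; linarith [h.bc]

/-- The lowest Robin eigenvalue bounds the Robin energy from below. -/
theorem energy_le (h : EvenMode c μ v) {f : ℝ → ℝ} (hf : ContDiff ℝ 1 f) :
    μ * (∫ x in (-1 : ℝ)..1, f x ^ 2) ≤
      (∫ x in (-1 : ℝ)..1, deriv f x ^ 2) + c * (f (-1) ^ 2 + f 1 ^ 2) := by
  have := picone (a := -1) (b := 1) (by norm_num) (fun x _ => hf.hasDerivAt_deriv_of_one x)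
    (hf.continuous_deriv le_rfl).continuousOn (fun x _ => h.hasDerivAt x)
    (fun x _ => h.hasDerivAt_deriv x) h.pos'
  rw [deriv_odd_of_even h.even, h.even, neg_div, h.quot_one] at this
  linarith

end EvenMode

namespace OddMode

variable {c μ : ℝ} {v : ℝ → ℝ}

theorem hasDerivAt (h : OddMode c μ v) (x : ℝ) : HasDerivAt v (deriv v x) x :=
  h.smooth.hasDerivAt_deriv x

theorem hasDerivAt_deriv (h : OddMode c μ v) (x : ℝ) : HasDerivAt (deriv v) (-μ * v x) x := by
  rw [← h.ode x]; exact h.smooth.contDiff_deriv.hasDerivAt_deriv x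

theorem zero (h : OddMode c μ v) : v 0 = 0 := by
  have := h.odd 0
  rw [neg_zero] at this; linarith

theorem quot_one (h : OddMode c μ v) : deriv v 1 / v 1 = -c := by
  have h1 := h.pos 1 (by simp)
  rw [div_eq_iff h1.ne']; linarith [h.bc]

/-- The lowest odd Robin eigenvalue bounds the Robin energy of functions vanishing at the
midpoint. -/
theorem energy_le (h : OddMode c μ v) {f f' : ℝ → ℝ}
    (hf : ∀ x ∈ Icc (0 : ℝ) 1, HasDerivAt f (f' x) x) (hf' : ContinuousOn f' (Icc 0 1))
    (h0 : f 0 = 0) :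
    μ * (∫ x in (0 : ℝ)..1, f x ^ 2) ≤ (∫ x in (0 : ℝ)..1, f' x ^ 2) + c * f 1 ^ 2 := by
  have c1 : ContinuousAt v 1 := h.smooth.continuous.continuousAt
  have c2 : ContinuousAt (deriv v) 1 := h.smooth.contDiff_deriv.continuous.continuousAt
  have p1 : 0 < v 1 := h.pos 1 (by simp)
  obtain ⟨δ, hδ, hball⟩ := Metric.eventually_nhds_iff.1 (c1.eventually (lt_mem_nhds p1))
  -- `v` vanishes at `0`, so Picone's inequality is applied to the translate `v(· + ε)`. It solves
  -- the same equation and is positive on all of `[0, 1]`, past the endpoint `1` by continuity. The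
  -- boundary term at `0` drops out because `f 0 = 0`, and then `ε → 0`.
  have main : ∀ ε ∈ Ioo 0 δ, μ * (∫ x in (0 : ℝ)..1, f x ^ 2) +
      f 1 ^ 2 * (deriv v (1 + ε) / v (1 + ε)) ≤ ∫ x in (0 : ℝ)..1, f' x ^ 2 := by
    intro ε hε
    have := picone (a := 0) (b := 1) (μ := μ) zero_le_one hf hf'
      (v := fun x => v (x + ε)) (v' := fun x => deriv v (x + ε))
      (fun x _ => (h.hasDerivAt (x + ε)).comp_add_const x ε)
      (fun x _ => (h.hasDerivAt_deriv (x + ε)).comp_add_const x ε)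
      (fun x hx => by
        rcases le_total (x + ε) 1 with h1 | h1
        · exact h.pos _ ⟨by linarith [hx.1, hε.1], h1⟩
        · apply hball
          rw [Real.dist_eq, abs_of_nonneg (by linarith)]
          linarith [hx.2, hε.2])
    rw [h0] at this
    linarith
  have lim : Tendsto (fun ε : ℝ => μ * (∫ x in (0 : ℝ)..1, f x ^ 2) +
      f 1 ^ 2 * (deriv v (1 + ε) / v (1 + ε))) (𝓝[>] 0)
      (𝓝 (μ * (∫ x in (0 : ℝ)..1, f x ^ 2) + f 1 ^ 2 * (deriv v 1 / v 1))) := by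
    have e : Tendsto (fun ε : ℝ => 1 + ε) (𝓝[>] 0) (𝓝 1) := by
      have : Tendsto (fun ε : ℝ => 1 + ε) (𝓝 0) (𝓝 (1 + 0)) := tendsto_const_nhds.add tendsto_id
      rw [add_zero] at this
      exact this.mono_left nhdsWithin_le_nhds
    exact tendsto_const_nhds.add
      (tendsto_const_nhds.mul ((c2.tendsto.comp e).div (c1.tendsto.comp e) p1.ne'))
  have := le_of_tendsto lim (by
    filter_upwards [Ioo_mem_nhdsGT hδ] with ε hε using main ε hε)
  rw [h.quot_one] at this
  linarith

end OddMode

/-- The sharp Poincaré inequality on `[0, 1]` with Dirichlet conditions. -/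
theorem dirichlet_poincare {f f' : ℝ → ℝ}
    (hf : ∀ x ∈ Icc (0 : ℝ) 1, HasDerivAt f (f' x) x) (hf' : ContinuousOn f' (Icc 0 1))
    (h0 : f 0 = 0) (h1 : f 1 = 0) :
    Real.pi ^ 2 * (∫ x in (0 : ℝ)..1, f x ^ 2) ≤ ∫ x in (0 : ℝ)..1, f' x ^ 2 := by
  -- For `r < π` the sine, centred at the midpoint, is positive on the closed interval; the sharp
  -- constant is recovered as `r → π`.
  have main : ∀ r ∈ Ioo 0 Real.pi, r ^ 2 * (∫ x in (0 : ℝ)..1, f x ^ 2) ≤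
      ∫ x in (0 : ℝ)..1, f' x ^ 2 := by
    intro r hr
    have d1 : ∀ x : ℝ, HasDerivAt (fun x : ℝ => r * x + (Real.pi - r) / 2) r x := fun x => by
      simpa using ((hasDerivAt_id x).const_mul r).add_const ((Real.pi - r) / 2)
    have := picone (a := 0) (b := 1) (μ := r ^ 2) zero_le_one hf hf'
      (v := fun x => Real.sin (r * x + (Real.pi - r) / 2))
      (v' := fun x => Real.cos (r * x + (Real.pi - r) / 2) * r)
      (fun x _ => (d1 x).sin)
      (fun x _ => by
        have := (d1 x).cos.mul_const r
        rwa [show -Real.sin (r * x + (Real.pi - r) / 2) * r * r =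
          -r ^ 2 * Real.sin (r * x + (Real.pi - r) / 2) by ring] at this)
      (fun x hx => Real.sin_pos_of_pos_of_lt_pi
        (by nlinarith [hx.1, hr.1, hr.2]) (by nlinarith [hx.2, hr.1, hr.2]))
    rw [h0, h1] at this
    linarith
  have lim : Tendsto (fun r : ℝ => r ^ 2 * (∫ x in (0 : ℝ)..1, f x ^ 2)) (𝓝[<] Real.pi)
      (𝓝 (Real.pi ^ 2 * (∫ x in (0 : ℝ)..1, f x ^ 2))) :=
    Tendsto.mono_left (Continuous.tendsto (by fun_prop) _) nhdsWithin_le_nhds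
  exact le_of_tendsto lim (by
    filter_upwards [Ioo_mem_nhdsLT Real.pi_pos] with r hr using main r hr)

/-- Even functions orthogonal to the ground state: the second even eigenvalue exceeds
`π² + 2 μ`. -/
theorem EvenMode.second_even_energy_le {c μ : ℝ} {v : ℝ → ℝ} (h : EvenMode c μ v) {f : ℝ → ℝ}
    (hf : ContDiff ℝ 1 f) (horth : ∫ x in (0 : ℝ)..1, f x * v x = 0) :
    (Real.pi ^ 2 + 2 * μ) * (∫ x in (0 : ℝ)..1, f x ^ 2) ≤
      (∫ x in (0 : ℝ)..1, deriv f x ^ 2) + c * f 1 ^ 2 := by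
  have vc : Continuous v := h.smooth.continuous
  have vc' : Continuous (deriv v) := h.smooth.contDiff_deriv.continuous
  have fc : Continuous f := hf.continuous
  have fc' : Continuous (deriv f) := hf.continuous_deriv le_rfl
  have cfv : Continuous (fun x => f x * v x) := fc.mul vc
  have cf2 : ContinuousOn (fun x => f x ^ 2) (Icc 0 1) := (fc.pow 2).continuousOn
  have hne : ∀ x ∈ Icc (0 : ℝ) 1, v x ≠ 0 := fun x hx => (h.pos x hx).ne'
  -- Darboux transform. With `A f = f' - q f` one has `A* H = -H' - q H`, and `A A* = -d²/dx² + μ +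
  -- 2q²` by the Riccati equation for `q`. The function `H` is built so that `f = -A* H`;
  -- orthogonality to `v` makes `H` vanish at `1` as well as at `0`.
  set q : ℝ → ℝ := fun x => deriv v x / v x with hq
  set G : ℝ → ℝ := fun x => ∫ t in (0 : ℝ)..x, f t * v t with hG
  set H : ℝ → ℝ := fun x => G x / v x with hH
  have dG : ∀ x, HasDerivAt G (f x * v x) x := fun x =>
    intervalIntegral.integral_hasDerivAt_right (cfv.intervalIntegrable _ _)
      (cfv.stronglyMeasurableAtFilter _ _) cfv.continuousAt
  have dH : ∀ x ∈ Icc (0 : ℝ) 1, HasDerivAt H (f x - q x * H x) x := fun x hx => by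
    have h0 := hne x hx
    refine ((dG x).div (h.hasDerivAt x) h0).congr_deriv ?_
    simp only [hq, hH]
    field_simp
  have dq : ∀ x ∈ Icc (0 : ℝ) 1, HasDerivAt q (-μ - q x ^ 2) x := fun x hx => by
    have h0 := hne x hx
    refine ((h.hasDerivAt_deriv x).div (h.hasDerivAt x) h0).congr_deriv ?_
    simp only [hq]
    field_simp
  have cq : ContinuousOn q (Icc 0 1) := fun x hx => (dq x hx).continuousAt.continuousWithinAt
  have cH : ContinuousOn H (Icc 0 1) := fun x hx => (dH x hx).continuousAt.continuousWithinAt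
  have cH' : ContinuousOn (fun x => f x - q x * H x) (Icc 0 1) :=
    fc.continuousOn.sub (cq.mul cH)
  have cp : ContinuousOn (fun x => deriv f x - q x * f x) (Icc 0 1) :=
    fc'.continuousOn.sub (cq.mul fc.continuousOn)
  have cq2 : ContinuousOn (fun x => q x ^ 2) (Icc 0 1) := cq.pow 2
  have cH2 : ContinuousOn (fun x => H x ^ 2) (Icc 0 1) := cH.pow 2
  have cH'2 : ContinuousOn (fun x => (f x - q x * H x) ^ 2) (Icc 0 1) := cH'.pow 2
  have cp2 : ContinuousOn (fun x => (deriv f x - q x * f x) ^ 2) (Icc 0 1) := cp.pow 2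
  have cR : ContinuousOn (fun x => f x ^ 2 - (f x - q x * H x) ^ 2 -
      (μ + 2 * q x ^ 2) * H x ^ 2) (Icc 0 1) :=
    (cf2.sub cH'2).sub ((continuousOn_const.add (continuousOn_const.mul cq2)).mul cH2)
  have cL : ∀ l : ℝ, ContinuousOn (fun x => l * H x ^ 2) (Icc 0 1) :=
    fun l => continuousOn_const.mul cH2
  have cHp : ContinuousOn (fun x => H x * (deriv f x - q x * f x)) (Icc 0 1) := cH.mul cp
  have cM : ∀ l : ℝ, ContinuousOn (fun x => 2 * l * (H x * (deriv f x - q x * f x)))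
      (Icc 0 1) := fun l => continuousOn_const.mul cHp
  have cS : ∀ l : ℝ, ContinuousOn (fun x => (deriv f x - q x * f x) ^ 2 +
      2 * l * (H x * (deriv f x - q x * f x))) (Icc 0 1) := fun l => cp2.add (cM l)
  have H0 : H 0 = 0 := by simp [hH, hG]
  have H1 : H 1 = 0 := by simp only [hH, hG]; rw [horth, zero_div]
  have int : ∀ {g : ℝ → ℝ}, ContinuousOn g (Icc 0 1) → IntervalIntegrable g volume 0 1 :=
    fun hg => hg.intervalIntegrable_of_Icc zero_le_one
  have hu : uIcc (0 : ℝ) 1 = Icc 0 1 := uIcc_of_le zero_le_one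
  have e1 := picone_identity zero_le_one (fun x _ => hf.hasDerivAt_deriv_of_one x)
    fc'.continuousOn (fun x _ => h.hasDerivAt x) (fun x _ => h.hasDerivAt_deriv x) h.pos
  rw [h.deriv_zero, h.quot_one, zero_div, mul_zero, sub_zero] at e1
  -- Integration by parts turns `f = -A* H` into `∫ f² = -∫ H · A f`.
  have e2 : ∫ x in (0 : ℝ)..1, (f x ^ 2 + H x * (deriv f x - q x * f x)) = 0 := by
    rw [intervalIntegral.integral_eq_sub_of_hasDerivAt (f := fun x => H x * f x)]
    · rw [H0, H1]; ring
    · intro x hx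
      rw [hu] at hx
      refine ((dH x hx).mul (hf.hasDerivAt_deriv_of_one x)).congr_deriv ?_
      ring
    · exact int (cf2.add cHp)
  rw [intervalIntegral.integral_add (int cf2) (int cHp)] at e2
  -- This is `‖A* H‖² = ∫ H'² + ∫ (μ + 2q²) H²`; discarding `2q²` and using the Dirichlet inequality
  -- yields `(π² + μ) ∫ H² ≤ ∫ f²`.
  have e3 : ∫ x in (0 : ℝ)..1,
      (f x ^ 2 - (f x - q x * H x) ^ 2 - (μ + 2 * q x ^ 2) * H x ^ 2) = 0 := by
    rw [intervalIntegral.integral_eq_sub_of_hasDerivAt (f := fun x => q x * H x ^ 2)]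
    · rw [H0, H1]; ring
    · intro x hx
      rw [hu] at hx
      refine ((dq x hx).mul ((dH x hx).pow 2)).congr_deriv ?_
      simp only [Pi.pow_apply]
      ring
    · exact int cR
  have e4 := dirichlet_poincare dH cH' H0 H1
  have e5 : μ * (∫ x in (0 : ℝ)..1, H x ^ 2) + (∫ x in (0 : ℝ)..1, (f x - q x * H x) ^ 2) ≤
      ∫ x in (0 : ℝ)..1, f x ^ 2 := by
    have : ∫ x in (0 : ℝ)..1, (μ * H x ^ 2 + (f x - q x * H x) ^ 2) ≤
        ∫ x in (0 : ℝ)..1, (f x ^ 2 -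
          (f x ^ 2 - (f x - q x * H x) ^ 2 - (μ + 2 * q x ^ 2) * H x ^ 2)) := by
      apply intervalIntegral.integral_mono_on zero_le_one
      · exact int ((cL μ).add cH'2)
      · exact int (cf2.sub cR)
      · intro x _
        nlinarith [mul_nonneg (sq_nonneg (q x)) (sq_nonneg (H x))]
    rw [intervalIntegral.integral_sub (int cf2) (int cR), e3,
      sub_zero, intervalIntegral.integral_add (int (cL μ)) (int cH'2),
      intervalIntegral.integral_const_mul] at this
    exact this
  -- Cauchy–Schwarz as a nonnegative quadratic in `l`. At `l = π² + μ ≥ 0` it reads `B ≥ 2 l F - l²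
  -- K`, and `l K ≤ F` turns this into `B ≥ l F`. For `l ≤ 0` that bound is trivial.
  have e6 : ∀ l : ℝ, 0 ≤ (∫ x in (0 : ℝ)..1, (deriv f x - q x * f x) ^ 2) +
      2 * l * (∫ x in (0 : ℝ)..1, H x * (deriv f x - q x * f x)) +
      l ^ 2 * ∫ x in (0 : ℝ)..1, H x ^ 2 := by
    intro l
    rw [← intervalIntegral.integral_const_mul, ← intervalIntegral.integral_const_mul,
      ← intervalIntegral.integral_add (int cp2) (int (cM l)),
      ← intervalIntegral.integral_add (int (cS l)) (int (cL (l ^ 2)))]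
    refine intervalIntegral.integral_nonneg zero_le_one fun x _ => ?_
    have := sq_nonneg ((deriv f x - q x * f x) + l * H x)
    nlinarith
  set F := ∫ x in (0 : ℝ)..1, f x ^ 2 with hF
  set B := ∫ x in (0 : ℝ)..1, (deriv f x - q x * f x) ^ 2 with hB
  set K := ∫ x in (0 : ℝ)..1, H x ^ 2 with hK
  have hF0 : 0 ≤ F := intervalIntegral.integral_nonneg zero_le_one fun x _ => sq_nonneg _
  have hB0 : 0 ≤ B := intervalIntegral.integral_nonneg zero_le_one fun x _ => sq_nonneg _
  have hB' : (Real.pi ^ 2 + μ) * F ≤ B := by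
    rcases le_total 0 (Real.pi ^ 2 + μ) with hl | hl
    · have := e6 (Real.pi ^ 2 + μ)
      have h2 : (Real.pi ^ 2 + μ) * K ≤ F := by linarith
      nlinarith [mul_le_mul_of_nonneg_left h2 hl]
    · nlinarith
  have : B = (∫ x in (0 : ℝ)..1, deriv f x ^ 2) + c * f 1 ^ 2 - μ * F := by
    linarith
  linarith


/-! ### Parity splitting and the spectral gap on `[-1, 1]` -/

theorem integral_add_of_continuous {a b : ℝ} {f g : ℝ → ℝ} (hf : Continuous f)
    (hg : Continuous g) :
    ∫ x in a..b, (f x + g x) = (∫ x in a..b, f x) + ∫ x in a..b, g x :=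
  intervalIntegral.integral_add (hf.intervalIntegrable _ _) (hg.intervalIntegrable _ _)

theorem integral_sub_of_continuous {a b : ℝ} {f g : ℝ → ℝ} (hf : Continuous f)
    (hg : Continuous g) :
    ∫ x in a..b, (f x - g x) = (∫ x in a..b, f x) - ∫ x in a..b, g x :=
  intervalIntegral.integral_sub (hf.intervalIntegrable _ _) (hg.intervalIntegrable _ _)

theorem integral_symm_eq {g : ℝ → ℝ} (hg : Continuous g) :
    ∫ x in (-1 : ℝ)..1, g x = ∫ x in (0 : ℝ)..1, (g x + g (-x)) := by
  have hg' : Continuous (fun x => g (-x)) := hg.comp continuous_neg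
  rw [intervalIntegral.integral_add (hg.intervalIntegrable _ _) (hg'.intervalIntegrable _ _),
    intervalIntegral.integral_comp_neg, neg_zero, add_comm]
  exact (intervalIntegral.integral_add_adjacent_intervals (hg.intervalIntegrable _ _)
    (hg.intervalIntegrable _ _)).symm

/-- Weak formulation of the eigenvalue equation for a mode on the half interval. -/
theorem weak_mode_eq {c μ : ℝ} {v g : ℝ → ℝ} (hv : ContDiff ℝ ∞ v)
    (ode : ∀ x, deriv (deriv v) x = -μ * v x) (bc : deriv v 1 + c * v 1 = 0)
    (hg : ContDiff ℝ 1 g) (h0 : deriv v 0 * g 0 = 0) :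
    (∫ x in (0 : ℝ)..1, deriv v x * deriv g x) + c * (v 1 * g 1) =
      μ * ∫ x in (0 : ℝ)..1, v x * g x := by
  have cv : Continuous v := hv.continuous
  have cv' : Continuous (deriv v) := hv.contDiff_deriv.continuous
  have cg : Continuous g := hg.continuous
  have cg' : Continuous (deriv g) := hg.continuous_deriv le_rfl
  have c1 : Continuous (fun x => deriv v x * deriv g x) := cv'.mul cg'
  have c2 : Continuous (fun x => μ * (v x * g x)) := continuous_const.mul (cv.mul cg)
  have : ∫ x in (0 : ℝ)..1, (deriv v x * deriv g x - μ * (v x * g x)) =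
      deriv v 1 * g 1 - deriv v 0 * g 0 := by
    rw [intervalIntegral.integral_eq_sub_of_hasDerivAt (f := fun x => deriv v x * g x)]
    · intro x _
      refine ((hv.contDiff_deriv.hasDerivAt_deriv x).mul
        (hg.hasDerivAt_deriv_of_one x)).congr_deriv ?_
      rw [ode]; ring
    · exact (c1.sub c2).intervalIntegrable _ _
  rw [intervalIntegral.integral_sub (c1.intervalIntegrable _ _) (c2.intervalIntegrable _ _),
    intervalIntegral.integral_const_mul, h0] at this
  linear_combination this + g 1 * bc

theorem EvenMode.integral_sq_pos {c μ : ℝ} {v : ℝ → ℝ} (h : EvenMode c μ v) :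
    0 < ∫ x in (-1 : ℝ)..1, v x ^ 2 :=
  intervalIntegral.intervalIntegral_pos_of_pos_on
    ((h.smooth.continuous.pow 2).intervalIntegrable _ _)
    (fun x hx => pow_pos (h.pos' x (Ioo_subset_Icc_self hx)) 2) (by norm_num)

/-- The Robin energy bound by the second eigenvalue, with a correction in the direction of the
ground state. -/
theorem EvenMode.gap_energy_le {c μ₁ μ₂ : ℝ} {v w : ℝ → ℝ} (hv : EvenMode c μ₁ v)
    (hw : OddMode c μ₂ w) (hgap : μ₂ ≤ Real.pi ^ 2 + 2 * μ₁) {f : ℝ → ℝ} (hf : ContDiff ℝ 1 f) :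
    μ₂ * (∫ x in (-1 : ℝ)..1, f x ^ 2) ≤
      (∫ x in (-1 : ℝ)..1, deriv f x ^ 2) + c * (f (-1) ^ 2 + f 1 ^ 2) +
        (μ₂ - μ₁) * ((∫ x in (-1 : ℝ)..1, f x * v x) ^ 2 / ∫ x in (-1 : ℝ)..1, v x ^ 2) := by
  have cv : Continuous v := hv.smooth.continuous
  have cv' : Continuous (deriv v) := hv.smooth.contDiff_deriv.continuous
  have cf : Continuous f := hf.continuous
  have cf' : Continuous (deriv f) := hf.continuous_deriv le_rfl
  set N := ∫ x in (-1 : ℝ)..1, v x ^ 2 with hN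
  have hNpos : 0 < N := hv.integral_sq_pos
  set β := (∫ x in (-1 : ℝ)..1, f x * v x) / N with hβ
  have hfn : ContDiff ℝ 1 (fun x => f (-x)) := hf.comp contDiff_neg
  set fe : ℝ → ℝ := fun x => (f x + f (-x)) / 2 with hfe
  set fo : ℝ → ℝ := fun x => (f x - f (-x)) / 2 with hfo
  -- The even part of `f` is `β v + ψ` with `ψ` orthogonal to the ground state. The odd part is
  -- controlled by `OddMode.energy_le` and `ψ` by `second_even_energy_le`; the weak equation removes
  -- the cross terms between `v` and `ψ`.
  set ψ : ℝ → ℝ := fun x => fe x - β * v x with hψ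
  have Cfe : ContDiff ℝ 1 fe := (hf.add hfn).div_const 2
  have Cfo : ContDiff ℝ 1 fo := (hf.sub hfn).div_const 2
  have hv1 : ContDiff ℝ 1 v := hv.smooth.of_le (by simp)
  have Cψ : ContDiff ℝ 1 ψ := Cfe.sub (contDiff_const.mul hv1)
  have dfn : ∀ x, HasDerivAt (fun x => f (-x)) (-deriv f (-x)) x := fun x => by
    have := (hf.hasDerivAt_deriv_of_one (-x)).scomp x (hasDerivAt_neg x)
    simpa [Function.comp_def] using this
  have dfe : ∀ x, deriv fe x = (deriv f x - deriv f (-x)) / 2 := fun x =>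
    (((hf.hasDerivAt_deriv_of_one x).add (dfn x)).div_const 2).deriv.trans (by ring)
  have dfo : ∀ x, deriv fo x = (deriv f x + deriv f (-x)) / 2 := fun x =>
    (((hf.hasDerivAt_deriv_of_one x).sub (dfn x)).div_const 2).deriv.trans (by ring)
  have dψ : ∀ x, deriv ψ x = deriv fe x - β * deriv v x := fun x =>
    ((Cfe.hasDerivAt_deriv_of_one x).sub ((hv.hasDerivAt x).const_mul β)).deriv
  have cfe : Continuous fe := Cfe.continuous
  have cfo : Continuous fo := Cfo.continuous
  have cψ : Continuous ψ := Cψ.continuous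
  have cfe' : Continuous (deriv fe) := Cfe.continuous_deriv le_rfl
  have cfo' : Continuous (deriv fo) := Cfo.continuous_deriv le_rfl
  have cψ' : Continuous (deriv ψ) := Cψ.continuous_deriv le_rfl
  have N0 : N = 2 * ∫ x in (0 : ℝ)..1, v x * v x := by
    rw [hN, integral_symm_eq (g := fun x => v x ^ 2) (cv.pow 2),
      ← intervalIntegral.integral_const_mul]
    · congr 1; ext x; rw [hv.even]; ring
  have F0 : ∫ x in (-1 : ℝ)..1, f x ^ 2 =
      2 * (∫ x in (0 : ℝ)..1, fe x ^ 2) + 2 * ∫ x in (0 : ℝ)..1, fo x ^ 2 := by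
    rw [integral_symm_eq (g := fun x => f x ^ 2) (cf.pow 2),
      ← intervalIntegral.integral_const_mul, ← intervalIntegral.integral_const_mul,
      ← integral_add_of_continuous]
    · congr 1; ext x; simp only [hfe, hfo]; ring
    all_goals fun_prop
  have F1 : ∫ x in (-1 : ℝ)..1, deriv f x ^ 2 =
      2 * (∫ x in (0 : ℝ)..1, deriv fe x ^ 2) + 2 * ∫ x in (0 : ℝ)..1, deriv fo x ^ 2 := by
    rw [integral_symm_eq (g := fun x => deriv f x ^ 2) (cf'.pow 2),
      ← intervalIntegral.integral_const_mul, ← intervalIntegral.integral_const_mul,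
      ← integral_add_of_continuous]
    · congr 1; ext x; simp only [dfe, dfo]; ring
    all_goals fun_prop
  have P0 : ∫ x in (-1 : ℝ)..1, f x * v x = 2 * ∫ x in (0 : ℝ)..1, fe x * v x := by
    rw [integral_symm_eq (g := fun x => f x * v x) (cf.mul cv),
      ← intervalIntegral.integral_const_mul]
    · congr 1; ext x; simp only [hfe, hv.even]; ring
  have hβN : β * N = ∫ x in (-1 : ℝ)..1, f x * v x := by rw [hβ]; field_simp
  have orth : ∫ x in (0 : ℝ)..1, ψ x * v x = 0 := by
    have : ∫ x in (0 : ℝ)..1, ψ x * v x =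
        (∫ x in (0 : ℝ)..1, fe x * v x) - β * ∫ x in (0 : ℝ)..1, v x * v x := by
      rw [← intervalIntegral.integral_const_mul,
        ← integral_sub_of_continuous]
      · congr 1; ext x; simp only [hψ]; ring
      all_goals fun_prop
    rw [this]
    linear_combination (1 / 2) * β * N0 - (1 / 2) * hβN - (1 / 2) * P0
  have orth' : ∫ x in (0 : ℝ)..1, v x * ψ x = 0 := by simpa only [mul_comm] using orth
  have E0 : ∫ x in (0 : ℝ)..1, fe x ^ 2 = (∫ x in (0 : ℝ)..1, ψ x ^ 2) +
      2 * β * (∫ x in (0 : ℝ)..1, v x * ψ x) + β ^ 2 * ∫ x in (0 : ℝ)..1, v x * v x := by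
    rw [← intervalIntegral.integral_const_mul, ← intervalIntegral.integral_const_mul,
      ← integral_add_of_continuous,
      ← integral_add_of_continuous]
    · congr 1; ext x; simp only [hψ]; ring
    all_goals fun_prop
  have E1 : ∫ x in (0 : ℝ)..1, deriv fe x ^ 2 = (∫ x in (0 : ℝ)..1, deriv ψ x ^ 2) +
      2 * β * (∫ x in (0 : ℝ)..1, deriv v x * deriv ψ x) +
      β ^ 2 * ∫ x in (0 : ℝ)..1, deriv v x * deriv v x := by
    rw [← intervalIntegral.integral_const_mul, ← intervalIntegral.integral_const_mul,
      ← integral_add_of_continuous,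
      ← integral_add_of_continuous]
    · congr 1; ext x; simp only [dψ]; ring
    all_goals fun_prop
  have W1 := weak_mode_eq hv.smooth hv.ode hv.bc Cψ (by rw [hv.deriv_zero, zero_mul])
  have W2 := weak_mode_eq hv.smooth hv.ode hv.bc hv1 (by rw [hv.deriv_zero, zero_mul])
  have S1 := hv.second_even_energy_le Cψ orth
  have S2 := hw.energy_le (fun x _ => Cfo.hasDerivAt_deriv_of_one x) cfo'.continuousOn
    (by simp [hfo])
  have hψ0 : 0 ≤ ∫ x in (0 : ℝ)..1, ψ x ^ 2 :=
    intervalIntegral.integral_nonneg zero_le_one fun x _ => sq_nonneg _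
  have b1 : f (-1) ^ 2 + f 1 ^ 2 = 2 * fe 1 ^ 2 + 2 * fo 1 ^ 2 := by
    simp only [hfe, hfo]; ring
  have b2 : fe 1 = ψ 1 + β * v 1 := by simp only [hψ]; ring
  have hq : (∫ x in (-1 : ℝ)..1, f x * v x) ^ 2 / N = β ^ 2 * N := by
    rw [← hβN]; field_simp
  have S3 := mul_le_mul_of_nonneg_right hgap hψ0
  rw [orth'] at E0 W1
  rw [hq, F0, F1, b1, E0, E1, b2, N0]
  linear_combination 2 * S1 + 2 * S2 + 2 * S3 - 4 * β * W1 - 2 * β ^ 2 * W2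


/-! ### The first two eigenvalues on `[-1, 1]` as functions of the Robin parameter -/

/-- The difference `cosh x - sinh x = exp (-x)` is at most `1`, and `x ≤ sinh x`. The result amounts
to `tanh x ≥ x / (1 + x)`, the elementary estimate used to bracket hyperbolic roots. -/
theorem Real.mul_cosh_le_one_add_mul_sinh {x : ℝ} (hx : 0 ≤ x) :
    x * Real.cosh x ≤ (1 + x) * Real.sinh x := by
  have h1 : Real.cosh x - Real.sinh x = Real.exp (-x) := by
    rw [Real.cosh_eq, Real.sinh_eq]; ring
  have h2 : Real.exp (-x) ≤ 1 := Real.exp_le_one_iff.2 (by linarith)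
  have h3 : x ≤ Real.sinh x := Real.self_le_sinh_iff.2 hx
  have h4 := mul_le_mul_of_nonneg_left h2 hx
  rw [← h1] at h4
  linarith

theorem exists_mul_tan_eq {c : ℝ} (hc : 0 < c) :
    ∃ x ∈ Ioo 0 (Real.pi / 2), x * Real.tan x = c := by
  have hp := Real.pi_pos
  obtain ⟨x, hx, h0⟩ := intermediate_value_Ioo (a := 0) (b := Real.pi / 2) (by linarith)
    (f := fun x => x * Real.sin x - c * Real.cos x) (by fun_prop)
    (show (0 : ℝ) ∈ Ioo _ _ by simp; constructor <;> linarith)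
  refine ⟨x, hx, ?_⟩
  have hcos : 0 < Real.cos x := Real.cos_pos_of_mem_Ioo ⟨by linarith [hx.1], hx.2⟩
  rw [Real.tan_eq_sin_div_cos, mul_div_assoc', div_eq_iff hcos.ne']
  simp only at h0; linarith

theorem exists_neg_mul_cot_eq {c : ℝ} (hc : -1 < c) :
    ∃ x ∈ Ioo 0 Real.pi, -x * Real.cot x = c := by
  have hp := Real.pi_pos
  have cs := Real.continuous_sinc
  -- Dividing the equation by `x` through `sinc` keeps the left endpoint informative: the value
  -- there is `c + 1 > 0`, whereas `c sin x + x cos x` vanishes at `0`.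
  obtain ⟨x, hx, h0⟩ := intermediate_value_Ioo' (a := 0) (b := Real.pi) hp.le
    (f := fun x => c * Real.sinc x + Real.cos x) (by fun_prop)
    (show (0 : ℝ) ∈ Ioo _ _ by
      simp [Real.sinc_of_ne_zero hp.ne']; linarith)
  refine ⟨x, hx, ?_⟩
  have hs : 0 < Real.sin x := Real.sin_pos_of_mem_Ioo hx
  have hx0 : x ≠ 0 := hx.1.ne'
  simp only [Real.sinc_of_ne_zero hx0] at h0
  rw [Real.cot_eq_cos_div_sin, mul_div_assoc', div_eq_iff hs.ne']
  field_simp at h0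
  linarith

theorem exists_mul_tanh_eq {c : ℝ} (hc : 0 < c) : ∃ x ∈ Ioi (0 : ℝ), x * Real.tanh x = c := by
  -- At `x = c + 1` the estimate above gives `x tanh x ≥ (c + 1)² / (c + 2) > c`.
  obtain ⟨x, hx, h0⟩ := intermediate_value_Ioo (a := 0) (b := c + 1) (by linarith)
    (f := fun x => x * Real.sinh x - c * Real.cosh x) (by fun_prop)
    (show (0 : ℝ) ∈ Ioo _ _ by
      simp only [mem_Ioo]
      constructor
      · simp [hc]
      · have h1 := Real.mul_cosh_le_one_add_mul_sinh (x := c + 1) (by linarith)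
        have h2 := Real.cosh_pos (c + 1)
        have h3 : (c + 1) * ((c + 1) * Real.cosh (c + 1)) ≤
          (c + 1) * ((1 + (c + 1)) * Real.sinh (c + 1)) := by gcongr
        have h4 : 0 < (1 + (c + 1)) * ((c + 1) * Real.sinh (c + 1) - c * Real.cosh (c + 1)) := by
          nlinarith
        exact pos_of_mul_pos_right h4 (by linarith))
  refine ⟨x, hx.1, ?_⟩
  rw [Real.tanh_eq_sinh_div_cosh, mul_div_assoc', div_eq_iff (Real.cosh_pos x).ne']
  simp only at h0; linarith

theorem exists_mul_coth_eq {c : ℝ} (hc : 1 < c) :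
    ∃ x ∈ Ioi (0 : ℝ), x * (Real.cosh x / Real.sinh x) = c := by
  -- The left endpoint works because `x coth x ≤ 1 + x`, which is `(c + 1) / 2 < c` there; the right
  -- endpoint because `coth > 1`.
  obtain ⟨x, hx, h0⟩ := intermediate_value_Ioo (a := (c - 1) / 2) (b := c) (by linarith)
    (f := fun x => x * Real.cosh x - c * Real.sinh x) (by fun_prop)
    (show (0 : ℝ) ∈ Ioo _ _ by
      simp only [mem_Ioo]
      constructor
      · have h1 := Real.mul_cosh_le_one_add_mul_sinh (x := (c - 1) / 2) (by linarith)
        have h2 := Real.sinh_pos_iff.2 (show 0 < (c - 1) / 2 by linarith)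
        nlinarith
      · have := Real.sinh_lt_cosh c
        nlinarith)
  have hx0 : 0 < x := by linarith [hx.1]
  refine ⟨x, hx0, ?_⟩
  rw [mul_div_assoc', div_eq_iff (Real.sinh_pos_iff.2 hx0).ne']
  simp only at h0; linarith

theorem g₁Inv_spec {c : ℝ} (hc : 0 < c) :
    g₁Inv c ∈ Ioo 0 (Real.pi / 2) ∧ g₁Inv c * Real.tan (g₁Inv c) = c :=
  ⟨Function.invFunOn_mem (exists_mul_tan_eq hc), Function.invFunOn_eq (exists_mul_tan_eq hc)⟩

theorem g₂Inv_spec {c : ℝ} (hc : -1 < c) :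
    g₂Inv c ∈ Ioo 0 Real.pi ∧ -g₂Inv c * Real.cot (g₂Inv c) = c :=
  ⟨Function.invFunOn_mem (exists_neg_mul_cot_eq hc),
    Function.invFunOn_eq (exists_neg_mul_cot_eq hc)⟩

theorem h₁Inv_spec {c : ℝ} (hc : 0 < c) :
    0 < h₁Inv c ∧ h₁Inv c * Real.tanh (h₁Inv c) = c :=
  ⟨Function.invFunOn_mem (exists_mul_tanh_eq hc), Function.invFunOn_eq (exists_mul_tanh_eq hc)⟩

theorem h₂Inv_spec {c : ℝ} (hc : 1 < c) :
    0 < h₂Inv c ∧ h₂Inv c * (Real.cosh (h₂Inv c) / Real.sinh (h₂Inv c)) = c :=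
  ⟨Function.invFunOn_mem (exists_mul_coth_eq hc), Function.invFunOn_eq (exists_mul_coth_eq hc)⟩

open Classical in
/-- The lowest Robin eigenvalue on `[-1, 1]`. -/
noncomputable def evenEigenvalue (c : ℝ) : ℝ :=
  if 0 < c then g₁Inv c ^ 2 else if c = 0 then 0 else -h₁Inv (-c) ^ 2

open Classical in
/-- The second Robin eigenvalue on `[-1, 1]`. -/
noncomputable def oddEigenvalue (c : ℝ) : ℝ :=
  if -1 < c then g₂Inv c ^ 2 else if c = -1 then 0 else -h₂Inv (-c) ^ 2

theorem evenEigenvalue_of_pos {c : ℝ} (hc : 0 < c) : evenEigenvalue c = g₁Inv c ^ 2 := if_pos hc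

theorem evenEigenvalue_zero : evenEigenvalue 0 = 0 := by simp [evenEigenvalue]

theorem evenEigenvalue_of_neg {c : ℝ} (hc : c < 0) : evenEigenvalue c = -h₁Inv (-c) ^ 2 := by
  rw [evenEigenvalue, if_neg hc.not_gt, if_neg hc.ne]

theorem oddEigenvalue_of_gt {c : ℝ} (hc : -1 < c) : oddEigenvalue c = g₂Inv c ^ 2 := if_pos hc

theorem oddEigenvalue_of_lt {c : ℝ} (hc : c < -1) : oddEigenvalue c = -h₂Inv (-c) ^ 2 := by
  rw [oddEigenvalue, if_neg hc.not_gt, if_neg hc.ne]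

theorem EvenMode.of_hasDerivAt {c μ : ℝ} {v v' : ℝ → ℝ} (smooth : ContDiff ℝ ∞ v)
    (h1 : ∀ x, HasDerivAt v (v' x) x) (h2 : ∀ x, HasDerivAt v' (-μ * v x) x)
    (even : ∀ x, v (-x) = v x) (pos : ∀ x ∈ Icc (0 : ℝ) 1, 0 < v x) (bc : v' 1 + c * v 1 = 0) :
    EvenMode c μ v := by
  have e : deriv v = v' := funext fun x => (h1 x).deriv
  exact ⟨smooth, fun x => by rw [e]; exact (h2 x).deriv, even, pos, by rw [e]; exact bc⟩

theorem OddMode.of_hasDerivAt {c μ : ℝ} {v v' : ℝ → ℝ} (smooth : ContDiff ℝ ∞ v)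
    (h1 : ∀ x, HasDerivAt v (v' x) x) (h2 : ∀ x, HasDerivAt v' (-μ * v x) x)
    (odd : ∀ x, v (-x) = -v x) (pos : ∀ x ∈ Ioc (0 : ℝ) 1, 0 < v x) (bc : v' 1 + c * v 1 = 0) :
    OddMode c μ v := by
  have e : deriv v = v' := funext fun x => (h1 x).deriv
  exact ⟨smooth, fun x => by rw [e]; exact (h2 x).deriv, odd, pos, by rw [e]; exact bc⟩

theorem hasDerivAt_const_mul_id (r x : ℝ) : HasDerivAt (fun x : ℝ => r * x) r x := by
  simpa using (hasDerivAt_id x).const_mul r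

theorem exists_evenMode (c : ℝ) : ∃ v, EvenMode c (evenEigenvalue c) v := by
  rcases lt_trichotomy c 0 with hc | rfl | hc
  · obtain ⟨h0, h1⟩ := h₁Inv_spec (neg_pos.2 hc)
    rw [evenEigenvalue_of_neg hc]
    set r := h₁Inv (-c)
    refine ⟨fun x => Real.cosh (r * x), .of_hasDerivAt (by fun_prop)
      (v' := fun x => Real.sinh (r * x) * r) (fun x => (hasDerivAt_const_mul_id r x).cosh)
      (fun x => (((hasDerivAt_const_mul_id r x).sinh).mul_const r).congr_deriv (by ring))
      (fun x => by simp) (fun x _ => Real.cosh_pos _) ?_⟩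
    rw [Real.tanh_eq_sinh_div_cosh, mul_div_assoc', div_eq_iff (Real.cosh_pos r).ne'] at h1
    simp only [mul_one]; linarith
  · exact ⟨fun _ => 1, .of_hasDerivAt contDiff_const (v' := fun _ => 0)
      (fun x => hasDerivAt_const _ _) (fun x => (hasDerivAt_const _ _).congr_deriv
        (by simp [evenEigenvalue_zero])) (fun _ => rfl) (fun _ _ => one_pos) (by simp)⟩
  · obtain ⟨h0, h1⟩ := g₁Inv_spec hc
    rw [evenEigenvalue_of_pos hc]
    set r := g₁Inv c
    have hcos : ∀ x ∈ Icc (0 : ℝ) 1, 0 < Real.cos (r * x) := fun x hx =>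
      Real.cos_pos_of_mem_Ioo ⟨by nlinarith [hx.1, h0.1, Real.pi_pos], by
        nlinarith [hx.2, h0.1, h0.2]⟩
    refine ⟨fun x => Real.cos (r * x), .of_hasDerivAt (by fun_prop)
      (v' := fun x => -Real.sin (r * x) * r) (fun x => (hasDerivAt_const_mul_id r x).cos)
      (fun x => (((hasDerivAt_const_mul_id r x).sin).neg.mul_const r).congr_deriv (by ring))
      (fun x => by simp) hcos ?_⟩
    have := hcos 1 (by simp)
    rw [mul_one] at this
    rw [Real.tan_eq_sin_div_cos, mul_div_assoc', div_eq_iff this.ne'] at h1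
    simp only [mul_one]; linarith

theorem exists_oddMode (c : ℝ) : ∃ v, OddMode c (oddEigenvalue c) v := by
  rcases lt_trichotomy c (-1) with hc | rfl | hc
  · obtain ⟨h0, h1⟩ := h₂Inv_spec (c := -c) (by linarith)
    rw [oddEigenvalue_of_lt hc]
    set r := h₂Inv (-c)
    refine ⟨fun x => Real.sinh (r * x), .of_hasDerivAt (by fun_prop)
      (v' := fun x => Real.cosh (r * x) * r) (fun x => (hasDerivAt_const_mul_id r x).sinh)
      (fun x => (((hasDerivAt_const_mul_id r x).cosh).mul_const r).congr_deriv (by ring))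
      (fun x => by simp) (fun x hx => Real.sinh_pos_iff.2 (mul_pos h0 hx.1)) ?_⟩
    rw [mul_div_assoc', div_eq_iff (Real.sinh_pos_iff.2 h0).ne'] at h1
    simp only [mul_one]; linarith
  · exact ⟨fun x => x, .of_hasDerivAt contDiff_id (v' := fun _ => 1)
      (fun x => hasDerivAt_id x) (fun x => (hasDerivAt_const _ _).congr_deriv
        (by simp [oddEigenvalue])) (fun _ => rfl) (fun _ hx => hx.1) (by simp)⟩
  · obtain ⟨h0, h1⟩ := g₂Inv_spec hc
    rw [oddEigenvalue_of_gt hc]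
    set r := g₂Inv c
    have hsin : ∀ x ∈ Ioc (0 : ℝ) 1, 0 < Real.sin (r * x) := fun x hx =>
      Real.sin_pos_of_pos_of_lt_pi (mul_pos h0.1 hx.1) (by nlinarith [hx.2, h0.1, h0.2])
    refine ⟨fun x => Real.sin (r * x), .of_hasDerivAt (by fun_prop)
      (v' := fun x => Real.cos (r * x) * r) (fun x => (hasDerivAt_const_mul_id r x).sin)
      (fun x => (((hasDerivAt_const_mul_id r x).cos).mul_const r).congr_deriv (by ring))
      (fun x => by simp) hsin ?_⟩
    have := hsin 1 (by simp)
    rw [mul_one] at this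
    rw [Real.cot_eq_cos_div_sin, mul_div_assoc', div_eq_iff this.ne'] at h1
    simp only [mul_one]; linarith

/-- The eigenfunction for `c`, used as a trial function for `c'`, has Rayleigh quotient affine in
`c'` with slope `2 v(1)² / ∫ v²`. Concavity, monotonicity and continuity of the eigenvalues all come
from this, without differentiating the inverse functions. -/
theorem exists_supergradient_evenEigenvalue (c : ℝ) :
    ∃ d, 0 < d ∧ ∀ c', evenEigenvalue c' ≤ evenEigenvalue c + d * (c' - c) := by
  obtain ⟨v, hv⟩ := exists_evenMode c
  have hN := hv.integral_sq_pos
  have h1 : 0 < v 1 := hv.pos 1 (by simp)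
  refine ⟨2 * v 1 ^ 2 / ∫ x in (-1 : ℝ)..1, v x ^ 2, by positivity, fun c' => ?_⟩
  obtain ⟨w, hw⟩ := exists_evenMode c'
  have hv1 : ContDiff ℝ 1 v := hv.smooth.of_le (by simp)
  have e := hw.energy_le hv1
  have W := weak_mode_eq hv.smooth hv.ode hv.bc hv1 (by rw [hv.deriv_zero, zero_mul])
  have N0 : ∫ x in (-1 : ℝ)..1, v x ^ 2 = 2 * ∫ x in (0 : ℝ)..1, v x * v x := by
    rw [integral_symm_eq (g := fun x => v x ^ 2) (hv.smooth.continuous.pow 2),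
      ← intervalIntegral.integral_const_mul]
    congr 1; ext x; rw [hv.even]; ring
  have N1 : ∫ x in (-1 : ℝ)..1, deriv v x ^ 2 =
      2 * ∫ x in (0 : ℝ)..1, deriv v x * deriv v x := by
    rw [integral_symm_eq (g := fun x => deriv v x ^ 2)
      (hv.smooth.contDiff_deriv.continuous.pow 2), ← intervalIntegral.integral_const_mul]
    congr 1; ext x; rw [deriv_odd_of_even hv.even]; ring
  rw [hv.even, N1] at e
  rw [show evenEigenvalue c + 2 * v 1 ^ 2 / (∫ x in (-1 : ℝ)..1, v x ^ 2) * (c' - c) =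
    (evenEigenvalue c * (∫ x in (-1 : ℝ)..1, v x ^ 2) + 2 * v 1 ^ 2 * (c' - c)) /
      ∫ x in (-1 : ℝ)..1, v x ^ 2 by field_simp, le_div_iff₀ hN]
  refine e.trans (le_of_eq ?_)
  rw [N0]
  linear_combination 2 * W

theorem OddMode.integral_sq_pos {c μ : ℝ} {v : ℝ → ℝ} (h : OddMode c μ v) :
    0 < ∫ x in (0 : ℝ)..1, v x ^ 2 :=
  intervalIntegral.intervalIntegral_pos_of_pos_on
    ((h.smooth.continuous.pow 2).intervalIntegrable _ _)
    (fun x hx => pow_pos (h.pos x ⟨hx.1, hx.2.le⟩) 2) (by norm_num)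

theorem exists_supergradient_oddEigenvalue (c : ℝ) :
    ∃ d, 0 < d ∧ ∀ c', oddEigenvalue c' ≤ oddEigenvalue c + d * (c' - c) := by
  obtain ⟨v, hv⟩ := exists_oddMode c
  have hN := hv.integral_sq_pos
  have h1 : 0 < v 1 := hv.pos 1 (by simp)
  refine ⟨v 1 ^ 2 / ∫ x in (0 : ℝ)..1, v x ^ 2, by positivity, fun c' => ?_⟩
  obtain ⟨w, hw⟩ := exists_oddMode c'
  have hv1 : ContDiff ℝ 1 v := hv.smooth.of_le (by simp)
  have e := hw.energy_le (fun x _ => hv.hasDerivAt x)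
    (hv.smooth.contDiff_deriv.continuous.continuousOn) hv.zero
  have W := weak_mode_eq hv.smooth hv.ode hv.bc hv1 (by rw [hv.zero, mul_zero])
  simp only [← pow_two] at W
  rw [show oddEigenvalue c + v 1 ^ 2 / (∫ x in (0 : ℝ)..1, v x ^ 2) * (c' - c) =
    (oddEigenvalue c * (∫ x in (0 : ℝ)..1, v x ^ 2) + v 1 ^ 2 * (c' - c)) /
      ∫ x in (0 : ℝ)..1, v x ^ 2 by field_simp, le_div_iff₀ hN]
  refine e.trans (le_of_eq ?_)
  linear_combination W

theorem concaveOn_of_exists_supergradient {F : ℝ → ℝ}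
    (h : ∀ c, ∃ d, ∀ c', F c' ≤ F c + d * (c' - c)) : ConcaveOn ℝ univ F := by
  refine ⟨convex_univ, fun x _ y _ a b ha hb hab => ?_⟩
  obtain ⟨d, hd⟩ := h (a • x + b • y)
  have h1 := mul_le_mul_of_nonneg_left (hd x) ha
  have h2 := mul_le_mul_of_nonneg_left (hd y) hb
  simp only [smul_eq_mul] at *
  obtain rfl : b = 1 - a := by linarith
  linarith

theorem concaveOn_oddEigenvalue : ConcaveOn ℝ univ oddEigenvalue :=
  concaveOn_of_exists_supergradient fun c =>
    (exists_supergradient_oddEigenvalue c).imp fun _ h => h.2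

theorem monotone_evenEigenvalue : Monotone evenEigenvalue := fun a b hab => by
  obtain ⟨d, hd, h⟩ := exists_supergradient_evenEigenvalue b
  nlinarith [h a, mul_nonneg hd.le (sub_nonneg.2 hab)]

theorem monotone_oddEigenvalue : Monotone oddEigenvalue := fun a b hab => by
  obtain ⟨d, hd, h⟩ := exists_supergradient_oddEigenvalue b
  nlinarith [h a, mul_nonneg hd.le (sub_nonneg.2 hab)]

theorem oddEigenvalue_zero : oddEigenvalue 0 = Real.pi ^ 2 / 4 := by
  obtain ⟨h0, h1⟩ := g₂Inv_spec (c := 0) (by norm_num)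
  rw [oddEigenvalue_of_gt (by norm_num)]
  set r := g₂Inv 0
  have hs := Real.sin_pos_of_mem_Ioo h0
  have hcos : Real.cos r = 0 := by
    rw [Real.cot_eq_cos_div_sin, mul_div_assoc', div_eq_iff hs.ne', zero_mul] at h1
    rcases mul_eq_zero.1 h1 with h | h
    · linarith [h0.1]
    · exact h
  have : r = Real.pi / 2 := by
    apply Real.injOn_cos (Ioo_subset_Icc_self h0) ⟨by linarith [Real.pi_pos], by
      linarith [Real.pi_pos]⟩
    rw [hcos, Real.cos_pi_div_two]
  rw [this]; ring

/-- The constant function is the trial function. -/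
theorem evenEigenvalue_le_self (c : ℝ) : evenEigenvalue c ≤ c := by
  obtain ⟨v, hv⟩ := exists_evenMode c
  have := hv.energy_le (f := fun _ => 1) contDiff_const
  norm_num at this
  linarith

/-- In terms of the root `r` this is `sin r cos r ≤ r` when `c = r tan r`, and `r ≤ sinh r cosh r`
when `c = -r tanh r`. The quadratic error is what controls the degenerate limit. -/
theorem self_sub_sq_le_evenEigenvalue (c : ℝ) : c - c ^ 2 ≤ evenEigenvalue c := by
  rcases lt_trichotomy c 0 with hc | rfl | hc
  · obtain ⟨h0, h1⟩ := h₁Inv_spec (neg_pos.2 hc)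
    rw [evenEigenvalue_of_neg hc]
    set r := h₁Inv (-c)
    have hC := Real.cosh_pos r
    have hS := Real.self_le_sinh_iff.2 h0.le
    have hC1 := Real.one_le_cosh r
    have hsq := Real.cosh_sq r
    have : c = -(r * (Real.sinh r / Real.cosh r)) := by
      rw [← Real.tanh_eq_sinh_div_cosh]; linarith
    rw [this]
    have key : 0 ≤ (r * Real.sinh r * Real.cosh r - r ^ 2) / Real.cosh r ^ 2 := by
      apply div_nonneg _ (by positivity)
      nlinarith [mul_le_mul hS hC1 (by norm_num) (by linarith)]
    have e : -(r * (Real.sinh r / Real.cosh r)) - (-(r * (Real.sinh r / Real.cosh r))) ^ 2 +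
        (r * Real.sinh r * Real.cosh r - r ^ 2) / Real.cosh r ^ 2 = -r ^ 2 := by
      field_simp
      rw [hsq]; ring
    linarith
  · simp [evenEigenvalue_zero]
  · obtain ⟨h0, h1⟩ := g₁Inv_spec hc
    rw [evenEigenvalue_of_pos hc]
    set r := g₁Inv c
    have hC : 0 < Real.cos r := Real.cos_pos_of_mem_Ioo ⟨by linarith [h0.1, Real.pi_pos], h0.2⟩
    have hS := Real.sin_le h0.1.le
    have hS0 : 0 < Real.sin r := Real.sin_pos_of_pos_of_lt_pi h0.1 (by
      linarith [h0.2, Real.pi_pos])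
    have hC1 := Real.cos_le_one r
    have hsq := Real.sin_sq_add_cos_sq r
    have : c = r * (Real.sin r / Real.cos r) := by
      rw [← Real.tan_eq_sin_div_cos]; linarith
    rw [this]
    have key : 0 ≤ (r ^ 2 - r * Real.sin r * Real.cos r) / Real.cos r ^ 2 := by
      apply div_nonneg _ (by positivity)
      nlinarith [mul_le_mul hS hC1 hC.le h0.1.le, h0.1]
    have e : r * (Real.sin r / Real.cos r) - (r * (Real.sin r / Real.cos r)) ^ 2 +
        (r ^ 2 - r * Real.sin r * Real.cos r) / Real.cos r ^ 2 = r ^ 2 := by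
      field_simp
      linear_combination (-r ^ 2) * hsq
    linarith


/-! ### Trigonometric and hyperbolic inequalities -/

theorem nonneg_of_hasDerivAt_nonneg {b : ℝ} {f f' : ℝ → ℝ} (h0 : 0 ≤ f 0)
    (hf : ∀ x ∈ Ico 0 b, HasDerivAt f (f' x) x) (hf' : ∀ x ∈ Ioo 0 b, 0 ≤ f' x) {x : ℝ}
    (hx : x ∈ Ico 0 b) : 0 ≤ f x := by
  have : MonotoneOn f (Ico 0 b) := by
    apply monotoneOn_of_deriv_nonneg (convex_Ico 0 b)
    · exact fun y hy => (hf y hy).continuousAt.continuousWithinAt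
    · intro y hy
      rw [interior_Ico] at hy
      exact (hf y (Ioo_subset_Ico_self hy)).differentiableAt.differentiableWithinAt
    · intro y hy
      rw [interior_Ico] at hy
      rw [(hf y (Ioo_subset_Ico_self hy)).deriv]
      exact hf' y hy
  exact h0.trans (this ⟨le_rfl, hx.1.trans_lt hx.2⟩ hx hx.1)

theorem Real.cos_pos_of_mem_Ico {x : ℝ} (hx : x ∈ Ico 0 (Real.pi / 2)) : 0 < Real.cos x :=
  Real.cos_pos_of_mem_Ioo ⟨by linarith [hx.1, Real.pi_pos], hx.2⟩

/-- Huygens' inequality. -/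
theorem Real.three_mul_le_tan_add_two_mul_sin {x : ℝ} (hx : x ∈ Ico 0 (Real.pi / 2)) :
    3 * x ≤ Real.tan x + 2 * Real.sin x := by
  have := nonneg_of_hasDerivAt_nonneg (b := Real.pi / 2)
    (f := fun x => Real.tan x + 2 * Real.sin x - 3 * x)
    (f' := fun x => 1 / Real.cos x ^ 2 + 2 * Real.cos x - 3) (by simp)
    (fun y hy => ((Real.hasDerivAt_tan (Real.cos_pos_of_mem_Ico hy).ne').add
      ((Real.hasDerivAt_sin y).const_mul 2)).sub (hasDerivAt_const_mul_id 3 y))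
    (fun y hy => by
      have hc := Real.cos_pos_of_mem_Ico (Ioo_subset_Ico_self hy)
      have : 1 / Real.cos y ^ 2 + 2 * Real.cos y - 3 =
          (Real.cos y - 1) ^ 2 * (2 * Real.cos y + 1) / Real.cos y ^ 2 := by
        field_simp; ring
      rw [this]; positivity) hx
  linarith

/-- Since `sin³ / cos = tan - sin cos`, it is enough to differentiate `tan - sin cos - x³`. The
derivative is `tan² + 2 sin² - 3x²`, nonnegative by Huygens' inequality and `(t + 2s)² ≤ 3 (t² +
2s²)`. -/
theorem Real.pow_three_mul_cos_le {x : ℝ} (hx : x ∈ Ico 0 (Real.pi / 2)) :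
    x ^ 3 * Real.cos x ≤ Real.sin x ^ 3 := by
  have hpi := Real.pi_pos
  have := nonneg_of_hasDerivAt_nonneg (b := Real.pi / 2)
    (f := fun x => Real.tan x - Real.sin x * Real.cos x - x ^ 3)
    (f' := fun x => 1 / Real.cos x ^ 2 - (Real.cos x * Real.cos x + Real.sin x * -Real.sin x) -
      3 * x ^ 2) (by simp)
    (fun y hy => ((Real.hasDerivAt_tan (Real.cos_pos_of_mem_Ico hy).ne').sub
      ((Real.hasDerivAt_sin y).mul (Real.hasDerivAt_cos y))).sub
        ((hasDerivAt_pow 3 y).congr_deriv (by norm_num)))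
    (fun y hy => by
      have hy' := Ioo_subset_Ico_self hy
      have hc := Real.cos_pos_of_mem_Ico hy'
      have h := Real.three_mul_le_tan_add_two_mul_sin hy'
      have e : 1 / Real.cos y ^ 2 - (Real.cos y * Real.cos y + Real.sin y * -Real.sin y) =
          Real.tan y ^ 2 + 2 * Real.sin y ^ 2 := by
        rw [Real.tan_eq_sin_div_cos]
        have := Real.sin_sq_add_cos_sq y
        field_simp
        rw [show Real.sin y ^ 2 = 1 - Real.cos y ^ 2 by linarith]
        ring
      rw [e]
      nlinarith [sq_nonneg (Real.tan y - Real.sin y), hy.1]) hx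
  have hc := Real.cos_pos_of_mem_Ico hx
  have e : Real.tan x - Real.sin x * Real.cos x = Real.sin x ^ 3 / Real.cos x := by
    rw [Real.tan_eq_sin_div_cos]
    have := Real.sin_sq_add_cos_sq x
    field_simp
    linear_combination (-Real.sin x) * this
  simp only [e] at this
  rw [← le_div_iff₀ hc]; linarith

/-- Wilker's inequality. -/
theorem Real.wilker {x : ℝ} (hx : x ∈ Ico 0 (Real.pi / 2)) :
    2 * x ^ 2 * Real.cos x ≤ x * Real.sin x + Real.cos x * Real.sin x ^ 2 := by
  have hc := Real.cos_pos_of_mem_Ico hx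
  have hs : 0 ≤ Real.sin x := Real.sin_nonneg_of_nonneg_of_le_pi hx.1 (by
    linarith [hx.2, Real.pi_pos])
  have h := Real.pow_three_mul_cos_le hx
  have hx0 := hx.1
  -- By the arithmetic–geometric mean inequality the square of the right side is at least `4 x cos x
  -- sin³ x`, and the cubic inequality bounds this below by `4 x⁴ cos² x`.
  apply le_of_sq_le_sq _ (by positivity)
  nlinarith [sq_nonneg (x * Real.sin x - Real.cos x * Real.sin x ^ 2),
    mul_le_mul_of_nonneg_left h (mul_nonneg hx.1 hc.le)]

/-- This is `(c - μ₁(c)) / c²` in the variable `x` with `c = x tan x`; Wilker's inequality is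
exactly the sign of its derivative. -/
theorem antitoneOn_tan_ratio : AntitoneOn
    (fun x => (Real.cos x * Real.sin x - x * Real.cos x ^ 2) / (x * Real.sin x ^ 2))
    (Ioo 0 (Real.pi / 2)) := by
  have hs : ∀ x ∈ Ioo 0 (Real.pi / 2), 0 < Real.sin x := fun x hx =>
    Real.sin_pos_of_pos_of_lt_pi hx.1 (by linarith [hx.2, Real.pi_pos])
  have hd : ∀ x ∈ Ioo 0 (Real.pi / 2), HasDerivAt
      (fun x => (Real.cos x * Real.sin x - x * Real.cos x ^ 2) / (x * Real.sin x ^ 2))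
      (-(Real.sin x * (x * Real.sin x + Real.cos x * Real.sin x ^ 2 - 2 * x ^ 2 * Real.cos x)) /
        (x * Real.sin x ^ 2) ^ 2) x := by
    intro x hx
    have h0 := hs x hx
    have h1 := hx.1
    have e := Real.sin_sq_add_cos_sq x
    refine HasDerivAt.congr_deriv ((((Real.hasDerivAt_cos x).mul (Real.hasDerivAt_sin x)).sub
      ((hasDerivAt_id x).mul ((Real.hasDerivAt_cos x).pow 2))).div
      ((hasDerivAt_id x).mul ((Real.hasDerivAt_sin x).pow 2)) 
        (show x * Real.sin x ^ 2 ≠ 0 by positivity)) ?_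
    simp only [Pi.mul_apply, Pi.pow_apply, Pi.sub_apply, id]
    congr 1
    norm_num
    linear_combination (-x * Real.sin x ^ 2 + 2 * x ^ 2 * Real.sin x * Real.cos x) * e
  apply antitoneOn_of_deriv_nonpos (convex_Ioo _ _)
  · exact fun y hy => (hd y hy).continuousAt.continuousWithinAt
  · intro y hy
    rw [interior_Ioo] at hy
    exact (hd y hy).differentiableAt.differentiableWithinAt
  · intro y hy
    rw [interior_Ioo] at hy
    rw [(hd y hy).deriv]
    have := Real.wilker (Ioo_subset_Ico_self hy)
    exact div_nonpos_of_nonpos_of_nonneg (neg_nonpos.2 (mul_nonneg (hs y hy).le (by linarith)))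
      (by positivity)

theorem Real.sinh_le_mul_cosh {x : ℝ} (hx : 0 ≤ x) : Real.sinh x ≤ x * Real.cosh x := by
  have := nonneg_of_hasDerivAt_nonneg (b := x + 1)
    (f := fun x => x * Real.cosh x - Real.sinh x) (f' := fun x => x * Real.sinh x) (by simp)
    (fun y _ => (((hasDerivAt_id y).mul (Real.hasDerivAt_cosh y)).sub
      (Real.hasDerivAt_sinh y)).congr_deriv (by simp))
    (fun y hy => mul_nonneg hy.1.le (Real.sinh_nonneg_iff.2 hy.1.le)) (x := x)
    ⟨hx, by linarith⟩
  linarith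

/-- A hyperbolic analogue of Wilker's inequality. -/
theorem Real.hyperbolic_wilker {x : ℝ} (hx : 0 ≤ x) :
    2 * Real.sinh x ^ 2 ≤ x ^ 2 + x * (Real.cosh x * Real.sinh x) := by
  -- This expression is the derivative of the difference of the two sides, and its own derivative is
  -- `4 sinh x (x cosh x - sinh x) ≥ 0`; both vanish at `0`.
  have h2 : ∀ x : ℝ, 0 ≤ x →
      0 ≤ 3 * x + 2 * x * Real.sinh x ^ 2 - 3 * (Real.sinh x * Real.cosh x) := fun x hx =>
    nonneg_of_hasDerivAt_nonneg (b := x + 1)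
      (f := fun x => 3 * x + 2 * x * Real.sinh x ^ 2 - 3 * (Real.sinh x * Real.cosh x))
      (f' := fun x => 4 * Real.sinh x * (x * Real.cosh x - Real.sinh x)) (by simp)
      (fun y _ => by
        have e := Real.cosh_sq y
        refine HasDerivAt.congr_deriv (((hasDerivAt_const_mul_id 3 y).add
          ((hasDerivAt_const_mul_id 2 y).mul ((Real.hasDerivAt_sinh y).pow 2))).sub
          (((Real.hasDerivAt_sinh y).mul (Real.hasDerivAt_cosh y)).const_mul 3)) ?_
        simp only [Pi.pow_apply]
        norm_num
        linear_combination (-3) * e)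
      (fun y hy => mul_nonneg (mul_nonneg (by norm_num) (Real.sinh_nonneg_iff.2 hy.1.le))
        (sub_nonneg.2 (Real.sinh_le_mul_cosh hy.1.le))) (x := x) ⟨hx, by linarith⟩
  have := nonneg_of_hasDerivAt_nonneg (b := x + 1)
    (f := fun x => x ^ 2 + x * (Real.cosh x * Real.sinh x) - 2 * Real.sinh x ^ 2)
    (f' := fun x => 3 * x + 2 * x * Real.sinh x ^ 2 - 3 * (Real.sinh x * Real.cosh x)) (by simp)
    (fun y _ => by
      have e := Real.cosh_sq y
      refine HasDerivAt.congr_deriv (((hasDerivAt_pow 2 y).add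
        ((hasDerivAt_id y).mul ((Real.hasDerivAt_cosh y).mul (Real.hasDerivAt_sinh y)))).sub
        (((Real.hasDerivAt_sinh y).pow 2).const_mul 2)) ?_
      simp only [Pi.mul_apply, id]
      norm_num
      linear_combination y * e)
    (fun y hy => h2 y hy.1.le) (x := x) ⟨hx, by linarith⟩
  linarith

theorem antitoneOn_coth : AntitoneOn (fun x => Real.cosh x / Real.sinh x) (Ioi 0) := by
  intro x hx y hy hxy
  simp only
  rw [div_le_div_iff₀ (Real.sinh_pos_iff.2 hy) (Real.sinh_pos_iff.2 hx)]
  have := Real.sinh_nonneg_iff.2 (sub_nonneg.2 hxy)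
  rw [Real.sinh_sub] at this
  linarith

/-- One factor of the defect ratio for negative parameters, in the variable `x` with `k = x tanh x`.
The sign of its derivative is the hyperbolic Wilker inequality; the remaining factor `coth²` is
decreasing by `antitoneOn_coth`. -/
theorem antitoneOn_coth_ratio : AntitoneOn
    (fun x => (x * Real.cosh x - Real.sinh x) / (x ^ 2 * Real.sinh x)) (Ioi 0) := by
  have hd : ∀ x ∈ Ioi (0 : ℝ), HasDerivAt
      (fun x => (x * Real.cosh x - Real.sinh x) / (x ^ 2 * Real.sinh x))
      (-(x * (x ^ 2 + x * (Real.cosh x * Real.sinh x) - 2 * Real.sinh x ^ 2)) /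
        (x ^ 2 * Real.sinh x) ^ 2) x := by
    intro x hx
    have h1 : 0 < x := hx
    have h0 := Real.sinh_pos_iff.2 h1
    have e := Real.cosh_sq x
    refine HasDerivAt.congr_deriv ((((hasDerivAt_id x).mul (Real.hasDerivAt_cosh x)).sub
      (Real.hasDerivAt_sinh x)).div ((hasDerivAt_pow 2 x).mul (Real.hasDerivAt_sinh x)) 
        (show x ^ 2 * Real.sinh x ≠ 0 by positivity)) ?_
    simp only [Pi.mul_apply, Pi.sub_apply, id]
    congr 1
    norm_num
    linear_combination (-x ^ 3) * e
  apply antitoneOn_of_deriv_nonpos (convex_Ioi _)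
  · exact fun y hy => (hd y hy).continuousAt.continuousWithinAt
  · intro y hy
    rw [interior_Ioi] at hy
    exact (hd y hy).differentiableAt.differentiableWithinAt
  · intro y hy
    rw [interior_Ioi] at hy
    rw [(hd y hy).deriv]
    have hy' : 0 < y := hy
    have := Real.hyperbolic_wilker hy'.le
    exact div_nonpos_of_nonpos_of_nonneg (neg_nonpos.2 (mul_nonneg hy'.le (by linarith)))
      (by positivity)

/-! ### The upper bound for the second eigenvalue of rectangles -/

theorem evenEigenvalue_ratio_pos {c c' : ℝ} (h0 : 0 < c') (h : c' ≤ c) :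
    (c - evenEigenvalue c) / c ^ 2 ≤ (c' - evenEigenvalue c') / c' ^ 2 := by
  have hm := monotone_evenEigenvalue h
  have ratio : ∀ c : ℝ, 0 < c → (c - evenEigenvalue c) / c ^ 2 =
      (Real.cos (g₁Inv c) * Real.sin (g₁Inv c) - g₁Inv c * Real.cos (g₁Inv c) ^ 2) /
        (g₁Inv c * Real.sin (g₁Inv c) ^ 2) := by
    intro c hc
    obtain ⟨h0, h1⟩ := g₁Inv_spec hc
    rw [evenEigenvalue_of_pos hc]
    set r := g₁Inv c
    have hr := h0.1
    have hC : 0 < Real.cos r := Real.cos_pos_of_mem_Ico (Ioo_subset_Ico_self h0)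
    have hS : 0 < Real.sin r :=
      Real.sin_pos_of_pos_of_lt_pi h0.1 (by linarith [h0.2, Real.pi_pos])
    have : c = r * (Real.sin r / Real.cos r) := by
      rw [← Real.tan_eq_sin_div_cos]; linarith
    rw [this]
    field_simp
  have s1 := g₁Inv_spec h0
  have s2 := g₁Inv_spec (h0.trans_le h)
  rw [ratio c (h0.trans_le h), ratio c' h0]
  rw [evenEigenvalue_of_pos h0, evenEigenvalue_of_pos (h0.trans_le h)] at hm
  exact antitoneOn_tan_ratio s1.1 s2.1 (le_of_sq_le_sq hm s2.1.1.le)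

/-- The power is cubic here, not quadratic as for positive parameters: with `k²` in the denominator
the quotient has limit `1/3` at `0` and `1` at infinity, so it cannot be antitone. The higher power
costs a term that `trialValue_lt` must absorb elsewhere. -/
theorem evenEigenvalue_ratio_neg {k k' : ℝ} (h0 : 0 < k') (h : k' ≤ k) :
    (-k - evenEigenvalue (-k)) / k ^ 3 ≤ (-k' - evenEigenvalue (-k')) / k' ^ 3 := by
  have hm := monotone_evenEigenvalue (neg_le_neg h)
  have ratio : ∀ k : ℝ, 0 < k → (-k - evenEigenvalue (-k)) / k ^ 3 =
      (h₁Inv k * Real.cosh (h₁Inv k) - Real.sinh (h₁Inv k)) / (h₁Inv k ^ 2 * Real.sinh (h₁Inv k)) *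
        (Real.cosh (h₁Inv k) / Real.sinh (h₁Inv k)) ^ 2 := by
    intro k hk
    obtain ⟨h0, h1⟩ := h₁Inv_spec hk
    rw [evenEigenvalue_of_neg (neg_neg_iff_pos.2 hk), neg_neg]
    set r := h₁Inv k
    have hC := Real.cosh_pos r
    have hS := Real.sinh_pos_iff.2 h0
    have : k = r * (Real.sinh r / Real.cosh r) := by
      rw [← Real.tanh_eq_sinh_div_cosh]; linarith
    rw [this]
    field_simp
    ring
  have s1 := h₁Inv_spec h0
  have s2 := h₁Inv_spec (h0.trans_le h)
  rw [ratio k (h0.trans_le h), ratio k' h0]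
  rw [evenEigenvalue_of_neg (neg_neg_iff_pos.2 h0),
    evenEigenvalue_of_neg (neg_neg_iff_pos.2 (h0.trans_le h)), neg_neg, neg_neg] at hm
  have hle : h₁Inv k' ≤ h₁Inv k := le_of_sq_le_sq (neg_le_neg_iff.1 hm) s2.1.le
  have p1 := Real.sinh_pos_iff.2 s1.1
  have p2 := Real.sinh_pos_iff.2 s2.1
  have q2 := Real.cosh_pos (h₁Inv k)
  have a1 := antitoneOn_coth_ratio s1.1 s2.1 hle
  have a2 := antitoneOn_coth s1.1 s2.1 hle
  simp only at a1 a2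
  gcongr
  exact div_nonneg (sub_nonneg.2 (Real.sinh_le_mul_cosh s1.1.le)) (by positivity)

/-- The scaled energy of the natural trial space on a rectangle of shape `τ`. -/
noncomputable def trialValue (c τ : ℝ) : ℝ :=
  oddEigenvalue (c * (2 - τ)) * (τ / (2 - τ)) + evenEigenvalue (c * τ) * ((2 - τ) / τ)

/-- Concavity of `μ₂` and the defect ratio for `μ₁` bound the trial value by an expression in `c`,
`μ₁(c)`, `μ₂(c)` and `τ`; the hypothesis `2c ≤ μ₁ + μ₂`, weighted by `1 - τ`, compares it with the
square. For `c ≥ 0` what remains has the right sign. For `c < 0` a deficit appears, and the last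
hypothesis keeps it below the slack gained from `μ₂(0) = π² / 4`. -/
theorem trialValue_lt {c τ : ℝ} (h0 : 0 < τ) (h1 : τ < 1)
    (hD : 2 * c ≤ evenEigenvalue c + oddEigenvalue c)
    (hneg : c < 0 → 2 * (c - evenEigenvalue c) < Real.pi ^ 2 / 4) :
    trialValue c τ < evenEigenvalue c + oddEigenvalue c := by
  have h2 : 0 < 2 - τ := by linarith
  have hpi : 0 < Real.pi ^ 2 / 4 := by positivity
  -- `c` is the convex combination of `c (2 - τ)` and `0` with weights `1 / (2 - τ)` and `(1 - τ) /
  -- (2 - τ)`.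
  have A : oddEigenvalue (c * (2 - τ)) ≤
      (2 - τ) * oddEigenvalue c - (1 - τ) * (Real.pi ^ 2 / 4) := by
    have := concaveOn_oddEigenvalue.2 (mem_univ (c * (2 - τ))) (mem_univ 0)
      (show 0 ≤ 1 / (2 - τ) by positivity) (show 0 ≤ (1 - τ) / (2 - τ) from
        div_nonneg (by linarith) h2.le) (by field_simp; ring)
    simp only [smul_eq_mul, mul_zero, add_zero, oddEigenvalue_zero] at this
    rw [show 1 / (2 - τ) * (c * (2 - τ)) = c by field_simp] at this
    have := mul_le_mul_of_nonneg_left this h2.le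
    rw [show (2 - τ) * (1 / (2 - τ) * oddEigenvalue (c * (2 - τ)) +
      (1 - τ) / (2 - τ) * (Real.pi ^ 2 / 4)) = oddEigenvalue (c * (2 - τ)) +
      (1 - τ) * (Real.pi ^ 2 / 4) by field_simp] at this
    linarith
  have A' : oddEigenvalue (c * (2 - τ)) * (τ / (2 - τ)) ≤
      τ * oddEigenvalue c - τ * ((1 - τ) * (Real.pi ^ 2 / 4) / (2 - τ)) := by
    refine (mul_le_mul_of_nonneg_right A (by positivity)).trans (le_of_eq ?_)
    field_simp
  have slack : 0 < τ * ((1 - τ) * (Real.pi ^ 2 / 4) / (2 - τ)) :=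
    mul_pos h0 (div_pos (mul_pos (by linarith) hpi) h2)
  have hself := evenEigenvalue_le_self c
  have hD' := mul_le_mul_of_nonneg_left hD (show 0 ≤ 1 - τ by linarith)
  unfold trialValue
  rcases lt_trichotomy c 0 with hc | rfl | hc
  · have B : evenEigenvalue (c * τ) ≤ c * τ - τ ^ 3 * (c - evenEigenvalue c) := by
      have hk : 0 < -c := by linarith
      have := evenEigenvalue_ratio_neg (k := -c) (k' := -c * τ) (by positivity) (by nlinarith)
      rw [neg_neg, show -(-c * τ) = c * τ by ring, div_le_div_iff₀ (by positivity)
        (by positivity)] at this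
      have h3 : 0 < (-c) ^ 3 := by positivity
      have : (-c) ^ 3 * (τ ^ 3 * (c - evenEigenvalue c)) ≤
          (-c) ^ 3 * (c * τ - evenEigenvalue (c * τ)) := by
        linarith
      linarith [le_of_mul_le_mul_left this h3]
    have B' : evenEigenvalue (c * τ) * ((2 - τ) / τ) ≤
        (2 - τ) * c - (2 - τ) * τ ^ 2 * (c - evenEigenvalue c) := by
      refine (mul_le_mul_of_nonneg_right B (by positivity)).trans (le_of_eq ?_)
      field_simp
    -- The left side is the deficit left by the cubic bound, the right side the slack from
    -- concavity. After cancellation, `(1 - τ)(2 - τ) ≤ 2` reduces the claim to the assumed bound on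
    -- the defect.
    have S : τ * ((c - evenEigenvalue c) * (1 - τ) ^ 2) <
        τ * ((1 - τ) * (Real.pi ^ 2 / 4) / (2 - τ)) := by
      apply mul_lt_mul_of_pos_left _ h0
      rw [lt_div_iff₀ h2]
      have h5 := hneg hc
      have h6 : 0 < 1 - τ := by linarith
      have h7 : (c - evenEigenvalue c) * ((1 - τ) * (2 - τ)) ≤ (c - evenEigenvalue c) * 2 :=
        mul_le_mul_of_nonneg_left (by nlinarith) (by linarith)
      nlinarith
    nlinarith
  · simp only [zero_mul, evenEigenvalue_zero] at *
    linarith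
  · have B : evenEigenvalue (c * τ) ≤ c * τ - τ ^ 2 * (c - evenEigenvalue c) := by
      have := evenEigenvalue_ratio_pos (c := c) (c' := c * τ) (by positivity) (by nlinarith)
      rw [div_le_div_iff₀ (by positivity) (by positivity)] at this
      have h3 : 0 < c ^ 2 := by positivity
      have : c ^ 2 * (τ ^ 2 * (c - evenEigenvalue c)) ≤
          c ^ 2 * (c * τ - evenEigenvalue (c * τ)) := by
        linarith
      linarith [le_of_mul_le_mul_left this h3]
    have B' : evenEigenvalue (c * τ) * ((2 - τ) / τ) ≤
        (2 - τ) * c - (2 - τ) * τ * (c - evenEigenvalue c) := by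
      refine (mul_le_mul_of_nonneg_right B (by positivity)).trans (le_of_eq ?_)
      field_simp
    -- With the quadratic bound the remainder is `τ (1 - τ) (c - μ₁(c)) ≥ 0`, so no slack has to be
    -- spent.
    nlinarith [mul_nonneg (mul_nonneg h0.le (show 0 ≤ 1 - τ by linarith))
      (sub_nonneg.2 hself)]


/-! ### Numerical enclosures of the roots -/

/-- An even number of terms of the exponential series splits evenly into cosine and sine
polynomials, so one remainder bound for the complex exponential serves both. -/
theorem Complex.sum_range_exp_mul_I (x : ℝ) (n : ℕ) :
    ∑ m ∈ Finset.range (2 * n), ((x : ℂ) * Complex.I) ^ m / (m.factorial : ℂ) =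
      ((∑ m ∈ Finset.range n, (-1) ^ m * x ^ (2 * m) / ((2 * m).factorial : ℝ) : ℝ) : ℂ) +
      ((∑ m ∈ Finset.range n, (-1) ^ m * x ^ (2 * m + 1) / ((2 * m + 1).factorial : ℝ) : ℝ) : ℂ) *
        Complex.I := by
  induction n with
  | zero => simp
  | succ n ih =>
    rw [show 2 * (n + 1) = 2 * n + 1 + 1 by ring, Finset.sum_range_succ, Finset.sum_range_succ, ih,
      Finset.sum_range_succ, Finset.sum_range_succ]
    push_cast
    have h : Complex.I ^ (2 * n) = (-1) ^ n := by rw [pow_mul, Complex.I_sq]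
    rw [mul_pow, mul_pow, pow_succ Complex.I, h]
    ring

theorem Complex.abs_re_le_norm_add_mul_I (a b : ℝ) : |a| ≤ ‖(a : ℂ) + (b : ℂ) * Complex.I‖ := by
  simpa using Complex.abs_re_le_norm ((a : ℂ) + (b : ℂ) * Complex.I)

theorem Complex.abs_im_le_norm_add_mul_I (a b : ℝ) : |b| ≤ ‖(a : ℂ) + (b : ℂ) * Complex.I‖ := by
  simpa using Complex.abs_im_le_norm ((a : ℂ) + (b : ℂ) * Complex.I)

theorem Complex.norm_exp_mul_I_sub_le {x : ℝ} {n : ℕ} (hx : |x| / (2 * n + 1) ≤ 1 / 2) :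
    ‖((Real.cos x - ∑ m ∈ Finset.range n, (-1) ^ m * x ^ (2 * m) / ((2 * m).factorial : ℝ) : ℝ) : ℂ) +
      ((Real.sin x - ∑ m ∈ Finset.range n,
        (-1) ^ m * x ^ (2 * m + 1) / ((2 * m + 1).factorial : ℝ) : ℝ) : ℂ) * Complex.I‖ ≤
      |x| ^ (2 * n) / (2 * n).factorial * 2 := by
  have := Complex.exp_bound' (x := (x : ℂ) * Complex.I) (n := 2 * n) (by simpa using hx)
  rw [Complex.sum_range_exp_mul_I, Complex.exp_mul_I] at this
  refine (le_of_eq ?_).trans (this.trans (le_of_eq (by simp)))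
  congr 1
  push_cast
  ring

theorem Real.abs_cos_sub_sum_le {x : ℝ} (n : ℕ) (hx : |x| / (2 * n + 1) ≤ 1 / 2) :
    |Real.cos x - ∑ m ∈ Finset.range n, (-1) ^ m * x ^ (2 * m) / ((2 * m).factorial : ℝ)| ≤
      |x| ^ (2 * n) / (2 * n).factorial * 2 :=
  (Complex.abs_re_le_norm_add_mul_I _ _).trans (Complex.norm_exp_mul_I_sub_le hx)

theorem Real.abs_sin_sub_sum_le {x : ℝ} (n : ℕ) (hx : |x| / (2 * n + 1) ≤ 1 / 2) :
    |Real.sin x - ∑ m ∈ Finset.range n, (-1) ^ m * x ^ (2 * m + 1) / ((2 * m + 1).factorial : ℝ)| ≤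
      |x| ^ (2 * n) / (2 * n).factorial * 2 :=
  (Complex.abs_im_le_norm_add_mul_I _ _).trans (Complex.norm_exp_mul_I_sub_le hx)

theorem Real.abs_exp_sub_sum_le {x : ℝ} (n : ℕ) (hx : |x| / (n + 1) ≤ 1 / 2) :
    |Real.exp x - ∑ m ∈ Finset.range n, x ^ m / (m.factorial : ℝ)| ≤
      |x| ^ n / n.factorial * 2 := by
  have := Complex.exp_bound' (x := (x : ℂ)) (n := n) (by simpa using hx)
  rw [Complex.norm_real, Real.norm_eq_abs] at this
  refine (le_of_eq ?_).trans this
  rw [← Real.norm_eq_abs, ← Complex.norm_real]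
  push_cast
  rfl

/-! ### Locating the inverse functions by sign tests -/

theorem lt_g₁Inv {c x : ℝ} (hc : 0 < c) (hx : x ≤ Real.pi / 2)
    (h : x * Real.sin x < c * Real.cos x) : x < g₁Inv c := by
  obtain ⟨h0, h1⟩ := g₁Inv_spec hc
  have hC := Real.cos_pos_of_mem_Ico (Ioo_subset_Ico_self h0)
  rw [Real.tan_eq_sin_div_cos, mul_div_assoc', div_eq_iff hC.ne'] at h1
  by_contra! hle
  have e1 := Real.sin_le_sin_of_le_of_le_pi_div_two (by linarith [h0.1, Real.pi_pos]) hx hle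
  have e2 := Real.cos_le_cos_of_nonneg_of_le_pi h0.1.le (by linarith [Real.pi_pos]) hle
  have e3 : 0 ≤ Real.sin (g₁Inv c) :=
    Real.sin_nonneg_of_nonneg_of_le_pi h0.1.le (by linarith [h0.2, Real.pi_pos])
  have e4 := mul_le_mul hle e1 e3 (h0.1.le.trans hle)
  have e5 := mul_le_mul_of_nonneg_left e2 hc.le
  linarith

theorem g₁Inv_lt {c x : ℝ} (hc : 0 < c) (hx : 0 ≤ x)
    (h : c * Real.cos x < x * Real.sin x) : g₁Inv c < x := by
  obtain ⟨h0, h1⟩ := g₁Inv_spec hc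
  have hC := Real.cos_pos_of_mem_Ico (Ioo_subset_Ico_self h0)
  rw [Real.tan_eq_sin_div_cos, mul_div_assoc', div_eq_iff hC.ne'] at h1
  by_contra! hle
  have e1 := Real.sin_le_sin_of_le_of_le_pi_div_two (by linarith [Real.pi_pos]) h0.2.le hle
  have e2 := Real.cos_le_cos_of_nonneg_of_le_pi hx (by linarith [h0.2, Real.pi_pos]) hle
  have e3 : 0 ≤ Real.sin x :=
    Real.sin_nonneg_of_nonneg_of_le_pi hx (by linarith [h0.2, Real.pi_pos])
  have e4 := mul_le_mul hle e1 e3 h0.1.le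
  have e5 := mul_le_mul_of_nonneg_left e2 hc.le
  linarith

theorem antitoneOn_mul_cot : AntitoneOn (fun x => x * Real.cos x / Real.sin x) (Ioo 0 Real.pi) := by
  have hd : ∀ x ∈ Ioo 0 Real.pi, HasDerivAt (fun x => x * Real.cos x / Real.sin x)
      (-(x - Real.sin x * Real.cos x) / Real.sin x ^ 2) x := by
    intro x hx
    have e := Real.sin_sq_add_cos_sq x
    refine (((hasDerivAt_id x).mul (Real.hasDerivAt_cos x)).div (Real.hasDerivAt_sin x)
      (Real.sin_pos_of_mem_Ioo hx).ne').congr_deriv ?_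
    simp only [Pi.mul_apply, id]
    congr 1
    linear_combination (-x) * e
  apply antitoneOn_of_deriv_nonpos (convex_Ioo _ _)
  · exact fun y hy => (hd y hy).continuousAt.continuousWithinAt
  · intro y hy
    rw [interior_Ioo] at hy
    exact (hd y hy).differentiableAt.differentiableWithinAt
  · intro y hy
    rw [interior_Ioo] at hy
    rw [(hd y hy).deriv]
    have h1 := Real.sin_pos_of_mem_Ioo hy
    have h2 := Real.sin_le hy.1.le
    have h3 := Real.cos_le_one y
    exact div_nonpos_of_nonpos_of_nonneg (by nlinarith) (by positivity)

/-- The sine is not monotone on `(0, π)`, so the test rests on the monotonicity of `x cot x` instead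
of that of the separate factors. -/
theorem lt_g₂Inv {c x : ℝ} (hc : -1 < c) (hx : x ∈ Ioo 0 Real.pi)
    (h : 0 < c * Real.sin x + x * Real.cos x) : x < g₂Inv c := by
  obtain ⟨h0, h1⟩ := g₂Inv_spec hc
  rw [Real.cot_eq_cos_div_sin] at h1
  by_contra! hle
  have := antitoneOn_mul_cot h0 hx hle
  simp only at this
  rw [show g₂Inv c * Real.cos (g₂Inv c) / Real.sin (g₂Inv c) = -c by
    linear_combination -h1,
    div_le_iff₀ (Real.sin_pos_of_mem_Ioo hx)] at this
  linarith

theorem g₂Inv_lt {c x : ℝ} (hc : -1 < c) (hx : 0 < x)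
    (h : c * Real.sin x + x * Real.cos x < 0) : g₂Inv c < x := by
  obtain ⟨h0, h1⟩ := g₂Inv_spec hc
  rw [Real.cot_eq_cos_div_sin] at h1
  by_contra! hle
  have hx' : x ∈ Ioo 0 Real.pi := ⟨hx, hle.trans_lt h0.2⟩
  have := antitoneOn_mul_cot hx' h0 hle
  simp only at this
  rw [show g₂Inv c * Real.cos (g₂Inv c) / Real.sin (g₂Inv c) = -c by
    linear_combination -h1,
    le_div_iff₀ (Real.sin_pos_of_mem_Ioo hx')] at this
  linarith

/-- With this form every hyperbolic sign test involves the single number `exp (2x)`, so one Taylor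
bound settles it. -/
theorem Real.coth_eq_exp {x : ℝ} (hx : 0 < x) : Real.cosh x / Real.sinh x =
    (Real.exp (2 * x) + 1) / (Real.exp (2 * x) - 1) := by
  have h1 : 1 < Real.exp (2 * x) := Real.one_lt_exp_iff.2 (by linarith)
  rw [div_eq_div_iff (Real.sinh_pos_iff.2 hx).ne' (by linarith), Real.cosh_eq, Real.sinh_eq,
    show (2 : ℝ) * x = x + x by ring, Real.exp_add, Real.exp_neg]
  field_simp

theorem h₁Inv_eq_mul_coth {c : ℝ} (hc : 0 < c) :
    h₁Inv c = c * (Real.cosh (h₁Inv c) / Real.sinh (h₁Inv c)) := by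
  obtain ⟨h0, h1⟩ := h₁Inv_spec hc
  rw [Real.tanh_eq_sinh_div_cosh, mul_div_assoc', div_eq_iff (Real.cosh_pos _).ne'] at h1
  rw [mul_div_assoc', eq_div_iff (Real.sinh_pos_iff.2 h0).ne']
  linarith

theorem lt_h₁Inv {c x : ℝ} (hc : 0 < c) (hx : 0 < x)
    (h : x * (Real.exp (2 * x) - 1) < c * (Real.exp (2 * x) + 1)) : x < h₁Inv c := by
  have h1 : 1 < Real.exp (2 * x) := Real.one_lt_exp_iff.2 (by linarith)
  rw [← lt_div_iff₀ (by linarith), mul_div_assoc, ← Real.coth_eq_exp hx] at h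
  by_contra! hle
  have := mul_le_mul_of_nonneg_left (antitoneOn_coth (h₁Inv_spec hc).1 hx hle) hc.le
  simp only [← h₁Inv_eq_mul_coth hc] at this
  linarith

theorem h₁Inv_lt {c x : ℝ} (hc : 0 < c) (hx : 0 < x)
    (h : c * (Real.exp (2 * x) + 1) < x * (Real.exp (2 * x) - 1)) : h₁Inv c < x := by
  have h1 : 1 < Real.exp (2 * x) := Real.one_lt_exp_iff.2 (by linarith)
  rw [← div_lt_iff₀ (by linarith), mul_div_assoc, ← Real.coth_eq_exp hx] at h
  by_contra! hle
  have := mul_le_mul_of_nonneg_left (antitoneOn_coth hx (h₁Inv_spec hc).1 hle) hc.le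
  simp only [← h₁Inv_eq_mul_coth hc] at this
  linarith

theorem monotoneOn_mul_coth : MonotoneOn (fun x => x * Real.cosh x / Real.sinh x) (Ioi 0) := by
  have hd : ∀ x ∈ Ioi (0 : ℝ), HasDerivAt (fun x => x * Real.cosh x / Real.sinh x)
      ((Real.sinh x * Real.cosh x - x) / Real.sinh x ^ 2) x := by
    intro x hx
    have e := Real.cosh_sq x
    refine (((hasDerivAt_id x).mul (Real.hasDerivAt_cosh x)).div (Real.hasDerivAt_sinh x)
      (Real.sinh_pos_iff.2 hx).ne').congr_deriv ?_
    simp only [Pi.mul_apply, id]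
    congr 1
    linear_combination (-x) * e
  apply monotoneOn_of_deriv_nonneg (convex_Ioi _)
  · exact fun y hy => (hd y hy).continuousAt.continuousWithinAt
  · intro y hy
    rw [interior_Ioi] at hy
    exact (hd y hy).differentiableAt.differentiableWithinAt
  · intro y hy
    rw [interior_Ioi] at hy
    rw [(hd y hy).deriv]
    have hy' : 0 < y := hy
    have h2 := Real.self_le_sinh_iff.2 hy'.le
    have h3 := Real.one_le_cosh y
    exact div_nonneg (by nlinarith) (by positivity)

theorem lt_h₂Inv {c x : ℝ} (hc : 1 < c) (hx : 0 < x)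
    (h : x * (Real.exp (2 * x) + 1) < c * (Real.exp (2 * x) - 1)) : x < h₂Inv c := by
  have h1 : 1 < Real.exp (2 * x) := Real.one_lt_exp_iff.2 (by linarith)
  rw [← div_lt_iff₀ (by linarith), mul_div_assoc, ← Real.coth_eq_exp hx] at h
  by_contra! hle
  have := monotoneOn_mul_coth (h₂Inv_spec hc).1 hx hle
  simp only [mul_div_assoc, (h₂Inv_spec hc).2] at this
  linarith

theorem h₂Inv_lt {c x : ℝ} (hc : 1 < c) (hx : 0 < x)
    (h : c * (Real.exp (2 * x) - 1) < x * (Real.exp (2 * x) + 1)) : h₂Inv c < x := by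
  have h1 : 1 < Real.exp (2 * x) := Real.one_lt_exp_iff.2 (by linarith)
  rw [← lt_div_iff₀ (by linarith), mul_div_assoc, ← Real.coth_eq_exp hx] at h
  by_contra! hle
  have := monotoneOn_mul_coth hx (h₂Inv_spec hc).1 hle
  simp only [mul_div_assoc, (h₂Inv_spec hc).2] at this
  linarith

/-- The difference whose sign decides whether the square is a maximizer. -/
noncomputable def squareExcess (c : ℝ) : ℝ := evenEigenvalue c + oddEigenvalue c - 2 * c

/-- The squares of the two lower bounds sum to slightly more than `33.2053 / 4`; the margin is below
`10⁻⁵`, hence the six decimals. -/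
theorem squareExcess_lower_right : 0 < squareExcess (33.2053 / 8) := by
  have hc : (0 : ℝ) < 33.2053 / 8 := by norm_num
  have a1 : 1.273166 < g₁Inv (33.2053 / 8) := by
    apply lt_g₁Inv hc (by linarith [Real.pi_gt_three])
    have h1 := abs_le.1 (Real.abs_cos_sub_sum_le (x := 1.273166) 9 (by norm_num))
    have h2 := abs_le.1 (Real.abs_sin_sub_sum_le (x := 1.273166) 9 (by norm_num))
    norm_num [Finset.sum_range_succ, Nat.factorial] at h1 h2
    linarith
  have a2 : 2.584643 < g₂Inv (33.2053 / 8) := by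
    apply lt_g₂Inv (by linarith) ⟨by norm_num, by linarith [Real.pi_gt_three]⟩
    have h1 := abs_le.1 (Real.abs_cos_sub_sum_le (x := 2.584643) 10 (by norm_num))
    have h2 := abs_le.1 (Real.abs_sin_sub_sum_le (x := 2.584643) 10 (by norm_num))
    norm_num [Finset.sum_range_succ, Nat.factorial] at h1 h2
    linarith
  rw [squareExcess, evenEigenvalue_of_pos hc, oddEigenvalue_of_gt (by linarith)]
  nlinarith

theorem squareExcess_upper_right : squareExcess (33.2055 / 8) < 0 := by
  have hc : (0 : ℝ) < 33.2055 / 8 := by norm_num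
  have a1 : g₁Inv (33.2055 / 8) < 1.273172 := by
    apply g₁Inv_lt hc (by norm_num)
    have h1 := abs_le.1 (Real.abs_cos_sub_sum_le (x := 1.273172) 9 (by norm_num))
    have h2 := abs_le.1 (Real.abs_sin_sub_sum_le (x := 1.273172) 9 (by norm_num))
    norm_num [Finset.sum_range_succ, Nat.factorial] at h1 h2
    linarith
  have a2 : g₂Inv (33.2055 / 8) < 2.584648 := by
    apply g₂Inv_lt (by linarith) (by norm_num)
    have h1 := abs_le.1 (Real.abs_cos_sub_sum_le (x := 2.584648) 10 (by norm_num))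
    have h2 := abs_le.1 (Real.abs_sin_sub_sum_le (x := 2.584648) 10 (by norm_num))
    norm_num [Finset.sum_range_succ, Nat.factorial] at h1 h2
    linarith
  have b1 := (g₁Inv_spec hc).1.1
  have b2 := (g₂Inv_spec (c := 33.2055 / 8) (by linarith)).1.1
  rw [squareExcess, evenEigenvalue_of_pos hc, oddEigenvalue_of_gt (by linarith)]
  nlinarith

/-- Both eigenvalues are now negatives of squares, so positivity calls for upper bounds on the
inverses. -/
theorem squareExcess_upper_left : 0 < squareExcess (-9.3884 / 8) := by
  have a1 : h₁Inv (9.3884 / 8) < 1.344618 := by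
    apply h₁Inv_lt (by norm_num) (by norm_num)
    have h1 := abs_le.1 (Real.abs_exp_sub_sum_le (x := 2 * 1.344618) 18 (by norm_num))
    norm_num [Finset.sum_range_succ, Nat.factorial] at h1 ⊢
    linarith
  have a2 : h₂Inv (9.3884 / 8) < 0.734223 := by
    apply h₂Inv_lt (by norm_num) (by norm_num)
    have h1 := abs_le.1 (Real.abs_exp_sub_sum_le (x := 2 * 0.734223) 14 (by norm_num))
    norm_num [Finset.sum_range_succ, Nat.factorial] at h1 ⊢
    linarith
  have b1 := (h₁Inv_spec (c := 9.3884 / 8) (by norm_num)).1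
  have b2 := (h₂Inv_spec (c := 9.3884 / 8) (by norm_num)).1
  rw [squareExcess, evenEigenvalue_of_neg (by norm_num), oddEigenvalue_of_lt (by norm_num),
    show -(-9.3884 / 8 : ℝ) = 9.3884 / 8 by norm_num]
  nlinarith

theorem squareExcess_lower_left : squareExcess (-9.3886 / 8) < 0 := by
  have a1 : 1.344635 < h₁Inv (9.3886 / 8) := by
    apply lt_h₁Inv (by norm_num) (by norm_num)
    have h1 := abs_le.1 (Real.abs_exp_sub_sum_le (x := 2 * 1.344635) 18 (by norm_num))
    norm_num [Finset.sum_range_succ, Nat.factorial] at h1 ⊢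
    linarith
  have a2 : 0.734273 < h₂Inv (9.3886 / 8) := by
    apply lt_h₂Inv (by norm_num) (by norm_num)
    have h1 := abs_le.1 (Real.abs_exp_sub_sum_le (x := 2 * 0.734273) 14 (by norm_num))
    norm_num [Finset.sum_range_succ, Nat.factorial] at h1 ⊢
    linarith
  rw [squareExcess, evenEigenvalue_of_neg (by norm_num), oddEigenvalue_of_lt (by norm_num),
    show -(-9.3886 / 8 : ℝ) = 9.3886 / 8 by norm_num]
  nlinarith

/-- The ground state defect is small in the range of parameters that matters. -/
theorem two_mul_self_sub_evenEigenvalue_lt {c : ℝ} (h0 : c < 0) (h1 : -9.3886 / 8 ≤ c) :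
    2 * (c - evenEigenvalue c) < Real.pi ^ 2 / 4 := by
  have hk : 0 < -c := by linarith
  obtain ⟨s0, s1⟩ := h₁Inv_spec hk
  rw [evenEigenvalue_of_neg h0]
  -- The defect is `r² - r tanh r ≤ r³ / (1 + r)`, which for `r < 1.4` stays below `1.15 < π² / 8`.
  have a1 : h₁Inv (-c) < 1.4 := by
    apply h₁Inv_lt hk (by norm_num)
    have h1 := abs_le.1 (Real.abs_exp_sub_sum_le (x := 2 * 1.4) 10 (by norm_num))
    norm_num [Finset.sum_range_succ, Nat.factorial] at h1 ⊢
    nlinarith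
  set r := h₁Inv (-c)
  have hC := Real.cosh_pos r
  have h3 := Real.mul_cosh_le_one_add_mul_sinh s0.le
  have h4 : r / (1 + r) ≤ Real.tanh r := by
    rw [Real.tanh_eq_sinh_div_cosh, div_le_div_iff₀ (by linarith) hC]; linarith
  have h5 : r ^ 2 / (1 + r) ≤ -c := by
    rw [← s1, pow_two, mul_div_assoc]
    exact mul_le_mul_of_nonneg_left h4 s0.le
  have h6 : r ^ 2 - r ^ 2 / (1 + r) < 1.15 := by
    rw [show r ^ 2 - r ^ 2 / (1 + r) = r ^ 3 / (1 + r) by field_simp; ring,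
      div_lt_iff₀ (by linarith)]
    nlinarith [mul_pos s0 s0, mul_nonneg s0.le (sub_nonneg.2 a1.le),
      mul_nonneg (mul_pos s0 s0).le (sub_nonneg.2 a1.le)]
  nlinarith [Real.pi_gt_d2]


/-! ### The critical parameters -/

theorem concaveOn_squareExcess : ConcaveOn ℝ univ squareExcess :=
  concaveOn_of_exists_supergradient fun c => by
    obtain ⟨d, _, h⟩ := exists_supergradient_evenEigenvalue c
    obtain ⟨e, _, h'⟩ := exists_supergradient_oddEigenvalue c
    refine ⟨d + e - 2, fun c' => ?_⟩
    unfold squareExcess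
    linarith [h c', h' c']

theorem concaveOn_trialValue_sub {τ : ℝ} (h0 : 0 < τ) (h1 : τ < 2) :
    ConcaveOn ℝ univ fun c => trialValue c τ - 2 * c :=
  concaveOn_of_exists_supergradient fun c => by
    have h2 : 0 < 2 - τ := by linarith
    obtain ⟨d, _, h⟩ := exists_supergradient_evenEigenvalue (c * τ)
    obtain ⟨e, _, h'⟩ := exists_supergradient_oddEigenvalue (c * (2 - τ))
    refine ⟨e * τ + d * (2 - τ) - 2, fun c' => ?_⟩
    unfold trialValue
    have e1 := mul_le_mul_of_nonneg_right (h (c' * τ)) (show 0 ≤ (2 - τ) / τ by positivity)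
    have e2 := mul_le_mul_of_nonneg_right (h' (c' * (2 - τ)))
      (show 0 ≤ τ / (2 - τ) by positivity)
    have e3 : d * (c' * τ - c * τ) * ((2 - τ) / τ) = d * (2 - τ) * (c' - c) := by field_simp
    have e4 : e * (c' * (2 - τ) - c * (2 - τ)) * (τ / (2 - τ)) = e * τ * (c' - c) := by field_simp
    linarith

/-- The point `p` lies between `0` and `t p`, so a nonnegative value at `t p` would force a positive
value at `p`. This gives uniqueness of the roots on each side and also the strict inequality beyond
them. -/
theorem ConcaveOn.neg_of_one_lt {F : ℝ → ℝ} (hF : ConcaveOn ℝ univ F) (h0 : 0 < F 0) {p t : ℝ}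
    (hp : F p ≤ 0) (ht : 1 < t) : F (t * p) < 0 := by
  have ht0 : 0 < t := by linarith
  have := hF.2 (mem_univ (t * p)) (mem_univ 0) (show 0 ≤ 1 / t by positivity)
    (show 0 ≤ (t - 1) / t from div_nonneg (by linarith) ht0.le) (by field_simp; ring)
  simp only [smul_eq_mul, mul_zero, add_zero] at this
  rw [show 1 / t * (t * p) = p by field_simp] at this
  have := mul_le_mul_of_nonneg_left (this.trans hp) ht0.le
  rw [show t * (1 / t * F (t * p) + (t - 1) / t * F 0) = F (t * p) + (t - 1) * F 0 by
    field_simp] at this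
  nlinarith

theorem squareExcess_zero_pos : 0 < squareExcess 0 := by
  have : 0 < Real.pi ^ 2 / 4 := by positivity
  rw [squareExcess, evenEigenvalue_zero, oddEigenvalue_zero]; linarith

theorem squareExcess_pos_of_lt_one {p t : ℝ} (hp : squareExcess p = 0) (h0 : 0 ≤ t) (h1 : t < 1) :
    0 < squareExcess (t * p) := by
  rcases h0.eq_or_lt with rfl | h0
  · rw [zero_mul]; exact squareExcess_zero_pos
  · by_contra! h
    have := concaveOn_squareExcess.neg_of_one_lt squareExcess_zero_pos h
      (show 1 < 1 / t by rw [lt_div_iff₀ h0]; linarith)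
    rw [show 1 / t * (t * p) = p by field_simp] at this
    linarith

theorem eq_of_squareExcess_eq_zero {p c : ℝ} (hp : squareExcess p = 0) (hc : squareExcess c = 0)
    (h : 0 < c / p) : c = p := by
  have hp0 : p ≠ 0 := by rintro rfl; simp at h
  have e : c / p * p = c := by field_simp
  rcases lt_trichotomy (c / p) 1 with h1 | h1 | h1
  · have := squareExcess_pos_of_lt_one hp h.le h1
    rw [e] at this; linarith
  · rw [← e, h1, one_mul]
  · have := concaveOn_squareExcess.neg_of_one_lt squareExcess_zero_pos hp.le h1
    rw [e] at this; linarith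

theorem continuous_squareExcess : Continuous squareExcess :=
  continuousOn_univ.1 (concaveOn_squareExcess.continuousOn isOpen_univ)

theorem exists_squareExcess_eq_zero_left :
    ∃ c ∈ Ioo (-9.3886 / 8 : ℝ) (-9.3884 / 8), squareExcess c = 0 := by
  obtain ⟨c, hc, h⟩ := intermediate_value_Ioo (show (-9.3886 / 8 : ℝ) ≤ -9.3884 / 8 by norm_num)
    continuous_squareExcess.continuousOn ⟨squareExcess_lower_left, squareExcess_upper_left⟩
  exact ⟨c, hc, h⟩

theorem exists_squareExcess_eq_zero_right :
    ∃ c ∈ Ioo (33.2053 / 8 : ℝ) (33.2055 / 8), squareExcess c = 0 := by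
  obtain ⟨c, hc, h⟩ := intermediate_value_Ioo' (show (33.2053 / 8 : ℝ) ≤ 33.2055 / 8 by norm_num)
    continuous_squareExcess.continuousOn ⟨squareExcess_upper_right, squareExcess_lower_right⟩
  exact ⟨c, hc, h⟩

theorem squareExcess_nonneg {cm cp c : ℝ} (hm : cm < 0) (hp : 0 < cp) (h1 : squareExcess cm = 0)
    (h2 : squareExcess cp = 0) (hc : c ∈ Icc cm cp) : 0 ≤ squareExcess c := by
  have := concaveOn_squareExcess.2 (mem_univ cm) (mem_univ cp)
    (show 0 ≤ (cp - c) / (cp - cm) from div_nonneg (by linarith [hc.2]) (by linarith))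
    (show 0 ≤ (c - cm) / (cp - cm) from div_nonneg (by linarith [hc.1]) (by linarith))
    (by rw [← add_div, div_eq_one_iff_eq (by linarith)]; ring)
  have h3 : cp - cm ≠ 0 := by linarith
  simp only [smul_eq_mul, h1, h2, mul_zero, add_zero] at this
  rwa [show (cp - c) / (cp - cm) * cm + (c - cm) / (cp - cm) * cp = c by
    field_simp; ring] at this

theorem isAlphaPlus_iff {a : ℝ} : IsAlphaPlus a ↔ 0 < a ∧ squareExcess (a / 8) = 0 := by
  unfold IsAlphaPlus
  refine and_congr_right fun h => ?_
  rw [squareExcess, evenEigenvalue_of_pos (by linarith), oddEigenvalue_of_gt (by linarith)]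
  constructor <;> intro h <;> linarith

theorem isAlphaMinus_iff {a : ℝ} : IsAlphaMinus a ↔ a < -8 ∧ squareExcess (a / 8) = 0 := by
  unfold IsAlphaMinus
  refine and_congr_right fun h => ?_
  rw [squareExcess, evenEigenvalue_of_neg (by linarith), oddEigenvalue_of_lt (by linarith),
    abs_of_neg (by linarith), neg_div]
  constructor <;> intro h <;> linarith

theorem trialValue_one (c : ℝ) : trialValue c 1 = evenEigenvalue c + oddEigenvalue c := by
  norm_num [trialValue]; ring

theorem trialValue_zero_pos {τ : ℝ} (h0 : 0 < τ) (h1 : τ < 2) : 0 < trialValue 0 τ := by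
  have h2 : 0 < 2 - τ := by linarith
  have := Real.pi_pos
  rw [trialValue, zero_mul, zero_mul, oddEigenvalue_zero, evenEigenvalue_zero]
  positivity

/-- At the root, `trialValue_lt` still applies because its hypothesis holds with equality, so the
trial value is at most `2p` there. Concavity along the ray from `0` does the rest. -/
theorem trialValue_lt_of_root {p t τ : ℝ} (hp : squareExcess p = 0) (hp' : -9.3886 / 8 ≤ p)
    (ht : 1 < t) (h0 : 0 < τ) (h1 : τ ≤ 1) : trialValue (t * p) τ < 2 * (t * p) := by
  have hle : trialValue p τ - 2 * p ≤ 0 := by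
    unfold squareExcess at hp
    rcases h1.eq_or_lt with rfl | h1
    · rw [trialValue_one]; linarith
    · have := trialValue_lt h0 h1 (c := p) (by linarith)
        (fun h => two_mul_self_sub_evenEigenvalue_lt h hp')
      linarith
  have := (concaveOn_trialValue_sub h0 (by linarith)).neg_of_one_lt
    (by simpa using trialValue_zero_pos h0 (by linarith)) hle ht
  linarith

theorem trialValue_lt_of_notMem {cm cp c τ : ℝ} (hm : cm ∈ Ioo (-9.3886 / 8 : ℝ) (-9.3884 / 8))
    (hp : 0 < cp) (h1 : squareExcess cm = 0) (h2 : squareExcess cp = 0) (hc : c ∉ Icc cm cp)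
    (hτ0 : 0 < τ) (hτ1 : τ ≤ 1) : trialValue c τ < 2 * c := by
  have hm0 : cm < 0 := by linarith [hm.2]
  rcases lt_or_ge c cm with h | h
  · have := trialValue_lt_of_root (t := c / cm) h1 hm.1.le
      (by rw [lt_div_iff_of_neg hm0]; linarith) hτ0 hτ1
    rwa [div_mul_cancel₀ _ hm0.ne] at this
  · have h' : cp < c := by
      by_contra! h3; exact hc ⟨h, h3⟩
    have := trialValue_lt_of_root (t := c / cp) h2 (by linarith)
      (by rw [lt_div_iff₀ hp]; linarith) hτ0 hτ1
    rwa [div_mul_cancel₀ _ hp.ne'] at this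

/-- This is the condition under which the second even level cannot undercut `μ₂`. For `c ≥ 0` it
holds since `μ₂ < π²` and `μ₁ ≥ 0`; for `c < 0` since `μ₂ ≤ π² / 4` and the ground state defect is
small. -/
theorem oddEigenvalue_le_pi_sq_add {c : ℝ} (hc : -9.3886 / 8 ≤ c) :
    oddEigenvalue c ≤ Real.pi ^ 2 + 2 * evenEigenvalue c := by
  have hpi := Real.pi_gt_three
  rcases le_or_gt 0 c with h | h
  · have h1 : 0 ≤ evenEigenvalue c := by
      rw [← evenEigenvalue_zero]; exact monotone_evenEigenvalue h
    have h2 := (g₂Inv_spec (c := c) (by linarith)).1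
    rw [oddEigenvalue_of_gt (by linarith)]
    nlinarith [h2.1, h2.2]
  · have h1 := monotone_oddEigenvalue h.le
    rw [oddEigenvalue_zero] at h1
    have h2 := two_mul_self_sub_evenEigenvalue_lt h hc
    nlinarith


/-! ### Smooth functions in `H¹` of a rectangle -/

/-- The space of smooth functions on the plane. -/
def smoothFun : Submodule ℝ (ℝ × ℝ → ℝ) where
  carrier := {φ | ContDiff ℝ ∞ φ}
  zero_mem' := show ContDiff ℝ ∞ (fun _ : ℝ × ℝ => (0 : ℝ)) from contDiff_const
  add_mem' := fun {a b} (h : ContDiff ℝ ∞ a) (h' : ContDiff ℝ ∞ b) => h.add h'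
  smul_mem' := fun c a (h : ContDiff ℝ ∞ a) => h.const_smul c

namespace smoothFun

theorem contDiff (φ : smoothFun) : ContDiff ℝ ∞ (φ : ℝ × ℝ → ℝ) := φ.2

theorem continuous (φ : smoothFun) : Continuous (φ : ℝ × ℝ → ℝ) := (smoothFun.contDiff φ).continuous

theorem differentiable (φ : smoothFun) : Differentiable ℝ (φ : ℝ × ℝ → ℝ) :=
  (smoothFun.contDiff φ).differentiable (by simp)

/-- The derivative of a smooth function in the direction `v`. -/
noncomputable def pderiv (v : ℝ × ℝ) : smoothFun →ₗ[ℝ] smoothFun where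
  toFun φ := ⟨fun z => fderiv ℝ (φ : ℝ × ℝ → ℝ) z v,
    ((smoothFun.contDiff φ).fderiv_right (m := ∞) (by simp)).clm_apply contDiff_const⟩
  map_add' φ ψ := by
    ext z
    simp [fderiv_add (smoothFun.differentiable φ z) (smoothFun.differentiable ψ z)]
  map_smul' c φ := by
    ext z
    simp [fderiv_const_smul (smoothFun.differentiable φ z)]

theorem pderiv_apply (v : ℝ × ℝ) (φ : smoothFun) (z : ℝ × ℝ) :
    (pderiv v φ : ℝ × ℝ → ℝ) z = fderiv ℝ (φ : ℝ × ℝ → ℝ) z v := rfl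

end smoothFun

namespace Rect

variable (R : Rect)

/-- The closed rectangle. -/
def box : Set (ℝ × ℝ) := Icc R.x₀ R.x₁ ×ˢ Icc R.y₀ R.y₁

theorem isCompact_box : IsCompact R.box := isCompact_Icc.prod isCompact_Icc

theorem isOpen_carrier : IsOpen R.carrier := isOpen_Ioo.prod isOpen_Ioo

theorem measurableSet_carrier : MeasurableSet R.carrier := R.isOpen_carrier.measurableSet

theorem carrier_subset_box : R.carrier ⊆ R.box :=
  prod_mono Ioo_subset_Icc_self Ioo_subset_Icc_self

instance : IsFiniteMeasure R.areaMeasure := by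
  refine ⟨?_⟩
  rw [areaMeasure, Measure.restrict_apply_univ]
  exact (measure_mono R.carrier_subset_box).trans_lt R.isCompact_box.measure_lt_top

instance : IsFiniteMeasure R.boundaryMeasure := by
  unfold boundaryMeasure
  infer_instance

theorem ae_mem_box_area : ∀ᵐ z ∂(R.areaMeasure), z ∈ R.box := by
  filter_upwards [ae_restrict_mem R.measurableSet_carrier] with z hz using R.carrier_subset_box hz

theorem ae_mem_box_boundary : ∀ᵐ z ∂(R.boundaryMeasure), z ∈ R.box := by
  have hb : MeasurableSet {z | z ∈ R.box} := R.isCompact_box.measurableSet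
  have m1 : ∀ y : ℝ, Measurable fun x : ℝ => (x, y) := fun y => by fun_prop
  have m2 : ∀ x : ℝ, Measurable fun y : ℝ => (x, y) := fun y => by fun_prop
  unfold boundaryMeasure
  simp only [ae_add_measure_iff]
  refine ⟨⟨⟨?_, ?_⟩, ?_⟩, ?_⟩
  · rw [ae_map_iff (m1 _).aemeasurable hb]
    filter_upwards [ae_restrict_mem measurableSet_Ioo] with x hx using
      ⟨Ioo_subset_Icc_self hx, left_mem_Icc.2 R.hy.le⟩
  · rw [ae_map_iff (m1 _).aemeasurable hb]
    filter_upwards [ae_restrict_mem measurableSet_Ioo] with x hx using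
      ⟨Ioo_subset_Icc_self hx, right_mem_Icc.2 R.hy.le⟩
  · rw [ae_map_iff (m2 _).aemeasurable hb]
    filter_upwards [ae_restrict_mem measurableSet_Ioo] with x hx using
      ⟨left_mem_Icc.2 R.hx.le, Ioo_subset_Icc_self hx⟩
  · rw [ae_map_iff (m2 _).aemeasurable hb]
    filter_upwards [ae_restrict_mem measurableSet_Ioo] with x hx using
      ⟨right_mem_Icc.2 R.hx.le, Ioo_subset_Icc_self hx⟩

theorem memLp_of_ae_mem_box {μ : Measure (ℝ × ℝ)} [IsFiniteMeasure μ] (hμ : ∀ᵐ z ∂μ, z ∈ R.box)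
    {ψ : ℝ × ℝ → ℝ} (hψ : Continuous ψ) (p : ENNReal) : MemLp ψ p μ := by
  obtain ⟨C, hC⟩ := R.isCompact_box.exists_bound_of_continuousOn hψ.continuousOn
  exact MemLp.of_bound hψ.aestronglyMeasurable C (hμ.mono fun z hz => hC z hz)

theorem memLp_area {ψ : ℝ × ℝ → ℝ} (hψ : Continuous ψ) (p : ENNReal) : MemLp ψ p R.areaMeasure :=
  R.memLp_of_ae_mem_box R.ae_mem_box_area hψ p

theorem memLp_boundary {ψ : ℝ × ℝ → ℝ} (hψ : Continuous ψ) (p : ENNReal) :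
    MemLp ψ p R.boundaryMeasure :=
  R.memLp_of_ae_mem_box R.ae_mem_box_boundary hψ p

theorem integrable_area {ψ : ℝ × ℝ → ℝ} (hψ : Continuous ψ) : Integrable ψ R.areaMeasure :=
  memLp_one_iff_integrable.1 (R.memLp_area hψ 1)

theorem integrable_boundary {ψ : ℝ × ℝ → ℝ} (hψ : Continuous ψ) :
    Integrable ψ R.boundaryMeasure :=
  memLp_one_iff_integrable.1 (R.memLp_boundary hψ 1)

theorem integral_area_eq_integral {f : ℝ × ℝ → ℝ} (hf : ∀ z, z ∉ R.carrier → f z = 0) :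
    ∫ z, f z ∂(R.areaMeasure) = ∫ z, f z :=
  setIntegral_eq_integral_of_forall_compl_eq_zero hf

/-- The class in `L²(R)` of a smooth function. -/
noncomputable def toL2 : smoothFun →ₗ[ℝ] R.L2 where
  toFun φ := (R.memLp_area (smoothFun.continuous φ) 2).toLp φ
  map_add' _ _ := rfl
  map_smul' _ _ := rfl

/-- The class in `L²(∂R)` of a smooth function. -/
noncomputable def toBoundary : smoothFun →ₗ[ℝ] Lp ℝ 2 R.boundaryMeasure where
  toFun φ := (R.memLp_boundary (smoothFun.continuous φ) 2).toLp φ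
  map_add' _ _ := rfl
  map_smul' _ _ := rfl

theorem coeFn_toL2 (φ : smoothFun) : R.toL2 φ =ᵐ[R.areaMeasure] φ :=
  (R.memLp_area (smoothFun.continuous φ) 2).coeFn_toLp

theorem coeFn_toBoundary (φ : smoothFun) : R.toBoundary φ =ᵐ[R.boundaryMeasure] φ :=
  (R.memLp_boundary (smoothFun.continuous φ) 2).coeFn_toLp

theorem inner_toL2 (u : R.L2) (φ : smoothFun) :
    inner ℝ u (R.toL2 φ) = ∫ z, u z * φ.1 z ∂(R.areaMeasure) := by
  rw [L2.inner_def]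
  refine integral_congr_ae ?_
  filter_upwards [R.coeFn_toL2 φ] with z hz
  rw [hz]; simp [mul_comm]

theorem inner_toL2_toL2 (φ ψ : smoothFun) :
    inner ℝ (R.toL2 φ) (R.toL2 ψ) = ∫ z, φ.1 z * ψ.1 z ∂(R.areaMeasure) := by
  rw [inner_toL2]
  refine integral_congr_ae ?_
  filter_upwards [R.coeFn_toL2 φ] with z hz
  rw [hz]

theorem norm_sq_Lp {α : Type*} [MeasurableSpace α] {μ : Measure α} (u : Lp ℝ 2 μ) :
    ‖u‖ ^ 2 = ∫ z, u z ^ 2 ∂μ := by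
  rw [← real_inner_self_eq_norm_sq, L2.inner_def]
  refine integral_congr_ae (Eventually.of_forall fun z => ?_)
  simp [pow_two]

theorem norm_sq_toL2 (φ : smoothFun) : ‖R.toL2 φ‖ ^ 2 = ∫ z, φ.1 z ^ 2 ∂(R.areaMeasure) := by
  rw [norm_sq_Lp]
  refine integral_congr_ae ?_
  filter_upwards [R.coeFn_toL2 φ] with z hz
  rw [hz]

theorem norm_sq_toBoundary (φ : smoothFun) :
    ‖R.toBoundary φ‖ ^ 2 = ∫ z, φ.1 z ^ 2 ∂(R.boundaryMeasure) := by
  rw [norm_sq_Lp]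
  refine integral_congr_ae ?_
  filter_upwards [R.coeFn_toBoundary φ] with z hz
  rw [hz]

/-- In inner product form, uniqueness of weak derivatives and closedness of the weak gradient become
Hilbert space statements. -/
theorem isWeakDeriv_iff {v : ℝ × ℝ} {u p : R.L2} : R.IsWeakDeriv v u p ↔
    ∀ φ : smoothFun, HasCompactSupport φ.1 → tsupport φ.1 ⊆ R.carrier →
      inner ℝ u (R.toL2 (smoothFun.pderiv v φ)) = -inner ℝ p (R.toL2 φ) := by
  constructor
  · intro h φ h1 h2
    rw [inner_toL2, inner_toL2]
    exact h φ.1 φ.2 h1 h2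
  · intro h φ h0 h1 h2
    have := h ⟨φ, h0⟩ h1 h2
    rwa [inner_toL2, inner_toL2] at this

/-- The fundamental lemma of the calculus of variations. -/
theorem eq_zero_of_inner_test {u : R.L2}
    (h : ∀ φ : smoothFun, HasCompactSupport φ.1 → tsupport φ.1 ⊆ R.carrier →
      inner ℝ u (R.toL2 φ) = 0) : u = 0 := by
  have hu : IntegrableOn u R.carrier := (Lp.memLp u).integrable (by norm_num)
  have := R.isOpen_carrier.ae_eq_zero_of_integral_contDiff_smul_eq_zero (μ := volume)
    hu.locallyIntegrableOn (fun g hg h1 h2 => by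
      have h3 := h ⟨g, hg⟩ h1 h2
      rw [inner_toL2, R.integral_area_eq_integral] at h3
      · simpa only [smul_eq_mul, mul_comm] using h3
      · intro z hz
        have : g z = 0 := image_eq_zero_of_notMem_tsupport fun h => hz (h2 h)
        simp [this])
  rw [Lp.eq_zero_iff_ae_eq_zero]
  exact (ae_restrict_iff' R.measurableSet_carrier).2 this

theorem IsWeakDeriv.unique {v : ℝ × ℝ} {u p p' : R.L2} (h : R.IsWeakDeriv v u p)
    (h' : R.IsWeakDeriv v u p') : p = p' := by
  rw [isWeakDeriv_iff] at h h'
  refine sub_eq_zero.1 (R.eq_zero_of_inner_test fun φ h1 h2 => ?_)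
  rw [inner_sub_left]
  linarith [h φ h1 h2, h' φ h1 h2]

theorem weakDeriv_eq {v : ℝ × ℝ} {u p : R.L2} (h : R.IsWeakDeriv v u p) :
    R.weakDeriv v u = p := by
  have h' : ∃ p, R.IsWeakDeriv v u p := ⟨p, h⟩
  rw [weakDeriv, dif_pos h']
  exact IsWeakDeriv.unique R h'.choose_spec h

theorem isWeakDeriv_weakDeriv {v : ℝ × ℝ} {u : R.L2} (h : ∃ p, R.IsWeakDeriv v u p) :
    R.IsWeakDeriv v u (R.weakDeriv v u) := by
  rw [weakDeriv, dif_pos h]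
  exact h.choose_spec

theorem isWeakDeriv_toL2 (v : ℝ × ℝ) (φ : smoothFun) :
    R.IsWeakDeriv v (R.toL2 φ) (R.toL2 (smoothFun.pderiv v φ)) := by
  rw [isWeakDeriv_iff]
  intro ψ h1 h2
  have hz : ∀ z, z ∉ R.carrier → ψ.1 z = 0 := fun z hz =>
    image_eq_zero_of_notMem_tsupport fun h => hz (h2 h)
  have hz' : ∀ z, z ∉ R.carrier → (smoothFun.pderiv v ψ).1 z = 0 := fun z hz => by
    have : fderiv ℝ ψ.1 z = 0 := image_eq_zero_of_notMem_tsupport fun h =>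
      hz (h2 (tsupport_fderiv_subset ℝ h))
    rw [smoothFun.pderiv_apply, this]; rfl
  have hc' : HasCompactSupport (smoothFun.pderiv v ψ).1 := h1.fderiv_apply (𝕜 := ℝ) v
  have cφ := smoothFun.continuous φ
  have cψ := smoothFun.continuous ψ
  have cφ' := smoothFun.continuous (smoothFun.pderiv v φ)
  have cψ' := smoothFun.continuous (smoothFun.pderiv v ψ)
  rw [inner_toL2_toL2, inner_toL2_toL2,
    R.integral_area_eq_integral (fun z h => by rw [hz' z h, mul_zero]),
    R.integral_area_eq_integral (fun z h => by rw [hz z h, mul_zero])]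
  exact integral_mul_fderiv_eq_neg_fderiv_mul_of_integrable
    ((cφ'.mul cψ).integrable_of_hasCompactSupport h1.mul_left)
    ((cφ.mul cψ').integrable_of_hasCompactSupport hc'.mul_left)
    ((cφ.mul cψ).integrable_of_hasCompactSupport h1.mul_left)
    (fun z _ => smoothFun.differentiable φ z) (fun z _ => smoothFun.differentiable ψ z)

theorem toL2_mem_H1 (φ : smoothFun) : R.toL2 φ ∈ R.H1 :=
  ⟨⟨_, R.isWeakDeriv_toL2 _ φ⟩, ⟨_, R.isWeakDeriv_toL2 _ φ⟩⟩

theorem weakDeriv_toL2 (v : ℝ × ℝ) (φ : smoothFun) :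
    R.weakDeriv v (R.toL2 φ) = R.toL2 (smoothFun.pderiv v φ) :=
  R.weakDeriv_eq (R.isWeakDeriv_toL2 v φ)

theorem tendsto_toL2_iff {φ : ℕ → smoothFun} {u : R.L2} :
    Tendsto (fun n => R.toL2 (φ n)) atTop (𝓝 u) ↔
      Tendsto (fun n => eLpNorm (fun z => (φ n).1 z - u z) 2 R.areaMeasure) atTop (𝓝 0) := by
  have := Lp.tendsto_Lp_iff_tendsto_eLpNorm'' (fi := atTop) (fun n => (φ n).1)
    (fun n => R.memLp_area (smoothFun.continuous (φ n)) 2) u (Lp.memLp u)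
  rw [Lp.toLp_coeFn] at this
  exact this

theorem tendsto_toBoundary_iff {φ : ℕ → smoothFun} {u : Lp ℝ 2 R.boundaryMeasure} :
    Tendsto (fun n => R.toBoundary (φ n)) atTop (𝓝 u) ↔
      Tendsto (fun n => eLpNorm (fun z => (φ n).1 z - u z) 2 R.boundaryMeasure) atTop (𝓝 0) := by
  have := Lp.tendsto_Lp_iff_tendsto_eLpNorm'' (fi := atTop) (fun n => (φ n).1)
    (fun n => R.memLp_boundary (smoothFun.continuous (φ n)) 2) u (Lp.memLp u)
  rw [Lp.toLp_coeFn] at this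
  exact this

theorem isTrace_iff {u : R.L2} {g : Lp ℝ 2 R.boundaryMeasure} : R.IsTrace u g ↔
    ∃ φ : ℕ → smoothFun, Tendsto (fun n => R.toL2 (φ n)) atTop (𝓝 u) ∧
      Tendsto (fun n => R.toL2 (smoothFun.pderiv (1, 0) (φ n))) atTop
        (𝓝 (R.weakDeriv (1, 0) u)) ∧
      Tendsto (fun n => R.toL2 (smoothFun.pderiv (0, 1) (φ n))) atTop
        (𝓝 (R.weakDeriv (0, 1) u)) ∧
      Tendsto (fun n => R.toBoundary (φ n)) atTop (𝓝 g) := by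
  simp only [tendsto_toL2_iff, tendsto_toBoundary_iff]
  constructor
  · rintro ⟨φ, h0, h⟩
    exact ⟨fun n => ⟨φ n, h0 n⟩, h⟩
  · rintro ⟨φ, h⟩
    exact ⟨fun n => (φ n).1, fun n => (φ n).2, h⟩

/-! ### Integrals over the rectangle and its boundary as iterated integrals -/

theorem integral_area_eq {ψ : ℝ × ℝ → ℝ} (hψ : Continuous ψ) :
    ∫ z, ψ z ∂(R.areaMeasure) = ∫ x in R.x₀..R.x₁, ∫ y in R.y₀..R.y₁, ψ (x, y) := by
  have hi := R.integrable_area hψ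
  rw [areaMeasure, carrier, Measure.volume_eq_prod, ← Measure.prod_restrict] at hi ⊢
  rw [integral_prod _ hi, intervalIntegral.integral_of_le R.hx.le,
    integral_Ioc_eq_integral_Ioo]
  refine integral_congr_ae (Eventually.of_forall fun x => ?_)
  simp only
  rw [intervalIntegral.integral_of_le R.hy.le, integral_Ioc_eq_integral_Ioo]

theorem integral_area_eq' {ψ : ℝ × ℝ → ℝ} (hψ : Continuous ψ) :
    ∫ z, ψ z ∂(R.areaMeasure) = ∫ y in R.y₀..R.y₁, ∫ x in R.x₀..R.x₁, ψ (x, y) := by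
  have hi := R.integrable_area hψ
  rw [areaMeasure, carrier, Measure.volume_eq_prod, ← Measure.prod_restrict] at hi ⊢
  rw [integral_prod_symm _ hi, intervalIntegral.integral_of_le R.hy.le,
    integral_Ioc_eq_integral_Ioo]
  refine integral_congr_ae (Eventually.of_forall fun x => ?_)
  simp only
  rw [intervalIntegral.integral_of_le R.hx.le, integral_Ioc_eq_integral_Ioo]

theorem integral_boundary_eq {ψ : ℝ × ℝ → ℝ} (hψ : Continuous ψ) :
    ∫ z, ψ z ∂(R.boundaryMeasure) =
      (∫ x in R.x₀..R.x₁, (ψ (x, R.y₀) + ψ (x, R.y₁))) +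
        ∫ y in R.y₀..R.y₁, (ψ (R.x₀, y) + ψ (R.x₁, y)) := by
  have hi := R.integrable_boundary hψ
  have m1 : ∀ y : ℝ, Continuous fun x : ℝ => (x, y) := fun y => by fun_prop
  have m2 : ∀ x : ℝ, Continuous fun y : ℝ => (x, y) := fun y => by fun_prop
  unfold boundaryMeasure at hi ⊢
  have i1 := hi.left_of_add_measure
  have i2 := i1.left_of_add_measure
  rw [integral_add_measure i1 hi.right_of_add_measure,
    integral_add_measure i2 i1.right_of_add_measure,
    integral_add_measure i2.left_of_add_measure i2.right_of_add_measure,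
    integral_map (m1 _).aemeasurable hψ.aestronglyMeasurable,
    integral_map (m1 _).aemeasurable hψ.aestronglyMeasurable,
    integral_map (m2 _).aemeasurable hψ.aestronglyMeasurable,
    integral_map (m2 _).aemeasurable hψ.aestronglyMeasurable,
    integral_add_of_continuous (f := fun x => ψ (x, R.y₀)) (g := fun x => ψ (x, R.y₁))
      (hψ.comp (m1 _)) (hψ.comp (m1 _)),
    integral_add_of_continuous (f := fun y => ψ (R.x₀, y)) (g := fun y => ψ (R.x₁, y))
      (hψ.comp (m2 _)) (hψ.comp (m2 _)),
    intervalIntegral.integral_of_le R.hx.le, intervalIntegral.integral_of_le R.hx.le,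
    intervalIntegral.integral_of_le R.hy.le, intervalIntegral.integral_of_le R.hy.le]
  simp only [integral_Ioc_eq_integral_Ioo]
  ring

end Rect


/-! ### Integration by parts for weak derivatives, up to the boundary -/

/-- At `t = n d - 1`, with `d` the distance to an endpoint, `t + 1 = n d`. The bound thus says that
`n d` times the slope of the transition is bounded uniformly in `n`. -/
theorem exists_bound_deriv_smoothTransition :
    ∃ D, 0 ≤ D ∧ ∀ t, |deriv Real.smoothTransition t| * |t + 1| ≤ D := by
  have hc : Continuous (deriv Real.smoothTransition) :=
    (Real.smoothTransition.contDiff (n := ⊤)).continuous_deriv (by simp)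
  obtain ⟨D, hD⟩ := (isCompact_Icc (a := (0 : ℝ)) (b := 1)).exists_bound_of_continuousOn
    (f := fun t => deriv Real.smoothTransition t * (t + 1)) (by fun_prop)
  refine ⟨max D 0, le_max_right _ _, fun t => ?_⟩
  rw [← abs_mul]
  by_cases ht : t ∈ Icc (0 : ℝ) 1
  · exact (hD t ht).trans (le_max_left _ _)
  · have : deriv Real.smoothTransition t = 0 := by
      rw [mem_Icc, not_and_or, not_le, not_le] at ht
      rcases ht with ht | ht
      · have : Real.smoothTransition =ᶠ[𝓝 t] fun _ => 0 := by
          filter_upwards [gt_mem_nhds ht] with s hs using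
            Real.smoothTransition.zero_of_nonpos hs.le
        rw [this.deriv_eq, deriv_const]
      · have : Real.smoothTransition =ᶠ[𝓝 t] fun _ => 1 := by
          filter_upwards [lt_mem_nhds ht] with s hs using
            Real.smoothTransition.one_of_one_le hs.le
        rw [this.deriv_eq, deriv_const]
    rw [this, zero_mul, abs_zero]
    exact le_max_right _ _

/-- Smooth cutoff functions of the interval `(a, b)`. -/
noncomputable def cutoff (a b : ℝ) (n : ℕ) (x : ℝ) : ℝ :=
  Real.smoothTransition (n * (x - a) - 1) * Real.smoothTransition (n * (b - x) - 1)

theorem contDiff_cutoff (a b : ℝ) (n : ℕ) : ContDiff ℝ ∞ (cutoff a b n) := by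
  have h : ContDiff ℝ ∞ Real.smoothTransition := Real.smoothTransition.contDiff
  exact (h.comp (by fun_prop)).mul (h.comp (by fun_prop))

theorem cutoff_nonneg (a b : ℝ) (n : ℕ) (x : ℝ) : 0 ≤ cutoff a b n x :=
  mul_nonneg (Real.smoothTransition.nonneg _) (Real.smoothTransition.nonneg _)

theorem cutoff_le_one (a b : ℝ) (n : ℕ) (x : ℝ) : cutoff a b n x ≤ 1 :=
  mul_le_one₀ (Real.smoothTransition.le_one _) (Real.smoothTransition.nonneg _)
    (Real.smoothTransition.le_one _)

/-- The shift by `-1` keeps the support at distance at least `1 / n` from both endpoints; for `n =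
0` the cutoff vanishes identically. -/
theorem tsupport_cutoff_subset (a b : ℝ) (n : ℕ) : tsupport (cutoff a b n) ⊆ Ioo a b := by
  have h1 : tsupport (cutoff a b n) ⊆ {x | 0 ≤ n * (x - a) - 1 ∧ 0 ≤ n * (b - x) - 1} := by
    apply closure_minimal
    · intro x hx
      constructor
      · by_contra! h
        exact hx (by rw [cutoff, Real.smoothTransition.zero_of_nonpos h.le, zero_mul])
      · by_contra! h
        exact hx (by rw [cutoff, Real.smoothTransition.zero_of_nonpos h.le, mul_zero])
    · exact (isClosed_le continuous_const
          (show Continuous fun x : ℝ => (n : ℝ) * (x - a) - 1 by fun_prop)).inter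
        (isClosed_le continuous_const
          (show Continuous fun x : ℝ => (n : ℝ) * (b - x) - 1 by fun_prop))
  intro x hx
  obtain ⟨h2, h3⟩ := h1 hx
  have hn : (0 : ℝ) ≤ n := Nat.cast_nonneg n
  constructor
  · by_contra! h; nlinarith
  · by_contra! h; nlinarith

theorem eventually_cutoff_eq_one {a b x : ℝ} (hx : x ∈ Ioo a b) :
    ∀ᶠ n in atTop, cutoff a b n =ᶠ[𝓝 x] fun _ => 1 := by
  have h1 : 0 < x - a := by linarith [hx.1]
  have h2 : 0 < b - x := by linarith [hx.2]
  filter_upwards [tendsto_natCast_atTop_atTop.eventually_gt_atTop (2 / (x - a)),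
    tendsto_natCast_atTop_atTop.eventually_gt_atTop (2 / (b - x))] with n hn1 hn2
  rw [div_lt_iff₀ h1] at hn1
  rw [div_lt_iff₀ h2] at hn2
  have c1 : ∀ᶠ y in 𝓝 x, 2 < (n : ℝ) * (y - a) :=
    Continuous.continuousAt (f := fun y : ℝ => (n : ℝ) * (y - a)) (by fun_prop)
      |>.eventually (lt_mem_nhds hn1)
  have c2 : ∀ᶠ y in 𝓝 x, 2 < (n : ℝ) * (b - y) :=
    Continuous.continuousAt (f := fun y : ℝ => (n : ℝ) * (b - y)) (by fun_prop)
      |>.eventually (lt_mem_nhds hn2)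
  filter_upwards [c1, c2] with y h3 h4
  rw [cutoff, Real.smoothTransition.one_of_one_le (by linarith),
    Real.smoothTransition.one_of_one_le (by linarith), one_mul]

theorem deriv_cutoff (a b : ℝ) (n : ℕ) (x : ℝ) : deriv (cutoff a b n) x =
    n * deriv Real.smoothTransition (n * (x - a) - 1) *
      Real.smoothTransition (n * (b - x) - 1) -
    n * deriv Real.smoothTransition (n * (b - x) - 1) *
      Real.smoothTransition (n * (x - a) - 1) := by
  have h : ∀ t, HasDerivAt Real.smoothTransition (deriv Real.smoothTransition t) t := fun t =>
    ((Real.smoothTransition.contDiff (n := ⊤)).differentiable (by simp) t).hasDerivAt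
  have d1 : HasDerivAt (fun x : ℝ => n * (x - a) - 1) (n : ℝ) x := by
    simpa using (((hasDerivAt_id x).sub_const a).const_mul (n : ℝ)).sub_const 1
  have d2 : HasDerivAt (fun x : ℝ => n * (b - x) - 1) (-n : ℝ) x := by
    simpa using (((hasDerivAt_id x).const_sub b).const_mul (n : ℝ)).sub_const 1
  have := ((h _).comp x d1).mul ((h _).comp x d2)
  refine this.deriv.trans ?_
  simp only [Function.comp_apply]
  ring

/-- The slope of the cutoff grows like `n` near an endpoint, and linear vanishing of `f` there
compensates for it. -/
theorem exists_bound_mul_deriv_cutoff {a b L : ℝ} {f : ℝ → ℝ}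
    (h1 : ∀ x ∈ Ioo a b, |f x| ≤ L * (x - a)) (h2 : ∀ x ∈ Ioo a b, |f x| ≤ L * (b - x)) :
    ∃ C, ∀ n : ℕ, ∀ x ∈ Ioo a b, |f x * deriv (cutoff a b n) x| ≤ C := by
  obtain ⟨D, hD0, hD⟩ := exists_bound_deriv_smoothTransition
  refine ⟨|L| * D + |L| * D, fun n x hx => ?_⟩
  have hn : (0 : ℝ) ≤ n := Nat.cast_nonneg n
  have key : ∀ d : ℝ, 0 < d → |f x| ≤ L * d → ∀ r : ℝ, 0 ≤ r → r ≤ 1 →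
      |f x * (n * deriv Real.smoothTransition (n * d - 1) * r)| ≤ |L| * D := by
    intro d hd hf r hr0 hr1
    have e := hD (n * d - 1)
    rw [sub_add_cancel, abs_of_nonneg (mul_nonneg hn hd.le)] at e
    rw [abs_mul, abs_mul, abs_mul, abs_of_nonneg hn, abs_of_nonneg hr0]
    have hf' : |f x| ≤ |L| * d := hf.trans (mul_le_mul_of_nonneg_right (le_abs_self L) hd.le)
    calc |f x| * (n * |deriv Real.smoothTransition (n * d - 1)| * r)
        ≤ (|L| * d) * (n * |deriv Real.smoothTransition (n * d - 1)| * 1) := by gcongr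
      _ = |L| * (|deriv Real.smoothTransition (n * d - 1)| * (n * d)) := by ring
      _ ≤ |L| * D := by gcongr
  rw [deriv_cutoff, mul_sub]
  refine (abs_sub _ _).trans (add_le_add ?_ ?_)
  · exact key _ (by linarith [hx.1]) (h1 x hx) _ (Real.smoothTransition.nonneg _)
      (Real.smoothTransition.le_one _)
  · exact key _ (by linarith [hx.2]) (h2 x hx) _ (Real.smoothTransition.nonneg _)
      (Real.smoothTransition.le_one _)

theorem exists_lipschitz_bound {a b : ℝ} (hab : a < b) {f : ℝ → ℝ} (hf : ContDiff ℝ ∞ f)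
    (ha : f a = 0) (hb : f b = 0) :
    ∃ L, (∀ x ∈ Ioo a b, |f x| ≤ L * (x - a)) ∧ ∀ x ∈ Ioo a b, |f x| ≤ L * (b - x) := by
  obtain ⟨L, hL⟩ := (isCompact_Icc (a := a) (b := b)).exists_bound_of_continuousOn
    hf.contDiff_deriv.continuous.continuousOn
  have key := fun {x y : ℝ} (hx : x ∈ Icc a b) (hy : y ∈ Icc a b) =>
    (convex_Icc a b).norm_image_sub_le_of_norm_deriv_le
      (fun z _ => (hf.hasDerivAt_deriv z).differentiableAt) hL hx hy
  refine ⟨L, fun x hx => ?_, fun x hx => ?_⟩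
  · have := key (left_mem_Icc.2 hab.le) (Ioo_subset_Icc_self hx)
    rwa [ha, sub_zero, Real.norm_eq_abs, Real.norm_eq_abs,
      abs_of_pos (show 0 < x - a by linarith [hx.1])] at this
  · have := key (right_mem_Icc.2 hab.le) (Ioo_subset_Icc_self hx)
    rwa [hb, sub_zero, Real.norm_eq_abs, Real.norm_eq_abs, abs_sub_comm,
      abs_of_pos (show 0 < b - x by linarith [hx.2])] at this

namespace smoothFun

/-- The product `f(x) g(y)`. -/
def tensor {f g : ℝ → ℝ} (hf : ContDiff ℝ ∞ f) (hg : ContDiff ℝ ∞ g) : smoothFun :=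
  ⟨fun z => f z.1 * g z.2, (hf.comp contDiff_fst).mul (hg.comp contDiff_snd)⟩

theorem tensor_apply {f g : ℝ → ℝ} (hf : ContDiff ℝ ∞ f) (hg : ContDiff ℝ ∞ g) (z : ℝ × ℝ) :
    (tensor hf hg).1 z = f z.1 * g z.2 := rfl

theorem hasDerivAt_fst (φ : smoothFun) (x y : ℝ) :
    HasDerivAt (fun x => φ.1 (x, y)) ((pderiv (1, 0) φ).1 (x, y)) x :=
  (smoothFun.differentiable φ (x, y)).hasFDerivAt.comp_hasDerivAt x
    ((hasDerivAt_id x).prodMk (hasDerivAt_const x y))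

theorem hasDerivAt_snd (φ : smoothFun) (x y : ℝ) :
    HasDerivAt (fun y => φ.1 (x, y)) ((pderiv (0, 1) φ).1 (x, y)) y :=
  (smoothFun.differentiable φ (x, y)).hasFDerivAt.comp_hasDerivAt y
    ((hasDerivAt_const y x).prodMk (hasDerivAt_id y))

theorem pderiv_fst_tensor {f g : ℝ → ℝ} (hf : ContDiff ℝ ∞ f) (hg : ContDiff ℝ ∞ g) :
    pderiv (1, 0) (tensor hf hg) = tensor hf.contDiff_deriv hg := by
  apply Subtype.ext
  funext ⟨x, y⟩
  exact (hasDerivAt_fst (tensor hf hg) x y).unique ((hf.hasDerivAt_deriv x).mul_const (g y))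

theorem pderiv_snd_tensor {f g : ℝ → ℝ} (hf : ContDiff ℝ ∞ f) (hg : ContDiff ℝ ∞ g) :
    pderiv (0, 1) (tensor hf hg) = tensor hf hg.contDiff_deriv := by
  apply Subtype.ext
  funext ⟨x, y⟩
  exact (hasDerivAt_snd (tensor hf hg) x y).unique ((hg.hasDerivAt_deriv y).const_mul (f x))

end smoothFun

namespace Rect

variable (R : Rect)

open smoothFun

/-- Smooth cutoff functions of a rectangle. -/
noncomputable def cutoff (n : ℕ) : smoothFun :=
  tensor (contDiff_cutoff R.x₀ R.x₁ n) (contDiff_cutoff R.y₀ R.y₁ n)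

theorem tsupport_cutoff_subset (n : ℕ) : tsupport (R.cutoff n).1 ⊆
    tsupport (_root_.cutoff R.x₀ R.x₁ n) ×ˢ tsupport (_root_.cutoff R.y₀ R.y₁ n) := by
  apply closure_minimal
  · intro z hz
    exact ⟨subset_tsupport _ (left_ne_zero_of_mul hz), subset_tsupport _ (right_ne_zero_of_mul hz)⟩
  · exact (isClosed_tsupport _).prod (isClosed_tsupport _)

theorem abs_cutoff_le_one (n : ℕ) (z : ℝ × ℝ) : |(R.cutoff n).1 z| ≤ 1 := by
  rw [cutoff, tensor_apply, abs_of_nonneg (mul_nonneg (cutoff_nonneg _ _ _ _)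
    (cutoff_nonneg _ _ _ _))]
  exact mul_le_one₀ (cutoff_le_one _ _ _ _) (cutoff_nonneg _ _ _ _) (cutoff_le_one _ _ _ _)

theorem eventually_cutoff_eq_one {z : ℝ × ℝ} (hz : z ∈ R.carrier) :
    ∀ᶠ n in atTop, (R.cutoff n).1 =ᶠ[𝓝 z] fun _ => 1 := by
  filter_upwards [_root_.eventually_cutoff_eq_one hz.1, _root_.eventually_cutoff_eq_one hz.2]
    with n h1 h2
  filter_upwards [continuous_fst.continuousAt.eventually h1,
    continuous_snd.continuousAt.eventually h2] with w h3 h4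
  rw [cutoff, tensor_apply, h3, h4, one_mul]

/-- Test with `ψ` times the cutoff and let `n → ∞`. The extra term `ψ ∂(cutoff)` is bounded by
assumption and eventually zero at each interior point, so dominated convergence removes it. -/
theorem IsWeakDeriv.inner_eq_of_bound {v : ℝ × ℝ} {u p : R.L2} (h : R.IsWeakDeriv v u p)
    (ψ : smoothFun)
    (hb : ∃ C, ∀ n, ∀ z ∈ R.carrier, |ψ.1 z * (pderiv v (R.cutoff n)).1 z| ≤ C) :
    inner ℝ u (R.toL2 (pderiv v ψ)) = -inner ℝ p (R.toL2 ψ) := by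
  obtain ⟨C, hC⟩ := hb
  obtain ⟨C₁, hC₁⟩ := R.isCompact_box.exists_bound_of_continuousOn
    (smoothFun.continuous (pderiv v ψ)).continuousOn
  obtain ⟨C₂, hC₂⟩ := R.isCompact_box.exists_bound_of_continuousOn
    (smoothFun.continuous ψ).continuousOn
  have hu : Integrable u R.areaMeasure := (Lp.memLp u).integrable (by norm_num)
  have hp : Integrable p R.areaMeasure := (Lp.memLp p).integrable (by norm_num)
  have hmem : ∀ᵐ z ∂(R.areaMeasure), z ∈ R.carrier := ae_restrict_mem R.measurableSet_carrier
  set χ : ℕ → smoothFun := fun n => ⟨fun z => ψ.1 z * (R.cutoff n).1 z,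
    (smoothFun.contDiff ψ).mul (smoothFun.contDiff (R.cutoff n))⟩ with hχ
  have dχ : ∀ n z, (pderiv v (χ n)).1 z =
      ψ.1 z * (pderiv v (R.cutoff n)).1 z + (R.cutoff n).1 z * (pderiv v ψ).1 z := fun n z => by
    simp only [hχ, pderiv_apply]
    rw [fderiv_fun_mul (smoothFun.differentiable ψ z) (smoothFun.differentiable (R.cutoff n) z)]
    simp
  have supp : ∀ n, tsupport (χ n).1 ⊆ tsupport (R.cutoff n).1 := fun n =>
    tsupport_mul_subset_right
  have htest : ∀ n, inner ℝ u (R.toL2 (pderiv v (χ n))) = -inner ℝ p (R.toL2 (χ n)) := fun n => by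
    refine (R.isWeakDeriv_iff.1 h) (χ n) ?_ ?_
    · refine IsCompact.of_isClosed_subset R.isCompact_box (isClosed_tsupport _)
        (((supp n).trans (R.tsupport_cutoff_subset n)).trans (prod_mono ?_ ?_))
      · exact (_root_.tsupport_cutoff_subset _ _ _).trans Ioo_subset_Icc_self
      · exact (_root_.tsupport_cutoff_subset _ _ _).trans Ioo_subset_Icc_self
    · exact ((supp n).trans (R.tsupport_cutoff_subset n)).trans
        (prod_mono (_root_.tsupport_cutoff_subset _ _ _) (_root_.tsupport_cutoff_subset _ _ _))
  simp only [inner_toL2] at htest ⊢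
  have l1 : Tendsto (fun n => ∫ z, u z * (pderiv v (χ n)).1 z ∂(R.areaMeasure)) atTop
      (𝓝 (∫ z, u z * (pderiv v ψ).1 z ∂(R.areaMeasure))) := by
    refine tendsto_integral_of_dominated_convergence (fun z => |u z| * (C + C₁)) ?_ ?_ ?_ ?_
    · exact fun n => hu.aestronglyMeasurable.mul
        (smoothFun.continuous (pderiv v (χ n))).aestronglyMeasurable
    · exact hu.abs.mul_const _
    · intro n
      filter_upwards [hmem] with z hz
      rw [Real.norm_eq_abs, abs_mul, dχ]
      refine mul_le_mul_of_nonneg_left ((abs_add_le _ _).trans (add_le_add (hC n z hz) ?_))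
        (abs_nonneg _)
      rw [abs_mul]
      have h1 := R.abs_cutoff_le_one n z
      have h2 := hC₁ z (R.carrier_subset_box hz)
      calc _ ≤ 1 * |(pderiv v ψ).1 z| := by gcongr
        _ ≤ C₁ := by rw [one_mul]; exact h2
    · filter_upwards [hmem] with z hz
      refine tendsto_const_nhds.congr' ?_
      filter_upwards [R.eventually_cutoff_eq_one hz] with n hn
      have h1 : (pderiv v (R.cutoff n)).1 z = 0 := by
        rw [pderiv_apply, hn.fderiv_eq, fderiv_fun_const]; rfl
      rw [dχ, h1, hn.self_of_nhds]
      ring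
  have l2 : Tendsto (fun n => ∫ z, p z * (χ n).1 z ∂(R.areaMeasure)) atTop
      (𝓝 (∫ z, p z * ψ.1 z ∂(R.areaMeasure))) := by
    refine tendsto_integral_of_dominated_convergence (fun z => |p z| * C₂) ?_ ?_ ?_ ?_
    · exact fun n => hp.aestronglyMeasurable.mul (smoothFun.continuous (χ n)).aestronglyMeasurable
    · exact hp.abs.mul_const _
    · intro n
      filter_upwards [hmem] with z hz
      rw [Real.norm_eq_abs, abs_mul]
      refine mul_le_mul_of_nonneg_left ?_ (abs_nonneg _)
      simp only [hχ]
      rw [abs_mul]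
      have h1 := R.abs_cutoff_le_one n z
      have h2 := hC₂ z (R.carrier_subset_box hz)
      calc _ ≤ |ψ.1 z| * 1 := by gcongr
        _ ≤ C₂ := by rw [mul_one]; exact h2
    · filter_upwards [hmem] with z hz
      refine tendsto_const_nhds.congr' ?_
      filter_upwards [R.eventually_cutoff_eq_one hz] with n hn
      simp only [hχ]
      rw [hn.self_of_nhds, mul_one]
  simp only [htest] at l1
  exact tendsto_nhds_unique l1 l2.neg

/-- Only the cutoff in the first variable is differentiated, so vanishing is needed on the two
vertical sides alone and `g` is unrestricted. -/
theorem IsWeakDeriv.inner_tensor_fst {u p : R.L2} (h : R.IsWeakDeriv (1, 0) u p) {f g : ℝ → ℝ}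
    (hf : ContDiff ℝ ∞ f) (hg : ContDiff ℝ ∞ g) (h0 : f R.x₀ = 0) (h1 : f R.x₁ = 0) :
    inner ℝ u (R.toL2 (tensor hf.contDiff_deriv hg)) = -inner ℝ p (R.toL2 (tensor hf hg)) := by
  rw [← pderiv_fst_tensor hf hg]
  apply IsWeakDeriv.inner_eq_of_bound R h
  obtain ⟨L, hL, hL'⟩ := exists_lipschitz_bound R.hx hf h0 h1
  obtain ⟨C, hC⟩ := exists_bound_mul_deriv_cutoff hL hL'
  obtain ⟨C', hC'⟩ := (isCompact_Icc (a := R.y₀) (b := R.y₁)).exists_bound_of_continuousOn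
    hg.continuous.continuousOn
  refine ⟨C * C', fun n z hz => ?_⟩
  rw [cutoff, pderiv_fst_tensor, tensor_apply, tensor_apply,
    show f z.1 * g z.2 * (deriv (_root_.cutoff R.x₀ R.x₁ n) z.1 * _root_.cutoff R.y₀ R.y₁ n z.2) =
    (f z.1 * deriv (_root_.cutoff R.x₀ R.x₁ n) z.1) * (g z.2 * _root_.cutoff R.y₀ R.y₁ n z.2) by
      ring, abs_mul]
  have e1 := hC n z.1 hz.1
  refine mul_le_mul e1 ?_ (abs_nonneg _) ((abs_nonneg _).trans e1)
  rw [abs_mul, abs_of_nonneg (cutoff_nonneg _ _ _ _)]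
  exact (mul_le_of_le_one_right (abs_nonneg _) (cutoff_le_one _ _ _ _)).trans
    (hC' _ (Ioo_subset_Icc_self hz.2))

theorem IsWeakDeriv.inner_tensor_snd {u p : R.L2} (h : R.IsWeakDeriv (0, 1) u p) {f g : ℝ → ℝ}
    (hf : ContDiff ℝ ∞ f) (hg : ContDiff ℝ ∞ g) (h0 : g R.y₀ = 0) (h1 : g R.y₁ = 0) :
    inner ℝ u (R.toL2 (tensor hf hg.contDiff_deriv)) = -inner ℝ p (R.toL2 (tensor hf hg)) := by
  rw [← pderiv_snd_tensor hf hg]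
  apply IsWeakDeriv.inner_eq_of_bound R h
  obtain ⟨L, hL, hL'⟩ := exists_lipschitz_bound R.hy hg h0 h1
  obtain ⟨C, hC⟩ := exists_bound_mul_deriv_cutoff hL hL'
  obtain ⟨C', hC'⟩ := (isCompact_Icc (a := R.x₀) (b := R.x₁)).exists_bound_of_continuousOn
    hf.continuous.continuousOn
  refine ⟨C * C', fun n z hz => ?_⟩
  rw [cutoff, pderiv_snd_tensor, tensor_apply, tensor_apply,
    show f z.1 * g z.2 * (_root_.cutoff R.x₀ R.x₁ n z.1 * deriv (_root_.cutoff R.y₀ R.y₁ n) z.2) =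
    (g z.2 * deriv (_root_.cutoff R.y₀ R.y₁ n) z.2) * (f z.1 * _root_.cutoff R.x₀ R.x₁ n z.1) by
      ring, abs_mul]
  have e1 := hC n z.2 hz.2
  refine mul_le_mul e1 ?_ (abs_nonneg _) ((abs_nonneg _).trans e1)
  rw [abs_mul, abs_of_nonneg (cutoff_nonneg _ _ _ _)]
  exact (mul_le_of_le_one_right (abs_nonneg _) (cutoff_le_one _ _ _ _)).trans
    (hC' _ (Ioo_subset_Icc_self hz.1))

end Rect


/-! ### Completeness of the cosines and density of smooth functions -/

/-- The Neumann modes of the interval `(a, b)`. -/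
noncomputable def cosMode (a b : ℝ) (m : ℤ) (x : ℝ) : ℝ :=
  Real.cos (m * (Real.pi / (b - a) * (x - a)))

theorem contDiff_cosMode (a b : ℝ) (m : ℤ) : ContDiff ℝ ∞ (cosMode a b m) :=
  Real.contDiff_cos.comp (by fun_prop)

theorem cosMode_zero (a b x : ℝ) : cosMode a b 0 x = 1 := by simp [cosMode]

theorem cosMode_one_mul (a b : ℝ) (m : ℤ) (x : ℝ) : cosMode a b 1 x * cosMode a b m x =
    (cosMode a b (m + 1) x + cosMode a b (m - 1) x) / 2 := by
  simp only [cosMode]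
  push_cast
  rw [add_mul, sub_mul, Real.cos_add, Real.cos_sub, one_mul]
  ring

theorem injOn_cosMode_one {a b : ℝ} (hab : a < b) : InjOn (cosMode a b 1) (Icc a b) := by
  have h : 0 < b - a := sub_pos.2 hab
  have hm : ∀ x ∈ Icc a b, Real.pi / (b - a) * (x - a) ∈ Icc 0 Real.pi := fun x hx => by
    have h1 : 0 ≤ x - a := by linarith [hx.1]
    refine ⟨by positivity, ?_⟩
    rw [div_mul_eq_mul_div, div_le_iff₀ h]
    exact mul_le_mul_of_nonneg_left (by linarith [hx.2]) Real.pi_pos.le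
  intro x hx y hy hxy
  simp only [cosMode, Int.cast_one, one_mul] at hxy
  have := Real.injOn_cos (hm x hx) (hm y hy) hxy
  have hp : Real.pi / (b - a) ≠ 0 := by positivity
  linarith [mul_left_cancel₀ hp this]

theorem deriv_cosMode (a b : ℝ) (m : ℤ) : deriv (cosMode a b m) = fun x =>
    -(m * (Real.pi / (b - a))) * Real.sin (m * (Real.pi / (b - a) * (x - a))) := by
  funext x
  have h : HasDerivAt (fun x : ℝ => m * (Real.pi / (b - a) * (x - a)))
      (m * (Real.pi / (b - a))) x := by
    simpa using (((hasDerivAt_id x).sub_const a).const_mul (Real.pi / (b - a))).const_mul (m : ℝ)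
  exact ((Real.hasDerivAt_cos _).comp x h).deriv.trans (by ring)

theorem deriv_deriv_cosMode (a b : ℝ) (m : ℤ) : deriv (deriv (cosMode a b m)) = fun x =>
    -(m * (Real.pi / (b - a))) ^ 2 * cosMode a b m x := by
  funext x
  have h : HasDerivAt (fun x : ℝ => m * (Real.pi / (b - a) * (x - a)))
      (m * (Real.pi / (b - a))) x := by
    simpa using (((hasDerivAt_id x).sub_const a).const_mul (Real.pi / (b - a))).const_mul (m : ℝ)
  rw [deriv_cosMode]
  exact (((Real.hasDerivAt_sin _).comp x h).const_mul _).deriv.trans (by rw [cosMode]; ring)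

theorem deriv_cosMode_left (a b : ℝ) (m : ℤ) : deriv (cosMode a b m) a = 0 := by
  simp [deriv_cosMode]

theorem deriv_cosMode_right {a b : ℝ} (hab : a < b) (m : ℤ) : deriv (cosMode a b m) b = 0 := by
  simp only [deriv_cosMode]
  rw [div_mul_cancel₀ _ (sub_pos.2 hab).ne', Real.sin_int_mul_pi, mul_zero]

namespace Rect

variable (R : Rect)

open smoothFun

/-- The Neumann modes of a rectangle. -/
noncomputable def cosMode (m n : ℤ) : smoothFun :=
  tensor (contDiff_cosMode R.x₀ R.x₁ m) (contDiff_cosMode R.y₀ R.y₁ n)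

theorem integrable_mul_continuous (u : R.L2) {ψ : ℝ × ℝ → ℝ} (hψ : Continuous ψ) :
    Integrable (fun z => u z * ψ z) R.areaMeasure :=
  (Lp.memLp u).integrable_mul (R.memLp_area hψ 2)

/-- The induction carries orthogonality to `ψ` times every cosine mode. Multiplying by a generator
shifts mode indices by `±1` through the product formula; integer indices avoid a special case at
`0`. -/
theorem integral_mul_eq_zero_of_mem_adjoin {u : R.L2}
    (h : ∀ m n, inner ℝ u (R.toL2 (R.cosMode m n)) = 0) {p : C(ℝ × ℝ, ℝ)}
    (hp : p ∈ Algebra.adjoin ℝ {(⟨(R.cosMode 1 0).1, smoothFun.continuous _⟩ : C(ℝ × ℝ, ℝ)),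
      ⟨(R.cosMode 0 1).1, smoothFun.continuous _⟩}) :
    ∫ z, u z * p z ∂(R.areaMeasure) = 0 := by
  set N : C(ℝ × ℝ, ℝ) → Prop := fun ψ =>
    ∀ m n, ∫ z, u z * (ψ z * (R.cosMode m n).1 z) ∂(R.areaMeasure) = 0 with hN
  have hi : ∀ (ψ : C(ℝ × ℝ, ℝ)) m n,
      Integrable (fun z => u z * (ψ z * (R.cosMode m n).1 z)) R.areaMeasure := fun ψ m n =>
    R.integrable_mul_continuous u (ψ.continuous.mul (smoothFun.continuous _))
  have half : ∀ (ψ : C(ℝ × ℝ, ℝ)), N ψ → ∀ m n m' n' : ℤ,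
      ∫ z, u z * (ψ z * (((R.cosMode m n).1 z + (R.cosMode m' n').1 z) / 2)) ∂(R.areaMeasure)
        = 0 := by
    intro ψ hψ m n m' n'
    have : (fun z => u z * (ψ z * (((R.cosMode m n).1 z + (R.cosMode m' n').1 z) / 2))) =
        fun z => (1 / 2) * (u z * (ψ z * (R.cosMode m n).1 z) +
          u z * (ψ z * (R.cosMode m' n').1 z)) := by
      funext z; ring
    rw [this, integral_const_mul, integral_add (hi ψ m n) (hi ψ m' n'), hψ, hψ, add_zero,
      mul_zero]
  have key : ∀ ψ, N ψ → N (p * ψ) := by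
    refine Algebra.adjoin_induction (p := fun p _ => ∀ ψ, N ψ → N (p * ψ)) ?_ ?_ ?_ ?_ hp
    · rintro q (rfl | rfl) ψ hψ m n
      · rw [← half ψ hψ (m + 1) n (m - 1) n]
        congr 1 with z
        simp only [ContinuousMap.mul_apply, ContinuousMap.coe_mk, cosMode, tensor_apply]
        rw [cosMode_zero, mul_one, show ∀ a b c d : ℝ, a * b * (c * d) = b * (a * c * d) by
          intros; ring, cosMode_one_mul]
        ring
      · rw [← half ψ hψ m (n + 1) m (n - 1)]
        congr 1 with z
        simp only [ContinuousMap.mul_apply, ContinuousMap.coe_mk, cosMode, tensor_apply]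
        rw [cosMode_zero, one_mul, show ∀ a b c d : ℝ, a * b * (c * d) = b * (c * (a * d)) by
          intros; ring, cosMode_one_mul]
        ring
    · intro r ψ hψ m n
      have : (fun z => u z * ((algebraMap ℝ C(ℝ × ℝ, ℝ) r * ψ) z * (R.cosMode m n).1 z)) =
          fun z => r * (u z * (ψ z * (R.cosMode m n).1 z)) := by
        funext z
        change u z * (r * ψ z * (R.cosMode m n).1 z) = _
        ring
      rw [this, integral_const_mul, hψ, mul_zero]
    · intro q q' _ _ h1 h2 ψ hψ m n
      have : (fun z => u z * (((q + q') * ψ) z * (R.cosMode m n).1 z)) =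
          fun z => u z * ((q * ψ) z * (R.cosMode m n).1 z) +
            u z * ((q' * ψ) z * (R.cosMode m n).1 z) := by
        funext z
        simp only [ContinuousMap.mul_apply, ContinuousMap.add_apply]
        ring
      rw [this, integral_add (hi _ m n) (hi _ m n), h1 ψ hψ, h2 ψ hψ, add_zero]
    · intro q q' _ _ h1 h2 ψ hψ
      rw [mul_assoc]
      exact h1 _ (h2 _ hψ)
  have h1 : N 1 := fun m n => by
    simp only [ContinuousMap.one_apply, one_mul]
    rw [← inner_toL2, h]
  have := key 1 h1 0 0
  simpa [cosMode, tensor_apply, cosMode_zero] using this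

/-- Stone–Weierstrass: the first nonconstant cosine of each variable is injective on its closed
side, so the two generate an algebra separating the points of the closed rectangle. It approximates
each test function uniformly. -/
theorem eq_zero_of_inner_cosMode {u : R.L2}
    (h : ∀ m n, inner ℝ u (R.toL2 (R.cosMode m n)) = 0) : u = 0 := by
  refine R.eq_zero_of_inner_test fun φ _ _ => ?_
  rw [inner_toL2]
  have : CompactSpace R.box := isCompact_iff_compactSpace.1 R.isCompact_box
  set rest : C(ℝ × ℝ, ℝ) →ₐ[ℝ] C(R.box, ℝ) :=
    ContinuousMap.compRightAlgHom ℝ ℝ ⟨Subtype.val, continuous_subtype_val⟩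
  set A := Algebra.adjoin ℝ {(⟨(R.cosMode 1 0).1, smoothFun.continuous _⟩ : C(ℝ × ℝ, ℝ)),
      ⟨(R.cosMode 0 1).1, smoothFun.continuous _⟩} with hA
  have hsep : (A.map rest).SeparatesPoints := by
    rintro ⟨⟨x, y⟩, hx, hy⟩ ⟨⟨x', y'⟩, hx', hy'⟩ hne
    by_cases hxx : x = x'
    · have hyy : y ≠ y' := fun h => hne (by simp [hxx, h])
      refine ⟨_, ⟨_, ⟨_, Algebra.subset_adjoin (Or.inr rfl), rfl⟩, rfl⟩, ?_⟩
      intro h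
      refine hyy (injOn_cosMode_one R.hy hy hy' ?_)
      change _root_.cosMode R.x₀ R.x₁ 0 x * _root_.cosMode R.y₀ R.y₁ 1 y =
        _root_.cosMode R.x₀ R.x₁ 0 x' * _root_.cosMode R.y₀ R.y₁ 1 y' at h
      simpa only [cosMode_zero, one_mul] using h
    · refine ⟨_, ⟨_, ⟨_, Algebra.subset_adjoin (Or.inl rfl), rfl⟩, rfl⟩, ?_⟩
      intro h
      refine hxx (injOn_cosMode_one R.hx hx hx' ?_)
      change _root_.cosMode R.x₀ R.x₁ 1 x * _root_.cosMode R.y₀ R.y₁ 0 y =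
        _root_.cosMode R.x₀ R.x₁ 1 x' * _root_.cosMode R.y₀ R.y₁ 0 y' at h
      simpa only [cosMode_zero, mul_one] using h
  have hu : Integrable u R.areaMeasure := (Lp.memLp u).integrable (by norm_num)
  set I := ∫ z, |u z| ∂(R.areaMeasure) with hI
  have hI0 : 0 ≤ I := integral_nonneg fun z => abs_nonneg _
  have bound : ∀ ε > 0, |∫ z, u z * φ.1 z ∂(R.areaMeasure)| ≤ I * ε := by
    intro ε hε
    obtain ⟨⟨_, p, hp, rfl⟩, hpε⟩ :=
      ContinuousMap.exists_mem_subalgebra_near_continuous_of_separatesPoints (A.map rest) hsep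
        (fun z => φ.1 z) ((smoothFun.continuous φ).comp continuous_subtype_val) ε hε
    have h0 := R.integral_mul_eq_zero_of_mem_adjoin h hp
    have e : ∫ z, u z * φ.1 z ∂(R.areaMeasure) =
        ∫ z, u z * (φ.1 z - p z) ∂(R.areaMeasure) := by
      have : (fun z => u z * (φ.1 z - p z)) = fun z => u z * φ.1 z - u z * p z := by
        funext z; ring
      rw [this, integral_sub (R.integrable_mul_continuous u (smoothFun.continuous φ))
        (R.integrable_mul_continuous u p.continuous), h0, sub_zero]
    rw [e, hI, ← integral_mul_const]
    rw [← Real.norm_eq_abs]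
    refine norm_integral_le_of_norm_le (g := fun z => |u z| * ε) (hu.abs.mul_const ε) ?_
    filter_upwards [R.ae_mem_box_area] with z hz
    rw [norm_mul]
    refine mul_le_mul_of_nonneg_left ?_ (norm_nonneg _)
    rw [norm_sub_rev]
    exact (hpε ⟨z, hz⟩).le
  have hlim : Tendsto (fun ε : ℝ => I * ε) (𝓝[>] 0) (𝓝 0) := by
    have : Tendsto (fun ε : ℝ => I * ε) (𝓝 0) (𝓝 (I * 0)) :=
      (continuous_const.mul continuous_id).tendsto 0
    rw [mul_zero] at this
    exact this.mono_left nhdsWithin_le_nhds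
  have := ge_of_tendsto hlim (eventually_mem_nhdsWithin.mono fun ε hε => bound ε hε)
  exact abs_eq_zero.1 (le_antisymm this (abs_nonneg _))

/-- The pair of equations that make up the graph of the weak gradient. -/
def weakGraph : Submodule ℝ (PiLp 2 fun _ : Fin 3 => R.L2) where
  carrier := {e | R.IsWeakDeriv (1, 0) (e 0) (e 1) ∧ R.IsWeakDeriv (0, 1) (e 0) (e 2)}
  zero_mem' := ⟨IsWeakDeriv.zero R _, IsWeakDeriv.zero R _⟩
  add_mem' := fun h h' => ⟨h.1.add h'.1, h.2.add h'.2⟩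
  smul_mem' := fun c _ h => ⟨h.1.smul c, h.2.smul c⟩

theorem isClosed_weakGraph : IsClosed (R.weakGraph : Set (PiLp 2 fun _ : Fin 3 => R.L2)) := by
  have hc : ∀ i, Continuous fun e : PiLp 2 fun _ : Fin 3 => R.L2 => e i := fun i =>
    PiLp.continuous_apply 2 _ i
  have key : ∀ v i, IsClosed {e : PiLp 2 fun _ : Fin 3 => R.L2 | R.IsWeakDeriv v (e 0) (e i)} := by
    intro v i
    simp only [isWeakDeriv_iff, Set.ofPred_forall]
    refine isClosed_iInter fun φ => isClosed_iInter fun _ => isClosed_iInter fun _ => ?_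
    exact isClosed_eq ((hc 0).inner continuous_const) (((hc i).inner continuous_const).neg)
  exact (key _ 1).inter (key _ 2)

/-- A smooth function together with its partial derivatives. -/
noncomputable def smoothGraph : smoothFun →ₗ[ℝ] PiLp 2 fun _ : Fin 3 => R.L2 where
  toFun φ := WithLp.toLp 2 ![R.toL2 φ, R.toL2 (pderiv (1, 0) φ), R.toL2 (pderiv (0, 1) φ)]
  map_add' φ ψ := by
    ext1 i
    fin_cases i <;> simp [map_add]
  map_smul' c φ := by
    ext1 i
    fin_cases i <;> simp [map_smul]

theorem inner_smoothGraph (e : PiLp 2 fun _ : Fin 3 => R.L2) (φ : smoothFun) :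
    inner ℝ e (R.smoothGraph φ) = inner ℝ (e 0) (R.toL2 φ) +
      inner ℝ (e 1) (R.toL2 (pderiv (1, 0) φ)) + inner ℝ (e 2) (R.toL2 (pderiv (0, 1) φ)) := by
  rw [PiLp.inner_apply, Fin.sum_univ_three]
  rfl

/-- Cosines have vanishing normal derivative, so the weak derivatives can be integrated by parts
against their gradients without a boundary term. Orthogonality in the graph norm becomes `(1 + kₘ² +
lₙ²) ⟨u, cos⟩ = 0`, and completeness of the cosines forces `u = 0`. -/
theorem eq_zero_of_mem_weakGraph {e : PiLp 2 fun _ : Fin 3 => R.L2} (he : e ∈ R.weakGraph)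
    (horth : ∀ φ, inner ℝ e (R.smoothGraph φ) = 0) : e = 0 := by
  obtain ⟨h1, h2⟩ := he
  have h0 : e 0 = 0 := by
    refine R.eq_zero_of_inner_cosMode fun m n => ?_
    have hx := contDiff_cosMode R.x₀ R.x₁ m
    have hy := contDiff_cosMode R.y₀ R.y₁ n
    have e1 := IsWeakDeriv.inner_tensor_fst R h1 hx.contDiff_deriv hy
      (deriv_cosMode_left _ _ _) (deriv_cosMode_right R.hx m)
    have e2 := IsWeakDeriv.inner_tensor_snd R h2 hx hy.contDiff_deriv
      (deriv_cosMode_left _ _ _) (deriv_cosMode_right R.hy n)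
    have e3 := horth (R.cosMode m n)
    rw [inner_smoothGraph] at e3
    rw [show pderiv (1, 0) (R.cosMode m n) = tensor hx.contDiff_deriv hy from
        pderiv_fst_tensor hx hy,
      show pderiv (0, 1) (R.cosMode m n) = tensor hx hy.contDiff_deriv from
        pderiv_snd_tensor hx hy] at e3
    have d1 : tensor hx.contDiff_deriv.contDiff_deriv hy =
        (-(m * (Real.pi / (R.x₁ - R.x₀))) ^ 2) • R.cosMode m n := by
      apply Subtype.ext
      funext z
      change deriv (deriv (_root_.cosMode R.x₀ R.x₁ m)) z.1 * _root_.cosMode R.y₀ R.y₁ n z.2 =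
        _ * (_root_.cosMode R.x₀ R.x₁ m z.1 * _root_.cosMode R.y₀ R.y₁ n z.2)
      rw [deriv_deriv_cosMode]
      ring
    have d2 : tensor hx hy.contDiff_deriv.contDiff_deriv =
        (-(n * (Real.pi / (R.y₁ - R.y₀))) ^ 2) • R.cosMode m n := by
      apply Subtype.ext
      funext z
      change _root_.cosMode R.x₀ R.x₁ m z.1 * deriv (deriv (_root_.cosMode R.y₀ R.y₁ n)) z.2 =
        _ * (_root_.cosMode R.x₀ R.x₁ m z.1 * _root_.cosMode R.y₀ R.y₁ n z.2)
      rw [deriv_deriv_cosMode]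
      ring
    rw [d1, map_smul, inner_smul_right] at e1
    rw [d2, map_smul, inner_smul_right] at e2
    have : (1 + (m * (Real.pi / (R.x₁ - R.x₀))) ^ 2 + (n * (Real.pi / (R.y₁ - R.y₀))) ^ 2) *
        inner ℝ (e 0) (R.toL2 (R.cosMode m n)) = 0 := by
      linarith
    exact (mul_eq_zero.1 this).resolve_left (by positivity)
  rw [h0] at h1 h2
  ext1 i
  fin_cases i
  · exact h0
  · exact IsWeakDeriv.unique R h1 (IsWeakDeriv.zero R _)
  · exact IsWeakDeriv.unique R h2 (IsWeakDeriv.zero R _)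

/-- Project the graph of the weak gradient at `u` onto the closure of the smooth graphs. The
residual remains in the closed weak graph and is orthogonal to all smooth graphs, hence is zero. -/
theorem exists_tendsto_smooth {u : R.L2} (hu : u ∈ R.H1) : ∃ φ : ℕ → smoothFun,
    Tendsto (fun n => R.toL2 (φ n)) atTop (𝓝 u) ∧
      Tendsto (fun n => R.toL2 (pderiv (1, 0) (φ n))) atTop (𝓝 (R.weakDeriv (1, 0) u)) ∧
      Tendsto (fun n => R.toL2 (pderiv (0, 1) (φ n))) atTop (𝓝 (R.weakDeriv (0, 1) u)) := by
  set S := LinearMap.range R.smoothGraph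
  have hSW : S ≤ R.weakGraph := by
    rintro _ ⟨φ, rfl⟩
    exact ⟨R.isWeakDeriv_toL2 _ φ, R.isWeakDeriv_toL2 _ φ⟩
  have hKW : S.topologicalClosure ≤ R.weakGraph :=
    S.topologicalClosure_minimal hSW R.isClosed_weakGraph
  set x : PiLp 2 fun _ : Fin 3 => R.L2 :=
    WithLp.toLp 2 ![u, R.weakDeriv (1, 0) u, R.weakDeriv (0, 1) u] with hx
  have hxW : x ∈ R.weakGraph :=
    ⟨R.isWeakDeriv_weakDeriv hu.1, R.isWeakDeriv_weakDeriv hu.2⟩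
  have : CompleteSpace S.topologicalClosure :=
    S.isClosed_topologicalClosure.completeSpace_coe
  obtain ⟨k, hk, z, hz, hxz⟩ := S.topologicalClosure.exists_add_mem_mem_orthogonal x
  have hz0 : z = 0 := by
    refine R.eq_zero_of_mem_weakGraph ?_ fun φ => ?_
    · have : z = x - k := by rw [hxz]; abel
      rw [this]
      exact R.weakGraph.sub_mem hxW (hKW hk)
    · rw [real_inner_comm]
      exact hz _ (S.le_topologicalClosure ⟨φ, rfl⟩)
  rw [hz0, add_zero] at hxz
  rw [← hxz] at hk
  obtain ⟨s, hs, hlim⟩ := mem_closure_iff_seq_limit.1 hk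
  choose φ hφ using hs
  have hc : ∀ i, Tendsto (fun n => s n i) atTop (𝓝 (x i)) := fun i =>
    ((PiLp.continuous_apply 2 _ i).tendsto x).comp hlim
  refine ⟨φ, ?_, ?_, ?_⟩
  · refine (hc 0).congr fun n => ?_
    rw [← hφ]; rfl
  · refine (hc 1).congr fun n => ?_
    rw [← hφ]; rfl
  · refine (hc 2).congr fun n => ?_
    rw [← hφ]; rfl

end Rect


/-! ### The Robin problem on an interval `[a, b]` -/

theorem integral_rescale {a b : ℝ} (h : ℝ → ℝ) : ∫ x in a..b, h x =
    (b - a) / 2 * ∫ t in (-1 : ℝ)..1, h ((a + b) / 2 + (b - a) / 2 * t) := by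
  have := intervalIntegral.smul_integral_comp_add_mul (a := -1) (b := 1) h ((b - a) / 2)
    ((a + b) / 2)
  rw [smul_eq_mul] at this
  rw [this]
  congr 1 <;> ring

/-- The Robin energy on the interval `[a, b]`. -/
noncomputable def intervalEnergy (β a b : ℝ) (f : ℝ → ℝ) : ℝ :=
  (∫ x in a..b, deriv f x ^ 2) + β * (f a ^ 2 + f b ^ 2)

/-- `v` is a normalized Robin eigenfunction on `[a, b]` with parameter `β` and eigenvalue `m`. -/
structure IntervalMode (β a b m : ℝ) (v : ℝ → ℝ) : Prop where
  smooth : ContDiff ℝ ∞ v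
  norm : ∫ x in a..b, v x ^ 2 = 1
  weak : ∀ f : ℝ → ℝ, ContDiff ℝ 1 f →
    (∫ x in a..b, deriv v x * deriv f x) + β * (v a * f a + v b * f b) =
      m * ∫ x in a..b, v x * f x

/-- The first Robin eigenvalue of the interval `[a, b]`. -/
noncomputable def intervalEigenvalue₁ (β a b : ℝ) : ℝ :=
  evenEigenvalue (β * ((b - a) / 2)) / ((b - a) / 2) ^ 2

/-- The second Robin eigenvalue of the interval `[a, b]`. -/
noncomputable def intervalEigenvalue₂ (β a b : ℝ) : ℝ :=
  oddEigenvalue (β * ((b - a) / 2)) / ((b - a) / 2) ^ 2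

/-- The function `V`, transplanted from `[-1, 1]` to `[a, b]` and normalized. -/
noncomputable def rescale (a b : ℝ) (V : ℝ → ℝ) (x : ℝ) : ℝ :=
  (√((b - a) / 2 * ∫ t in (-1 : ℝ)..1, V t ^ 2))⁻¹ * V ((x - (a + b) / 2) / ((b - a) / 2))

theorem rescale_apply {a b : ℝ} (hab : a < b) (V : ℝ → ℝ) (t : ℝ) :
    rescale a b V ((a + b) / 2 + (b - a) / 2 * t) =
      (√((b - a) / 2 * ∫ t in (-1 : ℝ)..1, V t ^ 2))⁻¹ * V t := by
  have hs : (b - a) / 2 ≠ 0 := by linarith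
  rw [rescale, add_sub_cancel_left, mul_div_cancel_left₀ _ hs]

theorem rescale_left {a b : ℝ} (hab : a < b) (V : ℝ → ℝ) : rescale a b V a =
    (√((b - a) / 2 * ∫ t in (-1 : ℝ)..1, V t ^ 2))⁻¹ * V (-1) := by
  rw [← rescale_apply hab]; congr 1; ring

theorem rescale_right {a b : ℝ} (hab : a < b) (V : ℝ → ℝ) : rescale a b V b =
    (√((b - a) / 2 * ∫ t in (-1 : ℝ)..1, V t ^ 2))⁻¹ * V 1 := by
  rw [← rescale_apply hab]; congr 1; ring

theorem inv_sqrt_sq_mul {k : ℝ} (hk : 0 < k) : (√k)⁻¹ ^ 2 * k = 1 := by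
  rw [inv_pow, Real.sq_sqrt hk.le, inv_mul_cancel₀ hk.ne']

theorem contDiff_rescale (a b : ℝ) {V : ℝ → ℝ} (hV : ContDiff ℝ ∞ V) :
    ContDiff ℝ ∞ (rescale a b V) :=
  contDiff_const.mul (hV.comp (by fun_prop))

theorem deriv_rescale (a b : ℝ) {V : ℝ → ℝ} (hV : ContDiff ℝ ∞ V) (x : ℝ) :
    HasDerivAt (rescale a b V) ((√((b - a) / 2 * ∫ t in (-1 : ℝ)..1, V t ^ 2))⁻¹ *
      (deriv V ((x - (a + b) / 2) / ((b - a) / 2)) * (1 / ((b - a) / 2)))) x :=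
  ((hV.hasDerivAt_deriv _).comp x
    (((hasDerivAt_id x).sub_const _).div_const _)).const_mul _

theorem IntervalMode.of_rescale {a b : ℝ} (hab : a < b) {β c μ : ℝ} (hc : c = β * ((b - a) / 2))
    {V : ℝ → ℝ} (hV : ContDiff ℝ ∞ V) (ode : ∀ x, deriv (deriv V) x = -μ * V x)
    (bc : deriv V 1 + c * V 1 = 0) (bc' : -deriv V (-1) + c * V (-1) = 0)
    (hpos : 0 < ∫ t in (-1 : ℝ)..1, V t ^ 2) :
    IntervalMode β a b (μ / ((b - a) / 2) ^ 2) (rescale a b V) := by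
  have hs : 0 < (b - a) / 2 := by linarith
  have hs' : b - a ≠ 0 := by linarith
  have hk := inv_sqrt_sq_mul (mul_pos hs hpos)
  have sm := contDiff_rescale a b hV
  have d1 : deriv (rescale a b V) = fun x => (√((b - a) / 2 * ∫ t in (-1 : ℝ)..1, V t ^ 2))⁻¹ *
      (deriv V ((x - (a + b) / 2) / ((b - a) / 2)) * (1 / ((b - a) / 2))) :=
    funext fun x => (deriv_rescale a b hV x).deriv
  have e1 : ∀ t, deriv (rescale a b V) ((a + b) / 2 + (b - a) / 2 * t) =
      (√((b - a) / 2 * ∫ t in (-1 : ℝ)..1, V t ^ 2))⁻¹ * (deriv V t * (1 / ((b - a) / 2))) := by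
    intro t
    rw [d1]
    simp only
    rw [add_sub_cancel_left, mul_div_cancel_left₀ _ hs.ne']
  have d2 : ∀ x, HasDerivAt (deriv (rescale a b V))
      (-(μ / ((b - a) / 2) ^ 2) * rescale a b V x) x := by
    intro x
    rw [d1]
    refine ((((hV.contDiff_deriv.hasDerivAt_deriv _).comp x
      (((hasDerivAt_id x).sub_const _).div_const _)).mul_const _).const_mul _).congr_deriv ?_
    rw [ode, rescale]
    simp only [id]
    generalize (b - a) / 2 = s
    ring
  have bl : deriv (rescale a b V) a = β * rescale a b V a := by
    have h := e1 (-1)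
    rw [show (a + b) / 2 + (b - a) / 2 * (-1) = a by ring] at h
    rw [h, rescale_left hab]
    rw [hc] at bc'
    have : deriv V (-1) = β * ((b - a) / 2) * V (-1) := by linarith
    rw [this]
    generalize (√((b - a) / 2 * ∫ t in (-1 : ℝ)..1, V t ^ 2))⁻¹ = k
    field_simp
  have br : deriv (rescale a b V) b = -(β * rescale a b V b) := by
    have h := e1 1
    rw [show (a + b) / 2 + (b - a) / 2 * 1 = b by ring] at h
    rw [h, rescale_right hab]
    rw [hc] at bc
    have : deriv V 1 = -(β * ((b - a) / 2) * V 1) := by linarith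
    rw [this]
    generalize (√((b - a) / 2 * ∫ t in (-1 : ℝ)..1, V t ^ 2))⁻¹ = k
    field_simp
  refine ⟨sm, ?_, fun f hf => ?_⟩
  · rw [integral_rescale]
    simp only [rescale_apply hab, mul_pow]
    rw [intervalIntegral.integral_const_mul]
    linear_combination hk
  · have cv : Continuous (rescale a b V) := sm.continuous
    have cv' : Continuous (deriv (rescale a b V)) := sm.contDiff_deriv.continuous
    have cf : Continuous f := hf.continuous
    have cf' : Continuous (deriv f) := hf.continuous_deriv le_rfl
    have key : ∫ x in a..b, (deriv (rescale a b V) x * deriv f x -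
        μ / ((b - a) / 2) ^ 2 * (rescale a b V x * f x)) =
        deriv (rescale a b V) b * f b - deriv (rescale a b V) a * f a := by
      rw [intervalIntegral.integral_eq_sub_of_hasDerivAt
        (f := fun x => deriv (rescale a b V) x * f x)]
      · intro x _
        exact ((d2 x).mul (hf.hasDerivAt_deriv_of_one x)).congr_deriv (by ring)
      · exact Continuous.intervalIntegrable (by fun_prop) _ _
    rw [integral_sub_of_continuous (f := fun x => deriv (rescale a b V) x * deriv f x)
      (g := fun x => μ / ((b - a) / 2) ^ 2 * (rescale a b V x * f x)) (by fun_prop)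
      (by fun_prop), intervalIntegral.integral_const_mul, bl, br] at key
    linear_combination key

theorem intervalEnergy_rescale {a b : ℝ} (hab : a < b) (β : ℝ) {f : ℝ → ℝ}
    (hf : ContDiff ℝ 1 f) : intervalEnergy β a b f = ((b - a) / 2)⁻¹ *
      ((∫ t in (-1 : ℝ)..1, deriv (fun t => f ((a + b) / 2 + (b - a) / 2 * t)) t ^ 2) +
        β * ((b - a) / 2) * (f ((a + b) / 2 + (b - a) / 2 * (-1)) ^ 2 +
          f ((a + b) / 2 + (b - a) / 2 * 1) ^ 2)) := by
  have hs : b - a ≠ 0 := by linarith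
  have d : ∀ t, deriv (fun t => f ((a + b) / 2 + (b - a) / 2 * t)) t =
      (b - a) / 2 * deriv f ((a + b) / 2 + (b - a) / 2 * t) := fun t => by
    have : HasDerivAt (fun t => (a + b) / 2 + (b - a) / 2 * t) ((b - a) / 2) t := by
      simpa using ((hasDerivAt_id t).const_mul ((b - a) / 2)).const_add ((a + b) / 2)
    exact ((hf.hasDerivAt_deriv_of_one _).comp t this).deriv.trans (mul_comm _ _)
  simp only [d, mul_pow]
  rw [intervalIntegral.integral_const_mul, intervalEnergy, integral_rescale,
    show (a + b) / 2 + (b - a) / 2 * (-1) = a by ring,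
    show (a + b) / 2 + (b - a) / 2 * 1 = b by ring]
  field_simp

theorem intervalEigenvalue₁_mul_le {a b : ℝ} (hab : a < b) (β : ℝ) {f : ℝ → ℝ}
    (hf : ContDiff ℝ 1 f) :
    intervalEigenvalue₁ β a b * (∫ x in a..b, f x ^ 2) ≤ intervalEnergy β a b f := by
  have hs : 0 < (b - a) / 2 := by linarith
  obtain ⟨V, hV⟩ := exists_evenMode (β * ((b - a) / 2))
  have := hV.energy_le (f := fun t => f ((a + b) / 2 + (b - a) / 2 * t))
    (hf.comp (by fun_prop))
  rw [intervalEnergy_rescale hab β hf, integral_rescale, intervalEigenvalue₁]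
  calc _ = ((b - a) / 2)⁻¹ * (evenEigenvalue (β * ((b - a) / 2)) *
        ∫ t in (-1 : ℝ)..1, f ((a + b) / 2 + (b - a) / 2 * t) ^ 2) := by field_simp
    _ ≤ _ := mul_le_mul_of_nonneg_left this (inv_pos.2 hs).le

/-- The first two Robin eigenfunctions of an interval. -/
theorem exists_intervalModes {a b : ℝ} (hab : a < b) (β : ℝ) : ∃ v w,
    IntervalMode β a b (intervalEigenvalue₁ β a b) v ∧
    IntervalMode β a b (intervalEigenvalue₂ β a b) w ∧ ∫ x in a..b, v x * w x = 0 ∧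
    (oddEigenvalue (β * ((b - a) / 2)) ≤ Real.pi ^ 2 + 2 * evenEigenvalue (β * ((b - a) / 2)) →
      ∀ f, ContDiff ℝ 1 f → intervalEigenvalue₂ β a b * (∫ x in a..b, f x ^ 2) ≤
        intervalEnergy β a b f + (intervalEigenvalue₂ β a b - intervalEigenvalue₁ β a b) *
          (∫ x in a..b, f x * v x) ^ 2) := by
  have hs : 0 < (b - a) / 2 := by linarith
  obtain ⟨V, hV⟩ := exists_evenMode (β * ((b - a) / 2))
  obtain ⟨W, hW⟩ := exists_oddMode (β * ((b - a) / 2))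
  have hWpos : 0 < ∫ t in (-1 : ℝ)..1, W t ^ 2 := by
    rw [integral_symm_eq (g := fun t => W t ^ 2) (hW.smooth.continuous.pow 2)]
    simp only [hW.odd, neg_sq, ← two_mul]
    rw [intervalIntegral.integral_const_mul]
    exact mul_pos two_pos hW.integral_sq_pos
  refine ⟨rescale a b V, rescale a b W, ?_, ?_, ?_, fun hgap f hf => ?_⟩
  · refine IntervalMode.of_rescale hab rfl hV.smooth hV.ode hV.bc ?_ hV.integral_sq_pos
    rw [deriv_odd_of_even hV.even, hV.even, neg_neg, hV.bc]
  · refine IntervalMode.of_rescale hab rfl hW.smooth hW.ode hW.bc ?_ hWpos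
    rw [deriv_even_of_odd hW.odd, hW.odd]
    linarith [hW.bc]
  · rw [integral_rescale]
    simp only [rescale_apply hab]
    rw [integral_symm_eq (by
      have := hV.smooth.continuous
      have := hW.smooth.continuous
      fun_prop)]
    simp [hV.even, hW.odd]
  · have key := hV.gap_energy_le hW hgap (f := fun t => f ((a + b) / 2 + (b - a) / 2 * t))
      (hf.comp (by fun_prop))
    have hk := inv_sqrt_sq_mul (mul_pos hs hV.integral_sq_pos)
    set k := (√((b - a) / 2 * ∫ t in (-1 : ℝ)..1, V t ^ 2))⁻¹ with hkdef
    have hVne := hV.integral_sq_pos.ne'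
    have e : (∫ x in a..b, f x * rescale a b V x) ^ 2 = (b - a) / 2 *
        ((∫ t in (-1 : ℝ)..1, f ((a + b) / 2 + (b - a) / 2 * t) * V t) ^ 2 /
          ∫ t in (-1 : ℝ)..1, V t ^ 2) := by
      rw [integral_rescale]
      simp only [rescale_apply hab]
      rw [← hkdef]
      simp only [mul_left_comm _ k]
      rw [intervalIntegral.integral_const_mul]
      clear_value k
      generalize (∫ t in (-1 : ℝ)..1, f ((a + b) / 2 + (b - a) / 2 * t) * V t) = J
      generalize (∫ t in (-1 : ℝ)..1, V t ^ 2) = N at hk hVne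
      generalize (b - a) / 2 = s at hk
      field_simp
      linear_combination s * J ^ 2 * hk
    rw [intervalEnergy_rescale hab β hf, integral_rescale, e]
    simp only [intervalEigenvalue₁, intervalEigenvalue₂]
    have := mul_le_mul_of_nonneg_left key (inv_pos.2 hs).le
    refine le_trans (le_of_eq ?_) (this.trans (le_of_eq ?_))
    · field_simp
    · field_simp

theorem IntervalMode.intervalEnergy_eq {β a b m : ℝ} {v : ℝ → ℝ} (h : IntervalMode β a b m v) :
    intervalEnergy β a b v = m := by
  have := h.weak v (h.smooth.of_le (by simp))
  simp only [← pow_two] at this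
  rw [intervalEnergy, this, h.norm, mul_one]

theorem intervalEigenvalue₁_le₂ {a b : ℝ} (hab : a < b) (β : ℝ) :
    intervalEigenvalue₁ β a b ≤ intervalEigenvalue₂ β a b := by
  obtain ⟨v, w, _, hw, _⟩ := exists_intervalModes hab β
  have := intervalEigenvalue₁_mul_le hab β (hw.smooth.of_le (by simp))
  rwa [hw.norm, mul_one, hw.intervalEnergy_eq] at this


/-! ### Slicing the Robin energy of a rectangle, and traces -/

theorem continuous_integral_fst {ψ : ℝ × ℝ → ℝ} (hψ : Continuous ψ) (a b : ℝ) :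
    Continuous fun y => ∫ x in a..b, ψ (x, y) :=
  intervalIntegral.continuous_parametric_intervalIntegral_of_continuous'
    (f := fun y x => ψ (x, y)) (hψ.comp continuous_swap) a b

theorem continuous_integral_snd {ψ : ℝ × ℝ → ℝ} (hψ : Continuous ψ) (a b : ℝ) :
    Continuous fun x => ∫ y in a..b, ψ (x, y) :=
  intervalIntegral.continuous_parametric_intervalIntegral_of_continuous'
    (f := fun x y => ψ (x, y)) hψ a b

theorem integral_mono_of_continuous {a b : ℝ} (hab : a ≤ b) {f g : ℝ → ℝ} (hf : Continuous f)
    (hg : Continuous g) (h : ∀ x, f x ≤ g x) : ∫ x in a..b, f x ≤ ∫ x in a..b, g x :=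
  intervalIntegral.integral_mono_on hab (hf.intervalIntegrable _ _) (hg.intervalIntegrable _ _)
    fun x _ => h x

namespace smoothFun

theorem contDiff_fst (φ : smoothFun) (y : ℝ) : ContDiff ℝ ∞ fun x => φ.1 (x, y) :=
  (smoothFun.contDiff φ).comp (by fun_prop)

theorem contDiff_snd (φ : smoothFun) (x : ℝ) : ContDiff ℝ ∞ fun y => φ.1 (x, y) :=
  (smoothFun.contDiff φ).comp (by fun_prop)

theorem intervalEnergy_fst (φ : smoothFun) (β a b y : ℝ) :
    intervalEnergy β a b (fun x => φ.1 (x, y)) =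
      (∫ x in a..b, (pderiv (1, 0) φ).1 (x, y) ^ 2) +
        β * (φ.1 (a, y) ^ 2 + φ.1 (b, y) ^ 2) := by
  simp only [intervalEnergy, (hasDerivAt_fst φ _ y).deriv]

theorem intervalEnergy_snd (φ : smoothFun) (β a b x : ℝ) :
    intervalEnergy β a b (fun y => φ.1 (x, y)) =
      (∫ y in a..b, (pderiv (0, 1) φ).1 (x, y) ^ 2) +
        β * (φ.1 (x, a) ^ 2 + φ.1 (x, b) ^ 2) := by
  simp only [intervalEnergy, (hasDerivAt_snd φ x _).deriv]

theorem continuous_intervalEnergy_fst (φ : smoothFun) (β a b : ℝ) :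
    Continuous fun y => intervalEnergy β a b (fun x => φ.1 (x, y)) := by
  simp only [intervalEnergy_fst]
  have h1 := continuous_integral_fst ((smoothFun.continuous (pderiv (1, 0) φ)).pow 2) a b
  have h2 := smoothFun.continuous φ
  exact h1.add (by fun_prop)

theorem continuous_intervalEnergy_snd (φ : smoothFun) (β a b : ℝ) :
    Continuous fun x => intervalEnergy β a b (fun y => φ.1 (x, y)) := by
  simp only [intervalEnergy_snd]
  have h1 := continuous_integral_snd ((smoothFun.continuous (pderiv (0, 1) φ)).pow 2) a b
  have h2 := smoothFun.continuous φ
  exact h1.add (by fun_prop)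

end smoothFun

namespace Rect

variable (R : Rect)

open smoothFun

/-- The Robin energy of a smooth function, by slices. -/
theorem energy_eq_integral_slices (β : ℝ) (φ : smoothFun) :
    ‖R.toL2 (pderiv (1, 0) φ)‖ ^ 2 + ‖R.toL2 (pderiv (0, 1) φ)‖ ^ 2 +
      β * ‖R.toBoundary φ‖ ^ 2 =
    (∫ y in R.y₀..R.y₁, intervalEnergy β R.x₀ R.x₁ (fun x => φ.1 (x, y))) +
      ∫ x in R.x₀..R.x₁, intervalEnergy β R.y₀ R.y₁ (fun y => φ.1 (x, y)) := by
  have hφ := smoothFun.continuous φ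
  have hφ1 : Continuous fun z => (pderiv (1, 0) φ).1 z ^ 2 :=
    (smoothFun.continuous (pderiv (1, 0) φ)).pow 2
  have hφ2 : Continuous fun z => (pderiv (0, 1) φ).1 z ^ 2 :=
    (smoothFun.continuous (pderiv (0, 1) φ)).pow 2
  have hφ0 : Continuous fun z => φ.1 z ^ 2 := hφ.pow 2
  simp only [intervalEnergy_fst, intervalEnergy_snd]
  rw [integral_add_of_continuous (continuous_integral_fst hφ1 _ _) (by fun_prop),
    integral_add_of_continuous (continuous_integral_snd hφ2 _ _) (by fun_prop),
    intervalIntegral.integral_const_mul, intervalIntegral.integral_const_mul,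
    norm_sq_toL2, norm_sq_toL2, norm_sq_toBoundary, R.integral_area_eq' hφ1,
    R.integral_area_eq hφ2, R.integral_boundary_eq hφ0]
  ring

theorem norm_sq_toL2_eq_fst (φ : smoothFun) :
    ‖R.toL2 φ‖ ^ 2 = ∫ y in R.y₀..R.y₁, ∫ x in R.x₀..R.x₁, φ.1 (x, y) ^ 2 := by
  rw [norm_sq_toL2]
  exact R.integral_area_eq' ((smoothFun.continuous φ).pow 2)

theorem norm_sq_toL2_eq_snd (φ : smoothFun) :
    ‖R.toL2 φ‖ ^ 2 = ∫ x in R.x₀..R.x₁, ∫ y in R.y₀..R.y₁, φ.1 (x, y) ^ 2 := by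
  rw [norm_sq_toL2]
  exact R.integral_area_eq ((smoothFun.continuous φ).pow 2)

theorem eigenvalue₁_mul_le_fst (β : ℝ) (φ : smoothFun) :
    intervalEigenvalue₁ β R.x₀ R.x₁ * ‖R.toL2 φ‖ ^ 2 ≤
      ∫ y in R.y₀..R.y₁, intervalEnergy β R.x₀ R.x₁ (fun x => φ.1 (x, y)) := by
  rw [norm_sq_toL2_eq_fst, ← intervalIntegral.integral_const_mul]
  exact integral_mono_of_continuous R.hy.le
    (continuous_const.mul (continuous_integral_fst ((smoothFun.continuous φ).pow 2) _ _))
    (continuous_intervalEnergy_fst φ _ _ _)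
    fun y => intervalEigenvalue₁_mul_le R.hx β ((contDiff_fst φ y).of_le (by simp))

theorem eigenvalue₁_mul_le_snd (β : ℝ) (φ : smoothFun) :
    intervalEigenvalue₁ β R.y₀ R.y₁ * ‖R.toL2 φ‖ ^ 2 ≤
      ∫ x in R.x₀..R.x₁, intervalEnergy β R.y₀ R.y₁ (fun y => φ.1 (x, y)) := by
  rw [norm_sq_toL2_eq_snd, ← intervalIntegral.integral_const_mul]
  exact integral_mono_of_continuous R.hx.le
    (continuous_const.mul (continuous_integral_snd ((smoothFun.continuous φ).pow 2) _ _))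
    (continuous_intervalEnergy_snd φ _ _ _)
    fun x => intervalEigenvalue₁_mul_le R.hy β ((contDiff_snd φ x).of_le (by simp))

theorem eigenvalue₁_mul_le_energy (β : ℝ) (φ : smoothFun) :
    (intervalEigenvalue₁ β R.x₀ R.x₁ + intervalEigenvalue₁ β R.y₀ R.y₁) * ‖R.toL2 φ‖ ^ 2 ≤
      ‖R.toL2 (pderiv (1, 0) φ)‖ ^ 2 + ‖R.toL2 (pderiv (0, 1) φ)‖ ^ 2 +
        β * ‖R.toBoundary φ‖ ^ 2 := by
  rw [energy_eq_integral_slices, add_mul]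
  exact add_le_add (R.eigenvalue₁_mul_le_fst β φ) (R.eigenvalue₁_mul_le_snd β φ)

/-- The trace inequality is the lower energy bound for the Robin parameter `-1`, with the boundary
term moved to the other side. -/
theorem exists_norm_toBoundary_le : ∃ C, ∀ φ : smoothFun, ‖R.toBoundary φ‖ ≤
    C * ‖R.toL2 φ‖ + ‖R.toL2 (pderiv (1, 0) φ)‖ + ‖R.toL2 (pderiv (0, 1) φ)‖ := by
  set m := intervalEigenvalue₁ (-1) R.x₀ R.x₁ + intervalEigenvalue₁ (-1) R.y₀ R.y₁
  refine ⟨√|m|, fun φ => ?_⟩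
  have h := R.eigenvalue₁_mul_le_energy (-1) φ
  have hm := Real.sq_sqrt (abs_nonneg m)
  have h1 : -(|m| * ‖R.toL2 φ‖ ^ 2) ≤ m * ‖R.toL2 φ‖ ^ 2 := by
    rw [← neg_mul]
    exact mul_le_mul_of_nonneg_right (neg_abs_le m) (by positivity)
  refine le_of_sq_le_sq ?_ (by positivity)
  have p1 : 0 ≤ √|m| * ‖R.toL2 φ‖ := by positivity
  have p2 := norm_nonneg (R.toL2 (pderiv (1, 0) φ))
  have p3 := norm_nonneg (R.toL2 (pderiv (0, 1) φ))
  nlinarith [mul_nonneg p1 p2, mul_nonneg p1 p3, mul_nonneg p2 p3]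

/-- By the trace inequality, boundary values of an `H¹`-convergent smooth sequence form a Cauchy
sequence. -/
theorem exists_isTrace {u : R.L2} (hu : u ∈ R.H1) : ∃ g, R.IsTrace u g := by
  obtain ⟨φ, h0, h1, h2⟩ := R.exists_tendsto_smooth hu
  obtain ⟨C, hC⟩ := R.exists_norm_toBoundary_le
  have hB : CauchySeq fun n => R.toBoundary (φ n) := by
    rw [cauchySeq_iff_tendsto_dist_atTop_0]
    have c0 := cauchySeq_iff_tendsto_dist_atTop_0.1 h0.cauchySeq
    have c1 := cauchySeq_iff_tendsto_dist_atTop_0.1 h1.cauchySeq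
    have c2 := cauchySeq_iff_tendsto_dist_atTop_0.1 h2.cauchySeq
    have := ((c0.const_mul C).add c1).add c2
    rw [mul_zero, add_zero, add_zero] at this
    refine squeeze_zero (fun _ => dist_nonneg) (fun n => ?_) this
    simp only [dist_eq_norm, ← map_sub]
    exact hC _
  obtain ⟨g, hg⟩ := cauchySeq_tendsto_of_complete hB
  exact ⟨g, R.isTrace_iff.2 ⟨φ, h0, h1, h2, hg⟩⟩

theorem isTrace_trace {u : R.L2} (hu : u ∈ R.H1) : R.IsTrace u (R.trace u) := by
  have h := R.exists_isTrace hu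
  rw [trace, dif_pos h]
  exact h.choose_spec

/-- The chosen trace comes from some unspecified approximating sequence; the trace inequality
applied to its difference from `φ` identifies the limit. -/
theorem trace_toL2 (φ : smoothFun) : R.trace (R.toL2 φ) = R.toBoundary φ := by
  obtain ⟨ψ, h0, h1, h2, h3⟩ := R.isTrace_iff.1 (R.isTrace_trace (R.toL2_mem_H1 φ))
  rw [weakDeriv_toL2] at h1 h2
  obtain ⟨C, hC⟩ := R.exists_norm_toBoundary_le
  refine tendsto_nhds_unique h3 (tendsto_iff_norm_sub_tendsto_zero.2 ?_)
  have c0 := tendsto_iff_norm_sub_tendsto_zero.1 h0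
  have c1 := tendsto_iff_norm_sub_tendsto_zero.1 h1
  have c2 := tendsto_iff_norm_sub_tendsto_zero.1 h2
  have := ((c0.const_mul C).add c1).add c2
  rw [mul_zero, add_zero, add_zero] at this
  refine squeeze_zero (fun _ => norm_nonneg _) (fun n => ?_) this
  simp only [← map_sub]
  exact hC _

/-- The Robin energy, the numerator of the Rayleigh quotient. -/
noncomputable def energy (a : ℝ) (u : R.L2) : ℝ :=
  ‖R.weakDeriv (1, 0) u‖ ^ 2 + ‖R.weakDeriv (0, 1) u‖ ^ 2 + a * ‖R.trace u‖ ^ 2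

theorem rayleigh_eq (a : ℝ) (u : R.L2) : R.rayleigh a u = R.energy a u / ‖u‖ ^ 2 := by
  rw [rayleigh, energy, norm_sq_Lp, norm_sq_Lp, norm_sq_Lp, norm_sq_Lp,
    integral_add (Lp.memLp _).integrable_sq (Lp.memLp _).integrable_sq]

theorem energy_toL2 (a : ℝ) (φ : smoothFun) : R.energy a (R.toL2 φ) =
    ‖R.toL2 (pderiv (1, 0) φ)‖ ^ 2 + ‖R.toL2 (pderiv (0, 1) φ)‖ ^ 2 +
      a * ‖R.toBoundary φ‖ ^ 2 := by
  rw [energy, weakDeriv_toL2, weakDeriv_toL2, trace_toL2]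

/-- Every function in `H¹` is a limit of smooth functions with convergence of the energies. -/
theorem exists_tendsto_energy {u : R.L2} (hu : u ∈ R.H1) : ∃ φ : ℕ → smoothFun,
    Tendsto (fun n => R.toL2 (φ n)) atTop (𝓝 u) ∧
      ∀ a, Tendsto (fun n => R.energy a (R.toL2 (φ n))) atTop (𝓝 (R.energy a u)) := by
  obtain ⟨φ, h0, h1, h2, h3⟩ := R.isTrace_iff.1 (R.isTrace_trace hu)
  refine ⟨φ, h0, fun a => ?_⟩
  simp only [energy_toL2]
  exact ((h1.norm.pow 2).add (h2.norm.pow 2)).add ((h3.norm.pow 2).const_mul a)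

theorem eigenvalue₁_le_energy (a : ℝ) {u : R.L2} (hu : u ∈ R.H1) :
    (intervalEigenvalue₁ a R.x₀ R.x₁ + intervalEigenvalue₁ a R.y₀ R.y₁) * ‖u‖ ^ 2 ≤
      R.energy a u := by
  obtain ⟨φ, h0, h1⟩ := R.exists_tendsto_energy hu
  refine le_of_tendsto_of_tendsto' ((h0.norm.pow 2).const_mul _) (h1 a) fun n => ?_
  rw [energy_toL2]
  exact R.eigenvalue₁_mul_le_energy a (φ n)

end Rect


/-! ### The energy bound by the second eigenvalue on a rectangle -/

theorem hasDerivAt_integral_fst {a b : ℝ} (φ : smoothFun) {v : ℝ → ℝ} (hv : Continuous v)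
    (y : ℝ) : HasDerivAt (fun y => ∫ x in a..b, φ.1 (x, y) * v x)
      (∫ x in a..b, (smoothFun.pderiv (0, 1) φ).1 (x, y) * v x) y := by
  have c0 := smoothFun.continuous φ
  have c1 := smoothFun.continuous (smoothFun.pderiv (0, 1) φ)
  have cF : ∀ y, Continuous fun x => φ.1 (x, y) * v x := fun y => by fun_prop
  have cF' : ∀ y, Continuous fun x => (smoothFun.pderiv (0, 1) φ).1 (x, y) * v x :=
    fun y => by fun_prop
  obtain ⟨C, hC⟩ := (isCompact_uIcc (a := a) (b := b)).prod
    (isCompact_Icc (a := y - 1) (b := y + 1)) |>.exists_bound_of_continuousOn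
    (f := fun z => (smoothFun.pderiv (0, 1) φ).1 z * v z.1)
    (Continuous.continuousOn (by fun_prop))
  refine (intervalIntegral.hasDerivAt_integral_of_dominated_loc_of_deriv_le
    (F := fun y x => φ.1 (x, y) * v x)
    (F' := fun y x => (smoothFun.pderiv (0, 1) φ).1 (x, y) * v x)
    (bound := fun _ => C) (s := Icc (y - 1) (y + 1)) (Icc_mem_nhds (by linarith) (by linarith))
    (Eventually.of_forall fun y => (cF y).aestronglyMeasurable)
    ((cF y).intervalIntegrable _ _) (cF' y).aestronglyMeasurable ?_
    (continuous_const.intervalIntegrable _ _) ?_).2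
  · exact Eventually.of_forall fun x hx y hy => hC (x, y) ⟨uIoc_subset_uIcc hx, hy⟩
  · exact Eventually.of_forall fun x _ y _ => (smoothFun.hasDerivAt_snd φ x y).mul_const _

/-- The bilinear form of the energy excess over `n` times the `L²` norm. -/
noncomputable def excessForm (β a b n : ℝ) (f g : ℝ → ℝ) : ℝ :=
  (∫ x in a..b, deriv f x * deriv g x) + β * (f a * g a + f b * g b) - n * ∫ x in a..b, f x * g x

theorem excessForm_self (β a b n : ℝ) (f : ℝ → ℝ) : excessForm β a b n f f =
    intervalEnergy β a b f - n * ∫ x in a..b, f x ^ 2 := by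
  simp only [excessForm, intervalEnergy, pow_two]

theorem excessForm_sub_smul (β a b n c : ℝ) {f g : ℝ → ℝ} (hf : ContDiff ℝ 1 f)
    (hg : ContDiff ℝ 1 g) :
    excessForm β a b n (fun x => f x - c * g x) (fun x => f x - c * g x) =
      excessForm β a b n f f - 2 * c * excessForm β a b n f g +
        c ^ 2 * excessForm β a b n g g := by
  have cf := hf.continuous
  have cg := hg.continuous
  have cf' := hf.continuous_deriv le_rfl
  have cg' := hg.continuous_deriv le_rfl
  have key : ∀ p q : ℝ → ℝ, Continuous p → Continuous q →
      ∫ x in a..b, (p x - c * q x) * (p x - c * q x) = (∫ x in a..b, p x * p x) -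
        2 * c * (∫ x in a..b, p x * q x) + c ^ 2 * ∫ x in a..b, q x * q x := by
    intro p q hp hq
    rw [← intervalIntegral.integral_const_mul, ← intervalIntegral.integral_const_mul,
      ← integral_sub_of_continuous, ← integral_add_of_continuous]
    · congr 1; funext x; ring
    all_goals fun_prop
  have d : deriv (fun x => f x - c * g x) = fun x => deriv f x - c * deriv g x :=
    funext fun x => ((hf.hasDerivAt_deriv_of_one x).sub
      ((hg.hasDerivAt_deriv_of_one x).const_mul c)).deriv
  simp only [excessForm, d]
  rw [key f g cf cg, key _ _ cf' cg']
  ring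

namespace Rect

variable (R : Rect)

open smoothFun

/-- The integral over horizontal slices against `v` does not increase the energy excess. -/
theorem excessForm_slice_le (β : ℝ) (φ : smoothFun) {v : ℝ → ℝ} (hv : Continuous v)
    (hv1 : ∫ x in R.x₀..R.x₁, v x ^ 2 = 1) {g : ℝ → ℝ}
    (hg : g = fun y => ∫ x in R.x₀..R.x₁, φ.1 (x, y) * v x) (hg1 : ContDiff ℝ 1 g) :
    excessForm β R.y₀ R.y₁ (intervalEigenvalue₁ β R.y₀ R.y₁) g g ≤
      (∫ x in R.x₀..R.x₁, intervalEnergy β R.y₀ R.y₁ (fun y => φ.1 (x, y))) -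
        intervalEigenvalue₁ β R.y₀ R.y₁ * ‖R.toL2 φ‖ ^ 2 := by
  set n := intervalEigenvalue₁ β R.y₀ R.y₁
  have c0 := smoothFun.continuous φ
  have c1 := smoothFun.continuous (pderiv (0, 1) φ)
  have cg := hg1.continuous
  have cg' := hg1.continuous_deriv le_rfl
  have dg : deriv g = fun y => ∫ x in R.x₀..R.x₁, (pderiv (0, 1) φ).1 (x, y) * v x := by
    rw [hg]; exact funext fun y => (hasDerivAt_integral_fst φ hv y).deriv
  set K := excessForm β R.y₀ R.y₁ n g g with hK
  set F : ℝ → ℝ := fun x => intervalEnergy β R.y₀ R.y₁ (fun y => φ.1 (x, y)) -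
    n * ∫ y in R.y₀..R.y₁, φ.1 (x, y) ^ 2 with hF
  set H : ℝ → ℝ := fun x => excessForm β R.y₀ R.y₁ n (fun y => φ.1 (x, y)) g with hH
  -- This is the energy excess of `φ(x, ·) - v(x) g`, nonnegative because `n` is the first
  -- eigenvalue in the vertical direction.
  have nonneg : ∀ x, 0 ≤ F x - 2 * (v x * H x) + K * v x ^ 2 := by
    intro x
    have s1 : ContDiff ℝ 1 fun y => φ.1 (x, y) := (contDiff_snd φ x).of_le (by simp)
    have e := excessForm_sub_smul β R.y₀ R.y₁ n (v x) s1 hg1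
    have s2 : ContDiff ℝ 1 fun y => φ.1 (x, y) - v x * g y :=
      s1.sub (contDiff_const.mul hg1)
    have := intervalEigenvalue₁_mul_le R.hy β s2
    rw [excessForm_self, excessForm_self] at e
    simp only [hF, hH, hK]
    linarith
  have p1 : Continuous fun z : ℝ × ℝ => (pderiv (0, 1) φ).1 z * deriv g z.2 := by fun_prop
  have p2 : Continuous fun z : ℝ × ℝ => φ.1 z * g z.2 := by fun_prop
  have q1 := continuous_integral_snd p1 R.y₀ R.y₁
  have q2 := continuous_integral_snd p2 R.y₀ R.y₁
  have Hdef : ∀ x, H x = (∫ y in R.y₀..R.y₁, (pderiv (0, 1) φ).1 (x, y) * deriv g y) +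
      β * (φ.1 (x, R.y₀) * g R.y₀ + φ.1 (x, R.y₁) * g R.y₁) -
      n * ∫ y in R.y₀..R.y₁, φ.1 (x, y) * g y := fun x => by
    simp only [hH, excessForm, (hasDerivAt_snd φ x _).deriv]
  have cH : Continuous H := by
    rw [show H = _ from funext Hdef]
    fun_prop
  have q3 := continuous_integral_snd (c0.pow 2) R.y₀ R.y₁
  have cF : Continuous F := (continuous_intervalEnergy_snd φ _ _ _).sub (continuous_const.mul q3)
  have fubini : ∀ (ψ : ℝ × ℝ → ℝ), Continuous ψ → ∀ k : ℝ → ℝ, Continuous k →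
      ∫ x in R.x₀..R.x₁, v x * (∫ y in R.y₀..R.y₁, ψ (x, y) * k y) =
        ∫ y in R.y₀..R.y₁, (∫ x in R.x₀..R.x₁, ψ (x, y) * v x) * k y := by
    intro ψ hψ k hk
    have c : Continuous fun z : ℝ × ℝ => v z.1 * (ψ z * k z.2) := by fun_prop
    have h := (R.integral_area_eq c).symm.trans (R.integral_area_eq' c)
    simp only at h
    simp only [intervalIntegral.integral_const_mul] at h
    rw [h]
    congr 1
    funext y
    rw [← intervalIntegral.integral_mul_const]
    congr 1
    funext x
    ring
  have slice : ∀ y, ∫ x in R.x₀..R.x₁, v x * (φ.1 (x, y) * g y) = g y * g y := by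
    intro y
    have hgy : ∫ x in R.x₀..R.x₁, φ.1 (x, y) * v x = g y := by rw [hg]
    have : ∫ x in R.x₀..R.x₁, v x * (φ.1 (x, y) * g y) =
        (∫ x in R.x₀..R.x₁, φ.1 (x, y) * v x) * g y := by
      rw [← intervalIntegral.integral_mul_const]
      congr 1
      funext x
      ring
    rw [this, hgy]
  -- By Fubini the cross term contracts each slice to `g`. After integration in `x` the expression
  -- is `∫ F - 2K + K`, since `v` is normalized.
  have hvH : ∫ x in R.x₀..R.x₁, v x * H x = K := by
    have : (fun x => v x * H x) = fun x =>
        v x * (∫ y in R.y₀..R.y₁, (pderiv (0, 1) φ).1 (x, y) * deriv g y) +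
        β * (v x * (φ.1 (x, R.y₀) * g R.y₀) + v x * (φ.1 (x, R.y₁) * g R.y₁)) -
        n * (v x * ∫ y in R.y₀..R.y₁, φ.1 (x, y) * g y) := by
      funext x; rw [Hdef]; ring
    have t1 : Continuous fun x => v x *
        ∫ y in R.y₀..R.y₁, (pderiv (0, 1) φ).1 (x, y) * deriv g y := hv.mul q1
    have t2 : Continuous fun x => v x * ∫ y in R.y₀..R.y₁, φ.1 (x, y) * g y := hv.mul q2
    rw [this, integral_sub_of_continuous (by fun_prop) (by fun_prop),
      integral_add_of_continuous t1 (by fun_prop), intervalIntegral.integral_const_mul,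
      intervalIntegral.integral_const_mul, integral_add_of_continuous (by fun_prop)
      (by fun_prop), slice, slice, fubini _ c1 _ cg', fubini _ c0 _ cg, hK, excessForm, dg, hg]
  have total := intervalIntegral.integral_nonneg (μ := volume) R.hx.le
    fun x (_ : x ∈ Icc R.x₀ R.x₁) => nonneg x
  have cvH : Continuous fun x => 2 * (v x * H x) := by fun_prop
  have cFH : Continuous fun x => F x - 2 * (v x * H x) := cF.sub cvH
  rw [integral_add_of_continuous cFH (by fun_prop),
    integral_sub_of_continuous cF cvH, intervalIntegral.integral_const_mul,
    intervalIntegral.integral_const_mul, hvH, hv1] at total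
  have hFi : ∫ x in R.x₀..R.x₁, F x =
      (∫ x in R.x₀..R.x₁, intervalEnergy β R.y₀ R.y₁ (fun y => φ.1 (x, y))) -
        n * ‖R.toL2 φ‖ ^ 2 := by
    rw [norm_sq_toL2_eq_snd, ← intervalIntegral.integral_const_mul]
    exact integral_sub_of_continuous (continuous_intervalEnergy_snd φ _ _ _)
      (continuous_const.mul q3)
  linarith

/-- If the spectral gaps in both directions agree, the energy is bounded below by the second
eigenvalue up to a correction in the direction of the ground state. -/
theorem exists_gap_energy_le (β : ℝ)
    (hx : oddEigenvalue (β * ((R.x₁ - R.x₀) / 2)) ≤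
      Real.pi ^ 2 + 2 * evenEigenvalue (β * ((R.x₁ - R.x₀) / 2)))
    (hy : oddEigenvalue (β * ((R.y₁ - R.y₀) / 2)) ≤
      Real.pi ^ 2 + 2 * evenEigenvalue (β * ((R.y₁ - R.y₀) / 2)))
    (hgap : intervalEigenvalue₂ β R.x₀ R.x₁ - intervalEigenvalue₁ β R.x₀ R.x₁ ≤
      intervalEigenvalue₂ β R.y₀ R.y₁ - intervalEigenvalue₁ β R.y₀ R.y₁) :
    ∃ e : smoothFun, ∀ u ∈ R.H1,
      (intervalEigenvalue₂ β R.x₀ R.x₁ + intervalEigenvalue₁ β R.y₀ R.y₁) * ‖u‖ ^ 2 ≤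
        R.energy β u + (intervalEigenvalue₂ β R.y₀ R.y₁ - intervalEigenvalue₁ β R.y₀ R.y₁) *
          (inner ℝ u (R.toL2 e)) ^ 2 := by
  obtain ⟨v, v', hv, hv', _, Gx⟩ := exists_intervalModes R.hx β
  obtain ⟨w, w', hw, hw', _, Gy⟩ := exists_intervalModes R.hy β
  have Gx := Gx hx
  have Gy := Gy hy
  have cv := hv.smooth.continuous
  have cw := hw.smooth.continuous
  refine ⟨tensor hv.smooth hw.smooth, fun u hu => ?_⟩
  obtain ⟨φ, h0, h1⟩ := R.exists_tendsto_energy hu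
  refine le_of_tendsto_of_tendsto' ((h0.norm.pow 2).const_mul _) ((h1 β).add
    (((h0.inner tendsto_const_nhds).pow 2).const_mul _)) fun k => ?_
  generalize φ k = φ
  have c0 := smoothFun.continuous φ
  have c1 := smoothFun.continuous (pderiv (0, 1) φ)
  set g : ℝ → ℝ := fun y => ∫ x in R.x₀..R.x₁, φ.1 (x, y) * v x with hg
  have hg1 : ContDiff ℝ 1 g := by
    rw [contDiff_one_iff_deriv]
    refine ⟨fun y => (hasDerivAt_integral_fst φ cv y).differentiableAt, ?_⟩
    rw [show deriv g = _ from funext fun y => (hasDerivAt_integral_fst φ cv y).deriv]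
    exact continuous_integral_fst (ψ := fun z => (pderiv (0, 1) φ).1 z * v z.1) (by fun_prop) _ _
  have s1 := R.excessForm_slice_le β φ cv hv.norm hg hg1
  rw [excessForm_self] at s1
  have s2 := Gy g hg1
  have e1 : inner ℝ (R.toL2 φ) (R.toL2 (tensor hv.smooth hw.smooth)) =
      ∫ y in R.y₀..R.y₁, g y * w y := by
    rw [inner_toL2_toL2, R.integral_area_eq' (ψ := fun z =>
      φ.1 z * (tensor hv.smooth hw.smooth).1 z) (by
        simp only [tensor_apply]; fun_prop)]
    congr 1
    funext y
    rw [hg, ← intervalIntegral.integral_mul_const]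
    congr 1
    funext x
    rw [tensor_apply]
    ring
  have s3 : intervalEigenvalue₂ β R.x₀ R.x₁ * ‖R.toL2 φ‖ ^ 2 ≤
      (∫ y in R.y₀..R.y₁, intervalEnergy β R.x₀ R.x₁ (fun x => φ.1 (x, y))) +
        (intervalEigenvalue₂ β R.x₀ R.x₁ - intervalEigenvalue₁ β R.x₀ R.x₁) *
          ∫ y in R.y₀..R.y₁, g y ^ 2 := by
    have cg := hg1.continuous
    have cE := continuous_intervalEnergy_fst φ β R.x₀ R.x₁
    rw [norm_sq_toL2_eq_fst, ← intervalIntegral.integral_const_mul,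
      ← intervalIntegral.integral_const_mul, ← integral_add_of_continuous cE (by fun_prop)]
    exact integral_mono_of_continuous R.hy.le
      (continuous_const.mul (continuous_integral_fst (c0.pow 2) _ _)) (by fun_prop)
      fun y => Gx _ ((contDiff_fst φ y).of_le (by simp))
  have hgg : 0 ≤ ∫ y in R.y₀..R.y₁, g y ^ 2 :=
    intervalIntegral.integral_nonneg R.hy.le fun y _ => sq_nonneg _
  rw [energy_toL2, energy_eq_integral_slices, e1]
  -- `s3` costs the horizontal gap times `∫ g²`. The vertical gap is at least as large, and `s2`
  -- with `s1` pays for it out of the vertical energy excess, leaving only the rank-one term.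
  nlinarith [mul_le_mul_of_nonneg_right hgap hgg]

end Rect


/-! ### The minimax principle for the second eigenvalue -/

namespace Rect

variable (R : Rect)

open smoothFun

/-- The bilinear form of the Robin energy. -/
noncomputable def robinForm (a : ℝ) (φ ψ : smoothFun) : ℝ :=
  inner ℝ (R.toL2 (pderiv (1, 0) φ)) (R.toL2 (pderiv (1, 0) ψ)) +
    inner ℝ (R.toL2 (pderiv (0, 1) φ)) (R.toL2 (pderiv (0, 1) ψ)) +
    a * inner ℝ (R.toBoundary φ) (R.toBoundary ψ)

theorem energy_combination (a s t : ℝ) (φ ψ : smoothFun) :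
    R.energy a (R.toL2 (s • φ + t • ψ)) =
      s ^ 2 * R.robinForm a φ φ + 2 * (s * t) * R.robinForm a φ ψ + t ^ 2 * R.robinForm a ψ ψ := by
  have key : ∀ {E : Type} [NormedAddCommGroup E] [InnerProductSpace ℝ E] (x y : E),
      ‖s • x + t • y‖ ^ 2 = s ^ 2 * inner ℝ x x + 2 * (s * t) * inner ℝ x y +
        t ^ 2 * inner ℝ y y := by
    intro E _ _ x y
    rw [norm_add_sq_real, norm_smul, norm_smul, mul_pow, mul_pow, real_inner_self_eq_norm_sq,
      real_inner_self_eq_norm_sq, inner_smul_left, inner_smul_right, Real.norm_eq_abs,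
      Real.norm_eq_abs, sq_abs, sq_abs]
    simp only [conj_trivial]
    ring
  rw [energy_toL2]
  simp only [map_add, map_smul]
  rw [key, key, key, robinForm, robinForm, robinForm]
  ring

theorem inner_toBoundary_toBoundary (φ ψ : smoothFun) :
    inner ℝ (R.toBoundary φ) (R.toBoundary ψ) = ∫ z, φ.1 z * ψ.1 z ∂(R.boundaryMeasure) := by
  rw [L2.inner_def]
  refine integral_congr_ae ?_
  filter_upwards [R.coeFn_toBoundary φ, R.coeFn_toBoundary ψ] with z h1 h2
  rw [h1, h2]; simp [mul_comm]

section Tensor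

variable {f g f' g' : ℝ → ℝ} (hf : ContDiff ℝ ∞ f) (hg : ContDiff ℝ ∞ g)
  (hf' : ContDiff ℝ ∞ f') (hg' : ContDiff ℝ ∞ g')

theorem inner_tensor : inner ℝ (R.toL2 (tensor hf hg)) (R.toL2 (tensor hf' hg')) =
    (∫ x in R.x₀..R.x₁, f x * f' x) * ∫ y in R.y₀..R.y₁, g y * g' y := by
  have := hf.continuous
  have := hg.continuous
  have := hf'.continuous
  have := hg'.continuous
  rw [inner_toL2_toL2, R.integral_area_eq (ψ := fun z =>
    (tensor hf hg).1 z * (tensor hf' hg').1 z) (by simp only [tensor_apply]; fun_prop),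
    ← intervalIntegral.integral_mul_const]
  congr 1
  funext x
  rw [← intervalIntegral.integral_const_mul]
  congr 1
  funext y
  rw [tensor_apply, tensor_apply]
  ring

theorem inner_toBoundary_tensor :
    inner ℝ (R.toBoundary (tensor hf hg)) (R.toBoundary (tensor hf' hg')) =
      (∫ x in R.x₀..R.x₁, f x * f' x) * (g R.y₀ * g' R.y₀ + g R.y₁ * g' R.y₁) +
        (f R.x₀ * f' R.x₀ + f R.x₁ * f' R.x₁) * ∫ y in R.y₀..R.y₁, g y * g' y := by
  have := hf.continuous
  have := hg.continuous
  have := hf'.continuous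
  have := hg'.continuous
  rw [inner_toBoundary_toBoundary, R.integral_boundary_eq (ψ := fun z =>
    (tensor hf hg).1 z * (tensor hf' hg').1 z) (by simp only [tensor_apply]; fun_prop),
    ← intervalIntegral.integral_mul_const, ← intervalIntegral.integral_const_mul]
  congr 1
  · congr 1
    funext x
    simp only [tensor_apply]
    ring
  · congr 1
    funext y
    simp only [tensor_apply]
    ring

end Tensor

/-- The boundary integral of a product splits into the endpoint terms of the two one-dimensional
weak equations, so the eigenvalues add. -/
theorem robinForm_tensor {β m n : ℝ} {v w v' w' : ℝ → ℝ}
    (hv : IntervalMode β R.x₀ R.x₁ m v) (hw : IntervalMode β R.y₀ R.y₁ n w)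
    (hv' : ContDiff ℝ ∞ v') (hw' : ContDiff ℝ ∞ w') :
    R.robinForm β (tensor hv.smooth hw.smooth) (tensor hv' hw') =
      (m + n) * ((∫ x in R.x₀..R.x₁, v x * v' x) * ∫ y in R.y₀..R.y₁, w y * w' y) := by
  have e1 := hv.weak v' (hv'.of_le (by simp))
  have e2 := hw.weak w' (hw'.of_le (by simp))
  rw [robinForm, pderiv_fst_tensor, pderiv_fst_tensor, pderiv_snd_tensor, pderiv_snd_tensor,
    inner_tensor, inner_tensor, inner_toBoundary_tensor]
  linear_combination (∫ y in R.y₀..R.y₁, w y * w' y) * e1 + (∫ x in R.x₀..R.x₁, v x * v' x) * e2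

theorem le_rayleigh (a : ℝ) {u : R.L2} (hu : u ∈ R.H1) (h0 : u ≠ 0) :
    intervalEigenvalue₁ a R.x₀ R.x₁ + intervalEigenvalue₁ a R.y₀ R.y₁ ≤ R.rayleigh a u := by
  rw [rayleigh_eq, le_div_iff₀ (pow_pos (norm_pos_iff.2 h0) 2)]
  exact R.eigenvalue₁_le_energy a hu

/-- Needed before an infimum can be bounded above: a real `sInf` over a set unbounded below carries
no information. -/
theorem bddBelow_minimax (a : ℝ) (k : ℕ) : BddBelow {Λ : ℝ | ∃ U : Submodule ℝ R.L2, U ≤ R.H1 ∧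
    Module.finrank ℝ U = k ∧ IsGreatest {r : ℝ | ∃ u ∈ U, u ≠ 0 ∧ R.rayleigh a u = r} Λ} := by
  refine ⟨intervalEigenvalue₁ a R.x₀ R.x₁ + intervalEigenvalue₁ a R.y₀ R.y₁, ?_⟩
  rintro Λ ⟨U, hU, _, ⟨u, hu, h0, rfl⟩, _⟩
  exact R.le_rayleigh a (hU hu) h0

/-- On the span of an orthonormal pair that diagonalizes the form, the Rayleigh quotient is a
weighted mean of `Λ₁` and `Λ₂`, so its maximum `Λ₂` is attained at `ψ`. -/
theorem mem_minimax {a Λ₁ Λ₂ : ℝ} (hΛ : Λ₁ ≤ Λ₂) {φ ψ : smoothFun}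
    (h1 : inner ℝ (R.toL2 φ) (R.toL2 φ) = 1) (h2 : inner ℝ (R.toL2 ψ) (R.toL2 ψ) = 1)
    (h12 : inner ℝ (R.toL2 φ) (R.toL2 ψ) = 0) (e1 : R.robinForm a φ φ = Λ₁)
    (e2 : R.robinForm a ψ ψ = Λ₂) (e12 : R.robinForm a φ ψ = 0) :
    ∃ U : Submodule ℝ R.L2, U ≤ R.H1 ∧ Module.finrank ℝ U = 2 ∧
      IsGreatest {r : ℝ | ∃ u ∈ U, u ≠ 0 ∧ R.rayleigh a u = r} Λ₂ := by
  set x := R.toL2 φ with hx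
  set y := R.toL2 ψ with hy
  have hyx : inner ℝ y x = 0 := by rw [real_inner_comm]; exact h12
  have hli : LinearIndependent ℝ ![x, y] := by
    rw [LinearIndependent.pair_iff]
    intro s t hst
    have a1 := congrArg (fun z => inner ℝ z x) hst
    have a2 := congrArg (fun z => inner ℝ z y) hst
    simp only [inner_add_left, inner_smul_left, inner_zero_left, h1, h2, h12, hyx,
      conj_trivial, mul_zero, mul_one, add_zero, zero_add] at a1 a2
    exact ⟨a1, a2⟩
  have hr : Set.range ![x, y] = {x, y} := by simp [Matrix.range_cons, Set.pair_comm]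
  have hfin := finrank_span_eq_card hli
  rw [hr, Fintype.card_fin] at hfin
  have hray : ∀ s t : ℝ, R.rayleigh a (s • x + t • y) =
      (s ^ 2 * Λ₁ + t ^ 2 * Λ₂) / (s ^ 2 + t ^ 2) := by
    intro s t
    rw [rayleigh_eq, ← real_inner_self_eq_norm_sq]
    congr 1
    · rw [hx, hy, ← map_smul, ← map_smul, ← map_add, energy_combination, e1, e2, e12]
      ring
    · simp only [inner_add_left, inner_add_right, inner_smul_left, inner_smul_right, h1, h2, h12,
        hyx, conj_trivial]
      ring
  have hy0 : y ≠ 0 := by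
    rintro h
    rw [h, inner_zero_left] at h2
    exact zero_ne_one h2
  refine ⟨Submodule.span ℝ {x, y}, ?_, hfin, ?_, ?_⟩
  · rw [Submodule.span_le]
    rintro z (rfl | rfl)
    · exact R.toL2_mem_H1 φ
    · exact R.toL2_mem_H1 ψ
  · refine ⟨y, Submodule.subset_span (by simp), hy0, ?_⟩
    have := hray 0 1
    simpa using this
  · rintro r ⟨u, hu, h0, rfl⟩
    obtain ⟨s, t, rfl⟩ := Submodule.mem_span_pair.1 hu
    rw [hray]
    have hst : 0 < s ^ 2 + t ^ 2 := by
      refine lt_of_le_of_ne (by positivity) fun h => h0 ?_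
      have hs : s = 0 := by nlinarith [sq_nonneg s, sq_nonneg t]
      have ht : t = 0 := by nlinarith [sq_nonneg s, sq_nonneg t]
      rw [hs, ht, zero_smul, zero_smul, add_zero]
    rw [div_le_iff₀ hst]
    nlinarith [mul_le_mul_of_nonneg_left hΛ (sq_nonneg s)]

theorem exists_mem_minimax_fst (β : ℝ) : ∃ U : Submodule ℝ R.L2, U ≤ R.H1 ∧
    Module.finrank ℝ U = 2 ∧ IsGreatest {r : ℝ | ∃ u ∈ U, u ≠ 0 ∧ R.rayleigh β u = r}
      (intervalEigenvalue₂ β R.x₀ R.x₁ + intervalEigenvalue₁ β R.y₀ R.y₁) := by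
  obtain ⟨v, w, hv, hw, hvw, _⟩ := exists_intervalModes R.hx β
  obtain ⟨p, q, hp, _, _, _⟩ := exists_intervalModes R.hy β
  have nv := hv.norm
  have nw := hw.norm
  have np := hp.norm
  simp only [pow_two] at nv nw np
  refine R.mem_minimax (φ := tensor hv.smooth hp.smooth) (ψ := tensor hw.smooth hp.smooth)
    (add_le_add_left (intervalEigenvalue₁_le₂ R.hx β) _) ?_ ?_ ?_
    (R.robinForm_tensor hv hp _ _ |>.trans ?_)
    (R.robinForm_tensor hw hp _ _ |>.trans ?_) (R.robinForm_tensor hv hp _ _ |>.trans ?_)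
  · rw [inner_tensor, nv, np, mul_one]
  · rw [inner_tensor, nw, np, mul_one]
  · rw [inner_tensor, hvw, zero_mul]
  · rw [nv, np, mul_one, mul_one]
  · rw [nw, np, mul_one, mul_one]
  · rw [hvw, zero_mul, mul_zero]

theorem exists_mem_minimax_snd (β : ℝ) : ∃ U : Submodule ℝ R.L2, U ≤ R.H1 ∧
    Module.finrank ℝ U = 2 ∧ IsGreatest {r : ℝ | ∃ u ∈ U, u ≠ 0 ∧ R.rayleigh β u = r}
      (intervalEigenvalue₁ β R.x₀ R.x₁ + intervalEigenvalue₂ β R.y₀ R.y₁) := by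
  obtain ⟨v, w, hv, hw, hvw, _⟩ := exists_intervalModes R.hy β
  obtain ⟨p, q, hp, _, _, _⟩ := exists_intervalModes R.hx β
  have nv := hv.norm
  have nw := hw.norm
  have np := hp.norm
  simp only [pow_two] at nv nw np
  refine R.mem_minimax (φ := tensor hp.smooth hv.smooth) (ψ := tensor hp.smooth hw.smooth)
    (add_le_add_right (intervalEigenvalue₁_le₂ R.hy β) _) ?_ ?_ ?_
    (R.robinForm_tensor hp hv _ _ |>.trans ?_)
    (R.robinForm_tensor hp hw _ _ |>.trans ?_) (R.robinForm_tensor hp hv _ _ |>.trans ?_)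
  · rw [inner_tensor, nv, np, mul_one]
  · rw [inner_tensor, nw, np, mul_one]
  · rw [inner_tensor, hvw, mul_zero]
  · rw [nv, np, mul_one, mul_one]
  · rw [nw, np, mul_one, mul_one]
  · rw [hvw, mul_zero, mul_zero]

theorem robinEigenvalue_two_le_fst (β : ℝ) : R.robinEigenvalue β 2 ≤
    intervalEigenvalue₂ β R.x₀ R.x₁ + intervalEigenvalue₁ β R.y₀ R.y₁ :=
  csInf_le (R.bddBelow_minimax β 2) (R.exists_mem_minimax_fst β)

theorem robinEigenvalue_two_le_snd (β : ℝ) : R.robinEigenvalue β 2 ≤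
    intervalEigenvalue₁ β R.x₀ R.x₁ + intervalEigenvalue₂ β R.y₀ R.y₁ :=
  csInf_le (R.bddBelow_minimax β 2) (R.exists_mem_minimax_snd β)

/-- Every two-dimensional subspace contains a nonzero vector orthogonal to `e`, and there the
correction vanishes, whatever the sign of `k`. -/
theorem le_robinEigenvalue_two {β Λ k : ℝ} (e : R.L2)
    (h : ∀ u ∈ R.H1, Λ * ‖u‖ ^ 2 ≤ R.energy β u + k * (inner ℝ u e) ^ 2) :
    Λ ≤ R.robinEigenvalue β 2 := by
  refine le_csInf ⟨_, R.exists_mem_minimax_fst β⟩ ?_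
  rintro Λ' ⟨U, hU, hfin, hg⟩
  have : FiniteDimensional ℝ U := Module.finite_of_finrank_eq_succ hfin
  set f : U →ₗ[ℝ] ℝ := (innerSL ℝ e).toLinearMap.domRestrict U
  have hker : LinearMap.ker f ≠ ⊥ :=
    LinearMap.ker_ne_bot_of_finrank_lt (by rw [hfin, Module.finrank_self]; norm_num)
  obtain ⟨⟨u, hu⟩, hu0, hne⟩ := Submodule.exists_mem_ne_zero_of_ne_bot hker
  have hu0 : inner ℝ e u = 0 := hu0
  have hne : u ≠ 0 := fun h => hne (Subtype.ext h)
  refine le_trans ?_ (hg.2 ⟨u, hu, hne, rfl⟩)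
  have := h u (hU hu)
  rw [real_inner_comm, hu0] at this
  rw [rayleigh_eq, le_div_iff₀ (pow_pos (norm_pos_iff.2 hne) 2)]
  linarith

/-! ### The scaled second eigenvalue -/

/-- The width relative to half of the mean of width and height; it equals `1` for squares. -/
noncomputable def eccentricity : ℝ := 2 * R.width / (R.width + R.height)

theorem width_pos : 0 < R.width := sub_pos.2 R.hx

theorem height_pos : 0 < R.height := sub_pos.2 R.hy

theorem two_sub_eccentricity : 2 - R.eccentricity = 2 * R.height / (R.width + R.height) := by
  have := R.width_pos
  have := R.height_pos
  rw [eccentricity]; field_simp; ring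

theorem eccentricity_pos : 0 < R.eccentricity := by
  have := R.width_pos
  have := R.height_pos
  unfold eccentricity; positivity

theorem two_sub_eccentricity_pos : 0 < 2 - R.eccentricity := by
  have := R.width_pos
  have := R.height_pos
  rw [two_sub_eccentricity]; positivity

theorem isSquare_iff : R.IsSquare ↔ R.eccentricity = 1 := by
  have := R.width_pos
  have := R.height_pos
  rw [eccentricity, div_eq_one_iff_eq (by positivity), IsSquare]
  constructor <;> intro h <;> linarith

theorem robin_mul_half_width (α : ℝ) :
    α / R.perimeter * ((R.x₁ - R.x₀) / 2) = α / 8 * R.eccentricity := by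
  have := R.width_pos
  have := R.height_pos
  change α / R.perimeter * (R.width / 2) = _
  rw [eccentricity, perimeter]; field_simp; norm_num

theorem robin_mul_half_height (α : ℝ) :
    α / R.perimeter * ((R.y₁ - R.y₀) / 2) = α / 8 * (2 - R.eccentricity) := by
  have := R.width_pos
  have := R.height_pos
  change α / R.perimeter * (R.height / 2) = _
  rw [two_sub_eccentricity, perimeter]; field_simp; norm_num

theorem div_half_width_sq_mul_area (r : ℝ) : r / ((R.x₁ - R.x₀) / 2) ^ 2 * R.area =
    4 * (r * ((2 - R.eccentricity) / R.eccentricity)) := by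
  have := R.width_pos
  have := R.height_pos
  change r / (R.width / 2) ^ 2 * _ = _
  rw [two_sub_eccentricity, eccentricity, area]; field_simp; norm_num

theorem div_half_height_sq_mul_area (r : ℝ) : r / ((R.y₁ - R.y₀) / 2) ^ 2 * R.area =
    4 * (r * (R.eccentricity / (2 - R.eccentricity))) := by
  have := R.width_pos
  have := R.height_pos
  change r / (R.height / 2) ^ 2 * _ = _
  rw [two_sub_eccentricity, eccentricity, area]; field_simp; norm_num

theorem area_pos : 0 < R.area := mul_pos R.width_pos R.height_pos

theorem scaledSecondEigenvalue_le_snd (α : ℝ) :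
    R.scaledSecondEigenvalue α ≤ 4 * trialValue (α / 8) R.eccentricity := by
  refine (mul_le_mul_of_nonneg_right (R.robinEigenvalue_two_le_snd _) R.area_pos.le).trans_eq ?_
  rw [add_mul, intervalEigenvalue₁, intervalEigenvalue₂, div_half_width_sq_mul_area,
    div_half_height_sq_mul_area, robin_mul_half_width, robin_mul_half_height, trialValue]
  ring

theorem scaledSecondEigenvalue_le_fst (α : ℝ) :
    R.scaledSecondEigenvalue α ≤ 4 * trialValue (α / 8) (2 - R.eccentricity) := by
  refine (mul_le_mul_of_nonneg_right (R.robinEigenvalue_two_le_fst _) R.area_pos.le).trans_eq ?_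
  rw [add_mul, intervalEigenvalue₁, intervalEigenvalue₂, div_half_width_sq_mul_area,
    div_half_height_sq_mul_area, robin_mul_half_width, robin_mul_half_height, trialValue,
    sub_sub_cancel]
  ring

/-- Putting the second mode along the longer side makes `τ ≤ 1` in either orientation. -/
theorem exists_scaledSecondEigenvalue_le (α : ℝ) : ∃ τ, 0 < τ ∧ τ ≤ 1 ∧ (τ = 1 ↔ R.IsSquare) ∧
    R.scaledSecondEigenvalue α ≤ 4 * trialValue (α / 8) τ := by
  rw [isSquare_iff]
  rcases le_total R.eccentricity 1 with h | h
  · exact ⟨_, R.eccentricity_pos, h, Iff.rfl, R.scaledSecondEigenvalue_le_snd α⟩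
  · refine ⟨_, R.two_sub_eccentricity_pos, by linarith, ?_, R.scaledSecondEigenvalue_le_fst α⟩
    constructor <;> intro h <;> linarith

theorem le_scaledSecondEigenvalue (α : ℝ) :
    α - α ^ 2 / 2 / R.aspectRatio ≤ R.scaledSecondEigenvalue α := by
  have hw := R.width_pos
  have hh := R.height_pos
  have hτ := R.eccentricity_pos
  have hτ' := R.two_sub_eccentricity_pos
  -- No correction is needed for the crude bound `λ₂ ≥ λ₁`, which is sharp enough in the degenerate
  -- limit.
  have h1 := R.le_robinEigenvalue_two (k := 0) 0 fun u hu =>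
    (R.eigenvalue₁_le_energy (α / R.perimeter) hu).trans_eq (by rw [zero_mul, add_zero])
  have h2 := mul_le_mul_of_nonneg_right h1 R.area_pos.le
  refine le_trans ?_ h2
  rw [add_mul, intervalEigenvalue₁, intervalEigenvalue₁, div_half_width_sq_mul_area,
    div_half_height_sq_mul_area, robin_mul_half_width, robin_mul_half_height]
  have b1 := mul_le_mul_of_nonneg_right
    (self_sub_sq_le_evenEigenvalue (α / 8 * R.eccentricity)) (div_pos hτ' hτ).le
  have b2 := mul_le_mul_of_nonneg_right
    (self_sub_sq_le_evenEigenvalue (α / 8 * (2 - R.eccentricity))) (div_pos hτ hτ').le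
  have e1 : (α / 8 * R.eccentricity - (α / 8 * R.eccentricity) ^ 2) *
      ((2 - R.eccentricity) / R.eccentricity) =
      α / 8 * (2 - R.eccentricity) - (α / 8) ^ 2 * (R.eccentricity * (2 - R.eccentricity)) := by
    field_simp
  have e2 : (α / 8 * (2 - R.eccentricity) - (α / 8 * (2 - R.eccentricity)) ^ 2) *
      (R.eccentricity / (2 - R.eccentricity)) =
      α / 8 * R.eccentricity - (α / 8) ^ 2 * (R.eccentricity * (2 - R.eccentricity)) := by
    field_simp
  -- The left side is `4 M N / (M + N)²`, with `M` and `N` the longer and shorter sides, hence at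
  -- most `4 N / M`.
  have e3 : R.eccentricity * (2 - R.eccentricity) ≤ 4 / R.aspectRatio := by
    have hm : 0 < max R.width R.height := lt_max_of_lt_left hw
    have hwm := le_max_left R.width R.height
    have hprod := max_mul_min R.width R.height
    have hmin : 0 < min R.width R.height := lt_min hw hh
    rw [two_sub_eccentricity, eccentricity, aspectRatio, div_mul_div_comm, div_div_eq_mul_div,
      div_le_div_iff₀ (by positivity) hm]
    have hs : max R.width R.height + min R.width R.height = R.width + R.height :=
      max_add_min _ _
    rw [← hs, show 2 * R.width * (2 * R.height) = 4 * (R.width * R.height) by ring, ← hprod]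
    generalize max R.width R.height = M at *
    generalize min R.width R.height = N at *
    nlinarith [mul_pos hm hmin, mul_pos hmin hmin, mul_pos (mul_pos hm hmin) hmin,
      mul_pos (mul_pos hmin hmin) hmin]
  have e4 := mul_le_mul_of_nonneg_left e3 (show 0 ≤ 8 * (α / 8) ^ 2 by positivity)
  have e5 : 8 * (α / 8) ^ 2 * (4 / R.aspectRatio) = α ^ 2 / 2 / R.aspectRatio := by ring
  rw [e1] at b1
  rw [e2] at b2
  linarith

/-- Equal sides make the two spectral gaps equal, so `exists_gap_energy_le` supplies a lower bound
that meets the trial value. -/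
theorem scaledSecondEigenvalue_of_isSquare {α : ℝ} (hα : -9.3886 / 8 ≤ α / 8) (h : R.IsSquare) :
    R.scaledSecondEigenvalue α = 4 * (evenEigenvalue (α / 8) + oddEigenvalue (α / 8)) := by
  have hτ := R.isSquare_iff.1 h
  refine le_antisymm ?_ ?_
  · rw [← trialValue_one, ← hτ]
    exact R.scaledSecondEigenvalue_le_snd α
  · have hx := R.robin_mul_half_width α
    have hy := R.robin_mul_half_height α
    have hg := oddEigenvalue_le_pi_sq_add hα
    have hxy : R.x₁ - R.x₀ = R.y₁ - R.y₀ := h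
    rw [hτ, mul_one] at hx
    rw [hτ, show α / 8 * (2 - 1) = α / 8 by ring] at hy
    obtain ⟨e, he⟩ := R.exists_gap_energy_le (α / R.perimeter) (by rwa [hx]) (by rwa [hy])
      (by simp only [intervalEigenvalue₁, intervalEigenvalue₂, hxy]; exact le_rfl)
    have h1 := mul_le_mul_of_nonneg_right (R.le_robinEigenvalue_two _ he) R.area_pos.le
    refine le_trans (le_of_eq ?_) h1
    rw [add_mul, intervalEigenvalue₁, intervalEigenvalue₂, div_half_width_sq_mul_area,
      div_half_height_sq_mul_area, hx, hy, hτ]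
    norm_num
    ring

theorem tendsto_scaledSecondEigenvalue {α : ℝ}
    (h : ∀ R : Rect, R.scaledSecondEigenvalue α < α) :
    Tendsto (fun R : Rect => R.scaledSecondEigenvalue α) degenerating (𝓝 α) := by
  have h1 : Tendsto (fun R : Rect => α - α ^ 2 / 2 / R.aspectRatio) degenerating (𝓝 α) := by
    have : Tendsto (fun R : Rect => α ^ 2 / 2 / R.aspectRatio) degenerating (𝓝 0) :=
      tendsto_comap.const_div_atTop _
    simpa using tendsto_const_nhds.sub this
  exact tendsto_of_tendsto_of_tendsto_of_le_of_le h1 tendsto_const_nhds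
    (fun R => R.le_scaledSecondEigenvalue α) fun R => (h R).le

end Rect

theorem mainTheorem2 :
    ∃ αm αp : ℝ,
      (IsAlphaMinus αm ∧ ∀ a : ℝ, IsAlphaMinus a → a = αm) ∧ |αm - (-9.3885)| < 1e-4 ∧
      (IsAlphaPlus αp ∧ ∀ a : ℝ, IsAlphaPlus a → a = αp) ∧ |αp - 33.2054| < 1e-4 ∧
      (∀ α : ℝ, α ∈ Set.Icc αm αp → ∀ S : Rect, S.IsSquare →
        ∀ R : Rect, R.scaledSecondEigenvalue α ≤ S.scaledSecondEigenvalue α ∧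
          (R.scaledSecondEigenvalue α = S.scaledSecondEigenvalue α ↔ R.IsSquare)) ∧
      (∀ α : ℝ, α ∉ Set.Icc αm αp →
        (∀ R : Rect, R.scaledSecondEigenvalue α < α) ∧
        Filter.Tendsto (fun R : Rect => R.scaledSecondEigenvalue α) Rect.degenerating (nhds α)) := by
  obtain ⟨cm, hcm, hm⟩ := exists_squareExcess_eq_zero_left
  obtain ⟨cp, hcp, hp⟩ := exists_squareExcess_eq_zero_right
  have hcm0 : cm < 0 := by linarith [hcm.2]
  have hcp0 : 0 < cp := by linarith [hcp.1]
  have em : 8 * cm / 8 = cm := by ring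
  have ep : 8 * cp / 8 = cp := by ring
  refine ⟨8 * cm, 8 * cp, ⟨?_, fun a ha => ?_⟩, ?_, ⟨?_, fun a ha => ?_⟩, ?_, ?_, ?_⟩
  · rw [isAlphaMinus_iff, em]
    exact ⟨by linarith [hcm.2], hm⟩
  · rw [isAlphaMinus_iff] at ha
    have := eq_of_squareExcess_eq_zero hm ha.2
      (div_pos_of_neg_of_neg (by linarith [ha.1]) hcm0)
    linarith
  · rw [abs_lt]
    constructor <;> linarith [hcm.1, hcm.2]
  · rw [isAlphaPlus_iff, ep]
    exact ⟨by linarith, hp⟩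
  · rw [isAlphaPlus_iff] at ha
    have := eq_of_squareExcess_eq_zero hp ha.2 (div_pos (by linarith [ha.1]) hcp0)
    linarith
  · rw [abs_lt]
    constructor <;> linarith [hcp.1, hcp.2]
  · intro α hα S hS R
    have hc : α / 8 ∈ Icc cm cp := ⟨by linarith [hα.1], by linarith [hα.2]⟩
    have hc1 : -9.3886 / 8 ≤ α / 8 := hcm.1.le.trans hc.1
    have hD := squareExcess_nonneg hcm0 hcp0 hm hp hc
    rw [squareExcess] at hD
    rw [S.scaledSecondEigenvalue_of_isSquare hc1 hS]
    by_cases hR : R.IsSquare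
    · rw [R.scaledSecondEigenvalue_of_isSquare hc1 hR]
      exact ⟨le_rfl, iff_of_true rfl hR⟩
    · obtain ⟨τ, h0, h1, hτ, hle⟩ := R.exists_scaledSecondEigenvalue_le α
      have h1' : τ < 1 := lt_of_le_of_ne h1 fun h => hR (hτ.1 h)
      -- For a rectangle that is not a square `τ < 1`, so the comparison is strict; this also
      -- settles the equality case.
      have := trialValue_lt h0 h1' (by linarith)
        fun hneg => two_mul_self_sub_evenEigenvalue_lt hneg hc1
      have hlt : R.scaledSecondEigenvalue α <
          4 * (evenEigenvalue (α / 8) + oddEigenvalue (α / 8)) := by linarith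
      exact ⟨hlt.le, iff_of_false hlt.ne hR⟩
  · intro α hα
    have hc : α / 8 ∉ Icc cm cp := fun h => hα ⟨by linarith [h.1], by linarith [h.2]⟩
    have key : ∀ R : Rect, R.scaledSecondEigenvalue α < α := fun R => by
      obtain ⟨τ, h0, h1, _, hle⟩ := R.exists_scaledSecondEigenvalue_le α
      have := trialValue_lt_of_notMem hcm hcp0 hm hp hc h0 h1
      linarith
    exact ⟨key, Rect.tendsto_scaledSecondEigenvalue key⟩
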